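/- Let $q$ be a transcendental complex number, let $k,N$ be positive integers, and let $H_k$ be the Iwahori–Hecke algebra of type $A_{k-1}$ over $\mathbb C$, generated by $T_1,\dots,T_{k-1}$ with the relations $T_iT_{i+1}T_i=T_{i+1}T_iT_{i+1}$, $T_iT_j=T_jT_i$ for $|i-j|\ge 2$, and $T_i^2=(q-q^{-1})T_i+1$; write $T_w=T_{i_1}\cdots T_{i_r}$ for a reduced expression $w=s_{i_1}\cdots s_{i_r}$ in the symmetric group $S_k$. For a partition $\lambda\vdash k$ with conjugate $\lambda'$ let $\chi^\lambda$ be the character of the irreducible $H_k$-module (Specht module) labelled by $\lambda$, where $\lambda=(k)$ labels the one-dimensional module on which every $T_i$ acts as $q$; let $z_\lambda\in H_k$ be the minimal central idempotent belonging to this module, and let $t_\lambda=\sum_{w\in S_k}\chi^\lambda(T_w)\chi^\lambda(T_{w^{-1}})$. Let $h\mapsto h'$ be the antiautomorphism of $H_k$ with $T_i'=-T_i^{-1}$. Let $A_k\in H_k\otimes H_k$ be the image of the antisymmetrizer $\sum_{w\in S_k}(-1)^{\ell(w)}b_w$ of the group algebra of the braid group $B_k$ (where $b_w=b_{i_1}\cdots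 b_{i_r}$ for a reduced expression of $w$) under the algebra homomorphism with $b_i\mapsto T_i^{-1}\otimes T_i$. Then each $z_\lambda$ exists and is unique, $z_\lambda'=z_{\lambda'}$, $t_\lambda\neq 0$, and $$A_k=\sum_{\lambda\vdash k}t_\lambda\,\pi_\lambda,\qquad \pi_\lambda=t_\lambda^{-1}A_k\,(z_\lambda'\otimes z_\lambda),$$ where the $\pi_\lambda$ are mutually orthogonal idempotents: $\pi_\lambda^2=\pi_\lambda$, and $\pi_\lambda\pi_\mu=0$ for $\lambda\ne\mu$. Moreover $$(\mathrm{Tr}\otimes \mathrm{Tr})\,\pi_\lambda=s_{\lambda'}(x_1,\dots,x_N)\,s_\lambda(x_1,\dots,x_N).$$ Here $s_\lambda$ is the Schur polynomial, and $\mathrm{Tr}\colon H_k\to\mathbb C[x_1,\dots,x_N]$ is Ram's trace $$\mathrm{Tr}(h)=\sum_{c}x^c\,\mathrm{tr}(E_c\,\rho(h)),$$ the sum running over all $c\in\mathbb Z_{\ge0}^N$ with $c_1+\dots+c_N=k$, where $E_c$ is the projection of $(\mathbb C^N)^{\otimes k}$ onto the span of the basis tensors $e_{i_1}\otimes\cdots\otimes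 e_{i_k}$ in which each $e_j$ occurs $c_j$ times, and where $\rho$ is the representation of $H_k$ on $(\mathbb C^N)^{\otimes k}$ given on $v=e_{i_1}\otimes\cdots\otimes e_{i_k}$, with $s_n v$ obtained by exchanging the $n$-th and $(n+1)$-st factors, by $\rho(T_n)v=qv$ if $i_n=i_{n+1}$, $\rho(T_n)v=(q-q^{-1})v+s_nv$ if $i_n<i_{n+1}$, and $\rho(T_n)v=s_nv$ if $i_n>i_{n+1}$. The product on the right of the formula for $(\mathrm{Tr}\otimes\mathrm{Tr})\pi_\lambda$ is taken in $\mathbb C[x_1,\dots,x_N]$, i.e. $(\mathrm{Tr}\otimes\mathrm{Tr})(g\otimes h)=\mathrm{Tr}(g)\,\mathrm{Tr}(h)$. -/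

import Mathlib

open scoped TensorProduct

set_option linter.unusedSimpArgs false

noncomputable section

namespace HeckeA

/-! ### Symmetric group, words and lengths -/

/-- The simple transposition `s_i`, exchanging the positions `i` and `i + 1` (counted from `0`). -/
def simple (k : ℕ) (i : Fin (k - 1)) : Equiv.Perm (Fin k) :=
  Equiv.swap ⟨i.1, by omega⟩ ⟨i.1 + 1, by omega⟩

/-- The permutation `s_{i_1} ⋯ s_{i_r}` of a word `i_1, …, i_r`. -/
def wordProd {k : ℕ} (l : List (Fin (k - 1))) : Equiv.Perm (Fin k) :=
  (l.map (simple k)).prod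

theorem exists_wordProd {k : ℕ} (w : Equiv.Perm (Fin k)) :
    ∃ l : List (Fin (k - 1)), wordProd l = w := by
  cases k with
  | zero => exact ⟨[], Subsingleton.elim _ _⟩
  | succ n =>
    have hw : w ∈ Submonoid.closure (Set.range fun i : Fin n ↦ Equiv.swap i.castSucc i.succ) := by
      rw [Equiv.Perm.mclosure_swap_castSucc_succ]
      trivial
    induction hw using Submonoid.closure_induction with
    | mem x hx =>
      obtain ⟨i, rfl⟩ := hx
      exact ⟨[i], by simp [wordProd, simple]; rfl⟩
    | one => exact ⟨[], rfl⟩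
    | mul x y _ _ hx hy =>
      obtain ⟨l, rfl⟩ := hx
      obtain ⟨m, rfl⟩ := hy
      exact ⟨l ++ m, by simp [wordProd]⟩

/-- The length of a permutation: the least number of simple transpositions in a word for it. -/
def len {k : ℕ} (w : Equiv.Perm (Fin k)) : ℕ :=
  sInf {r | ∃ l : List (Fin (k - 1)), l.length = r ∧ wordProd l = w}

theorem exists_reduced {k : ℕ} (w : Equiv.Perm (Fin k)) :
    ∃ l : List (Fin (k - 1)), l.length = len w ∧ wordProd l = w :=
  Nat.sInf_mem (s := {r | ∃ l : List (Fin (k - 1)), l.length = r ∧ wordProd l = w})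
    (let ⟨l, hl⟩ := exists_wordProd w; ⟨l.length, l, rfl, hl⟩)

/-- A reduced expression of a permutation. Since reduced expressions are only used to form products
of elements that satisfy the braid relations, the choice does not matter. -/
def reducedWord {k : ℕ} (w : Equiv.Perm (Fin k)) : List (Fin (k - 1)) :=
  (exists_reduced w).choose

/-! ### The braid group and its antisymmetrizer -/

/-- The relators of Artin's braid group on `k` strands, whose generators are indexed by
`Fin (k - 1)`. -/
def braidRels (k : ℕ) : Set (FreeGroup (Fin (k - 1))) :=
  {r | (∃ i j : Fin (k - 1), i.1 + 1 = j.1 ∧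
        r = FreeGroup.of i * FreeGroup.of j * FreeGroup.of i *
          (FreeGroup.of j * FreeGroup.of i * FreeGroup.of j)⁻¹) ∨
      (∃ i j : Fin (k - 1), i.1 + 2 ≤ j.1 ∧
        r = FreeGroup.of i * FreeGroup.of j * (FreeGroup.of j * FreeGroup.of i)⁻¹)}

/-- Artin's braid group on `k` strands. -/
abbrev Braid (k : ℕ) : Type := PresentedGroup (braidRels k)

/-- The generator `b_i` of the braid group. -/
def braidGen (k : ℕ) (i : Fin (k - 1)) : Braid k := PresentedGroup.of i

/-- The lift `b_w = b_{i_1} ⋯ b_{i_r}` of a permutation with reduced expression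
`s_{i_1} ⋯ s_{i_r}`. -/
def braidLift {k : ℕ} (w : Equiv.Perm (Fin k)) : Braid k :=
  ((reducedWord w).map (braidGen k)).prod

/-- The antisymmetrizer `∑_w (-1)^{ℓ(w)} b_w` in the complex group algebra of the braid group. -/
def braidAntisymmetrizer (k : ℕ) : MonoidAlgebra ℂ (Braid k) :=
  ∑ w : Equiv.Perm (Fin k), (-1 : ℂ) ^ len w • MonoidAlgebra.of ℂ (Braid k) (braidLift w)

/-! ### The Iwahori–Hecke algebra of type A -/

/-- `q - q⁻¹`. -/
def qhat (q : ℂˣ) : ℂ := (q : ℂ) - (q : ℂ)⁻¹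

/-- The defining relations of the Iwahori–Hecke algebra: the braid relations and
`T_i ^ 2 = (q - q⁻¹) T_i + 1`. -/
inductive Rel (q : ℂˣ) (k : ℕ) :
    FreeAlgebra ℂ (Fin (k - 1)) → FreeAlgebra ℂ (Fin (k - 1)) → Prop
  | quad (i : Fin (k - 1)) :
      Rel q k (FreeAlgebra.ι ℂ i * FreeAlgebra.ι ℂ i) (qhat q • FreeAlgebra.ι ℂ i + 1)
  | braid (i j : Fin (k - 1)) (h : i.1 + 1 = j.1) :
      Rel q k (FreeAlgebra.ι ℂ i * FreeAlgebra.ι ℂ j * FreeAlgebra.ι ℂ i)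
        (FreeAlgebra.ι ℂ j * FreeAlgebra.ι ℂ i * FreeAlgebra.ι ℂ j)
  | comm (i j : Fin (k - 1)) (h : i.1 + 2 ≤ j.1) :
      Rel q k (FreeAlgebra.ι ℂ i * FreeAlgebra.ι ℂ j) (FreeAlgebra.ι ℂ j * FreeAlgebra.ι ℂ i)

/-- The Iwahori–Hecke algebra `H_k` of type `A_{k-1}` with parameter `q`. -/
def Hecke (q : ℂˣ) (k : ℕ) : Type := RingQuot (Rel q k)

instance (q : ℂˣ) (k : ℕ) : Ring (Hecke q k) := inferInstanceAs (Ring (RingQuot (Rel q k)))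

instance (q : ℂˣ) (k : ℕ) : Algebra ℂ (Hecke q k) :=
  inferInstanceAs (Algebra ℂ (RingQuot (Rel q k)))

/-- The generator `T_i` of `H_k`. -/
def T (q : ℂˣ) (k : ℕ) (i : Fin (k - 1)) : Hecke q k :=
  RingQuot.mkAlgHom ℂ (Rel q k) (FreeAlgebra.ι ℂ i)

theorem T_quad (q : ℂˣ) (k : ℕ) (i : Fin (k - 1)) : T q k i * T q k i = qhat q • T q k i + 1 := by
  have h := RingQuot.mkAlgHom_rel ℂ (Rel.quad (q := q) i)
  rwa [map_mul, map_add, map_smul, map_one] at h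

theorem T_braid (q : ℂˣ) (k : ℕ) (i j : Fin (k - 1)) (hij : i.1 + 1 = j.1) :
    T q k i * T q k j * T q k i = T q k j * T q k i * T q k j := by
  have h := RingQuot.mkAlgHom_rel ℂ (Rel.braid (q := q) i j hij)
  rwa [map_mul, map_mul, map_mul, map_mul] at h

theorem T_comm (q : ℂˣ) (k : ℕ) (i j : Fin (k - 1)) (hij : i.1 + 2 ≤ j.1) :
    T q k i * T q k j = T q k j * T q k i := by
  have h := RingQuot.mkAlgHom_rel ℂ (Rel.comm (q := q) i j hij)
  rwa [map_mul, map_mul] at h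

/-- The universal property of `H_k`. -/
def heckeLift (q : ℂˣ) (k : ℕ) {A : Type*} [Ring A] [Algebra ℂ A] (f : Fin (k - 1) → A)
    (hquad : ∀ i, f i * f i = qhat q • f i + 1)
    (hbraid : ∀ i j : Fin (k - 1), i.1 + 1 = j.1 → f i * f j * f i = f j * f i * f j)
    (hcomm : ∀ i j : Fin (k - 1), i.1 + 2 ≤ j.1 → f i * f j = f j * f i) :
    Hecke q k →ₐ[ℂ] A :=
  RingQuot.liftAlgHom ℂ ⟨FreeAlgebra.lift ℂ f, by
    intro x y h
    induction h with
    | quad i => simpa using hquad i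
    | braid i j h => simpa using hbraid i j h
    | comm i j h => simpa using hcomm i j h⟩

theorem heckeLift_T (q : ℂˣ) (k : ℕ) {A : Type*} [Ring A] [Algebra ℂ A] (f : Fin (k - 1) → A)
    (hquad : ∀ i, f i * f i = qhat q • f i + 1)
    (hbraid : ∀ i j : Fin (k - 1), i.1 + 1 = j.1 → f i * f j * f i = f j * f i * f j)
    (hcomm : ∀ i j : Fin (k - 1), i.1 + 2 ≤ j.1 → f i * f j = f j * f i) (i : Fin (k - 1)) :
    heckeLift q k f hquad hbraid hcomm (T q k i) = f i :=
  (RingQuot.liftAlgHom_mkAlgHom_apply ℂ (FreeAlgebra.lift ℂ f) _ _).trans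
    (FreeAlgebra.lift_ι_apply f i)

/-- The generator `T_i` as a unit, with inverse `T_i - (q - q⁻¹)`. -/
def Tunit (q : ℂˣ) (k : ℕ) (i : Fin (k - 1)) : (Hecke q k)ˣ where
  val := T q k i
  inv := T q k i - qhat q • 1
  val_inv := by rw [mul_sub, T_quad, mul_smul_comm, mul_one]; abel
  inv_val := by rw [sub_mul, T_quad, smul_mul_assoc, one_mul]; abel

theorem Tunit_braid (q : ℂˣ) (k : ℕ) (i j : Fin (k - 1)) (hij : i.1 + 1 = j.1) :
    Tunit q k i * Tunit q k j * Tunit q k i = Tunit q k j * Tunit q k i * Tunit q k j :=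
  Units.ext (T_braid q k i j hij)

theorem Tunit_comm (q : ℂˣ) (k : ℕ) (i j : Fin (k - 1)) (hij : i.1 + 2 ≤ j.1) :
    Tunit q k i * Tunit q k j = Tunit q k j * Tunit q k i :=
  Units.ext (T_comm q k i j hij)

/-- The basis element `T_w = T_{i_1} ⋯ T_{i_r}` for a reduced expression `w = s_{i_1} ⋯ s_{i_r}`. -/
def Tperm (q : ℂˣ) {k : ℕ} (w : Equiv.Perm (Fin k)) : Hecke q k :=
  ((reducedWord w).map (T q k)).prod

theorem neg_inv_quad (q : ℂˣ) (k : ℕ) (i : Fin (k - 1)) :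
    (-(↑(Tunit q k i)⁻¹ : Hecke q k)) * (-(↑(Tunit q k i)⁻¹ : Hecke q k)) =
      qhat q • (-(↑(Tunit q k i)⁻¹ : Hecke q k)) + 1 := by
  change (-(T q k i - qhat q • 1)) * (-(T q k i - qhat q • 1)) =
    qhat q • (-(T q k i - qhat q • 1)) + 1
  rw [neg_mul_neg, sub_mul, mul_sub, T_quad]
  simp only [mul_smul_comm, smul_mul_assoc, mul_one, one_mul, smul_sub, smul_neg]
  abel

/-- The antiautomorphism of `H_k` with `T_i ↦ -T_i⁻¹`, as a homomorphism to the opposite algebra. -/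
def primeOp (q : ℂˣ) (k : ℕ) : Hecke q k →ₐ[ℂ] (Hecke q k)ᵐᵒᵖ :=
  heckeLift q k (fun i ↦ MulOpposite.op (-(↑(Tunit q k i)⁻¹ : Hecke q k)))
    (fun i ↦ by
      rw [← MulOpposite.op_mul, neg_inv_quad]
      simp)
    (fun i j h ↦ by
      have := congrArg (fun u : (Hecke q k)ˣ ↦ (↑u⁻¹ : Hecke q k)) (Tunit_braid q k i j h)
      simp only [mul_inv_rev, Units.val_mul] at this
      refine MulOpposite.unop_injective ?_
      simp only [MulOpposite.unop_mul, MulOpposite.unop_op, neg_mul_neg, mul_neg, neg_mul, neg_neg,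
        this])
    (fun i j h ↦ by
      have := congrArg (fun u : (Hecke q k)ˣ ↦ (↑u⁻¹ : Hecke q k)) (Tunit_comm q k i j h)
      simp only [mul_inv_rev, Units.val_mul] at this
      refine MulOpposite.unop_injective ?_
      simp only [MulOpposite.unop_mul, MulOpposite.unop_op, neg_mul_neg, this])

/-- The involutive antiautomorphism `h ↦ h'` of `H_k` with `T_i' = -T_i⁻¹`. -/
def prime (q : ℂˣ) (k : ℕ) : Hecke q k →ₗ[ℂ] Hecke q k :=
  (MulOpposite.opLinearEquiv ℂ).symm.toLinearMap ∘ₗ (primeOp q k).toLinearMap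

/-! ### The image of the braid antisymmetrizer in `H_k ⊗ H_k` -/

/-- The unit `T_i⁻¹ ⊗ T_i` of `H_k ⊗ H_k`. -/
def sigmaUnit (q : ℂˣ) (k : ℕ) (i : Fin (k - 1)) : (Hecke q k ⊗[ℂ] Hecke q k)ˣ where
  val := (↑(Tunit q k i)⁻¹ : Hecke q k) ⊗ₜ[ℂ] (↑(Tunit q k i) : Hecke q k)
  inv := (↑(Tunit q k i) : Hecke q k) ⊗ₜ[ℂ] (↑(Tunit q k i)⁻¹ : Hecke q k)
  val_inv := by
    rw [Algebra.TensorProduct.tmul_mul_tmul, Units.inv_mul, Units.mul_inv]; rfl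
  inv_val := by
    rw [Algebra.TensorProduct.tmul_mul_tmul, Units.inv_mul, Units.mul_inv]; rfl

/-- The group homomorphism `b_i ↦ T_i⁻¹ ⊗ T_i` from the braid group to the units of
`H_k ⊗ H_k`. -/
def sigmaHom (q : ℂˣ) (k : ℕ) : Braid k →* (Hecke q k ⊗[ℂ] Hecke q k)ˣ :=
  PresentedGroup.toGroup (f := sigmaUnit q k) (by
    rintro r (⟨i, j, h, rfl⟩ | ⟨i, j, h, rfl⟩)
    · have h2 := congrArg (fun u : (Hecke q k)ˣ ↦ (↑u⁻¹ : Hecke q k)) (Tunit_braid q k i j h)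
      have h1 := congrArg (fun u : (Hecke q k)ˣ ↦ (↑u : Hecke q k)) (Tunit_braid q k i j h)
      simp only [mul_inv_rev, Units.val_mul] at h1 h2
      simp only [map_mul, map_inv, FreeGroup.lift_apply_of]
      rw [mul_inv_eq_one]
      ext
      simp only [Units.val_mul, sigmaUnit, Algebra.TensorProduct.tmul_mul_tmul]
      rw [h1, mul_assoc, h2, ← mul_assoc]
    · have h2 := congrArg (fun u : (Hecke q k)ˣ ↦ (↑u⁻¹ : Hecke q k)) (Tunit_comm q k i j h)
      have h1 := congrArg (fun u : (Hecke q k)ˣ ↦ (↑u : Hecke q k)) (Tunit_comm q k i j h)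
      simp only [mul_inv_rev, Units.val_mul] at h1 h2
      simp only [map_mul, map_inv, FreeGroup.lift_apply_of]
      rw [mul_inv_eq_one]
      ext
      simp only [Units.val_mul, sigmaUnit, Algebra.TensorProduct.tmul_mul_tmul]
      rw [h1, h2])

/-- The induced algebra homomorphism from the group algebra of the braid group. -/
def sigmaAlgHom (q : ℂˣ) (k : ℕ) : MonoidAlgebra ℂ (Braid k) →ₐ[ℂ] Hecke q k ⊗[ℂ] Hecke q k :=
  MonoidAlgebra.lift ℂ (Hecke q k ⊗[ℂ] Hecke q k) (Braid k)
    ((Units.coeHom (Hecke q k ⊗[ℂ] Hecke q k)).comp (sigmaHom q k))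

/-- The antisymmetrizer `A_k` in `H_k ⊗ H_k`. -/
def antisymmetrizer (q : ℂˣ) (k : ℕ) : Hecke q k ⊗[ℂ] Hecke q k :=
  sigmaAlgHom q k (braidAntisymmetrizer k)

/-! ### Partitions, Specht modules, characters and central idempotents -/

/-- Partitions of `k`, given by their Young diagrams. -/
abbrev Shape (k : ℕ) : Type := {μ : YoungDiagram // μ.card = k}

/-- The conjugate partition. -/
def Shape.conj {k : ℕ} (μ : Shape k) : Shape k :=
  ⟨μ.1.transpose, (Finset.card_map _).trans μ.2⟩

theorem shape_cells_subset {k : ℕ} (μ : Shape k) :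
    μ.1.cells ⊆ Finset.range k ×ˢ Finset.range k := by
  have key : ∀ ν : YoungDiagram, ν.card = k → ∀ i j, (i, j) ∈ ν → j < k := by
    intro ν hν i j hij
    rw [YoungDiagram.mem_iff_lt_rowLen, YoungDiagram.rowLen_eq_card] at hij
    exact hν ▸ lt_of_lt_of_le hij (Finset.card_le_card (Finset.filter_subset _ _))
  rintro ⟨i, j⟩ hc
  rw [YoungDiagram.mem_cells] at hc
  rw [Finset.mem_product, Finset.mem_range, Finset.mem_range]
  exact ⟨key _ μ.conj.2 j i (YoungDiagram.mem_transpose.mpr hc), key _ μ.2 i j hc⟩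

instance (k : ℕ) : Finite (Shape k) :=
  Finite.of_injective
    (fun μ : Shape k ↦ (⟨μ.1.cells, Finset.mem_powerset.mpr (shape_cells_subset μ)⟩ :
      (Finset.range k ×ˢ Finset.range k).powerset))
    (fun _ _ h ↦ Subtype.ext (YoungDiagram.ext (congrArg Subtype.val h)))

instance (k : ℕ) : Fintype (Shape k) := Fintype.ofFinite _

/-- Cut the positions `0, …, k - 1` into consecutive blocks of sizes `λ_1, λ_2, …`; this is the
number (counted from `0`) of the block that contains a position. -/
def block {k : ℕ} (μ : Shape k) (i : Fin k) : ℕ :=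
  ((Finset.range k).filter fun r ↦ ∑ j ∈ Finset.range (r + 1), μ.1.rowLen j ≤ i.1).card

/-- The Young subgroup `S_{λ_1} × S_{λ_2} × ⋯` of the symmetric group. -/
def youngSubgroup {k : ℕ} (μ : Shape k) : Finset (Equiv.Perm (Fin k)) :=
  Finset.univ.filter fun w ↦ ∀ i, block μ (w i) = block μ i

/-- The (unnormalized) symmetrizer of a Young subgroup; it satisfies `T_i x = q x` for the simple
transpositions `s_i` of the subgroup. -/
def symElt (q : ℂˣ) {k : ℕ} (μ : Shape k) : Hecke q k :=
  ∑ w ∈ youngSubgroup μ, (q : ℂ) ^ len w • Tperm q w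

/-- The (unnormalized) antisymmetrizer of a Young subgroup; it satisfies `T_i y = -q⁻¹ y` for the
simple transpositions `s_i` of the subgroup. -/
def altElt (q : ℂˣ) {k : ℕ} (μ : Shape k) : Hecke q k :=
  ∑ w ∈ youngSubgroup μ, (-(q : ℂ)⁻¹) ^ len w • Tperm q w

/-- The Specht module `S^λ` of `H_k`: the left ideal `H_k y_{λ'} H_k x_λ`. It is the irreducible
`H_k`-module labelled by `λ`; for `λ = (k)` every `T_i` acts on it by `q`, and for `λ = (1^k)`
by `-q⁻¹`. (The space `y_{λ'} H_k x_λ` is the line spanned by the usual Dipper–James generator.) -/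
def specht (q : ℂˣ) {k : ℕ} (μ : Shape k) : Submodule (Hecke q k) (Hecke q k) :=
  Submodule.span (Hecke q k) (Set.range fun h : Hecke q k ↦ altElt q μ.conj * h * symElt q μ)

/-- The irreducible character `χ^λ`. -/
def character (q : ℂˣ) {k : ℕ} (μ : Shape k) (h : Hecke q k) : ℂ :=
  LinearMap.trace ℂ (specht q μ) (Algebra.lsmul ℂ ℂ (specht q μ) h)

/-- `t_λ = ∑_w χ^λ(T_w) χ^λ(T_{w⁻¹})`. -/
def tval (q : ℂˣ) {k : ℕ} (μ : Shape k) : ℂ :=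
  ∑ w : Equiv.Perm (Fin k), character q μ (Tperm q w) * character q μ (Tperm q w⁻¹)

/-- `z` is a minimal (primitive) central idempotent of `H_k`, and it is the one belonging to the
irreducible module labelled by `λ`, on which it acts as the identity. -/
structure IsCentralIdempotentOf (q : ℂˣ) {k : ℕ} (μ : Shape k) (z : Hecke q k) : Prop where
  central : z ∈ Subalgebra.center ℂ (Hecke q k)
  idem : IsIdempotentElem z
  ne_zero : z ≠ 0
  minimal : ∀ e ∈ Subalgebra.center ℂ (Hecke q k), IsIdempotentElem e → e * z = e → e = 0 ∨ e = z
  acts : ∀ v ∈ specht q μ, z * v = v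

/-- The minimal central idempotent `z_λ`. -/
def centralIdempotent (q : ℂˣ) {k : ℕ} (μ : Shape k) : Hecke q k :=
  Classical.epsilon (IsCentralIdempotentOf q μ)

/-- `π_λ = t_λ⁻¹ A_k (z_λ' ⊗ z_λ)`, where `z_λ'` is the image of `z_λ` under the involution
`prime`. -/
def proj (q : ℂˣ) {k : ℕ} (μ : Shape k) : Hecke q k ⊗[ℂ] Hecke q k :=
  (tval q μ)⁻¹ • (antisymmetrizer q k *
    (prime q k (centralIdempotent q μ) ⊗ₜ[ℂ] centralIdempotent q μ))

/-! ### The action on `V^{⊗ k}` and Ram's trace -/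

/-- The tensor power `V^{⊗ k}` of `V = ℂ^N`, given by its basis `e_{i_1} ⊗ ⋯ ⊗ e_{i_k}`, which is
indexed by the words `i : Fin k → Fin N`. -/
abbrev TensorPower (k N : ℕ) : Type := (Fin k → Fin N) →₀ ℂ

/-- The value of the `R`-matrix on a basis vector, acting in the tensor factors `a` and `b`. -/
def rVec (q : ℂˣ) {k N : ℕ} (a b : Fin k) (v : Fin k → Fin N) : TensorPower k N :=
  if v a = v b then (q : ℂ) • Finsupp.single v 1
  else if v a < v b then
    qhat q • Finsupp.single v 1 + Finsupp.single (v ∘ Equiv.swap a b) 1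
  else Finsupp.single (v ∘ Equiv.swap a b) 1

/-- The `R`-matrix acting in the tensor factors `a` and `b`. -/
def rOp (q : ℂˣ) {k : ℕ} (N : ℕ) (a b : Fin k) : Module.End ℂ (TensorPower k N) :=
  Finsupp.linearCombination ℂ (rVec q a b)

theorem rOp_single (q : ℂˣ) {k N : ℕ} (a b : Fin k) (v : Fin k → Fin N) :
    rOp q N a b (Finsupp.single v 1) = rVec q a b v := by
  simp [rOp]

theorem rOp_quad (q : ℂˣ) {k : ℕ} (N : ℕ) (a b : Fin k) :
    rOp q N a b * rOp q N a b = qhat q • rOp q N a b + 1 := by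
  have hq : (q : ℂ) ≠ 0 := q.ne_zero
  refine Finsupp.lhom_ext' fun v ↦ LinearMap.ext_ring ?_
  simp only [LinearMap.comp_apply, Finsupp.lsingle_apply, Module.End.mul_apply,
    LinearMap.add_apply, LinearMap.smul_apply, Module.End.one_apply, rOp_single]
  rcases lt_trichotomy (v a) (v b) with h | h | h
  · have hs : rVec q a b (v ∘ Equiv.swap a b) = Finsupp.single v 1 := by
      have : (v ∘ Equiv.swap a b) ∘ Equiv.swap a b = v := by ext; simp
      simp [rVec, h.ne', h.not_gt, this]
    have hv : rVec q a b v =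
        qhat q • Finsupp.single v 1 + Finsupp.single (v ∘ Equiv.swap a b) 1 := by
      simp [rVec, h.ne, h]
    rw [hv, map_add, map_smul, rOp_single, rOp_single, hs, hv]
  · have hv : rVec q a b v = (q : ℂ) • Finsupp.single v 1 := by simp [rVec, h]
    rw [hv, map_smul, rOp_single, hv, smul_smul, smul_smul]
    nth_rewrite 3 [← one_smul ℂ (Finsupp.single v (1 : ℂ))]
    rw [← add_smul]
    congr 1
    unfold qhat
    field_simp
    ring
  · have hs : rVec q a b (v ∘ Equiv.swap a b) =
        qhat q • Finsupp.single (v ∘ Equiv.swap a b) 1 + Finsupp.single v 1 := by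
      have : (v ∘ Equiv.swap a b) ∘ Equiv.swap a b = v := by ext; simp
      simp [rVec, h.ne, h, this]
    have hv : rVec q a b v = Finsupp.single (v ∘ Equiv.swap a b) 1 := by
      simp [rVec, h.ne', h.not_gt]
    rw [hv, rOp_single, hs]

theorem rOp_comm (q : ℂˣ) {k : ℕ} (N : ℕ) (a b c d : Fin k) (hac : a ≠ c) (had : a ≠ d)
    (hbc : b ≠ c) (hbd : b ≠ d) (hab : a ≠ b) (hcd : c ≠ d) :
    rOp q N a b * rOp q N c d = rOp q N c d * rOp q N a b := by
  refine Finsupp.lhom_ext' fun v ↦ LinearMap.ext_ring ?_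
  simp only [LinearMap.comp_apply, Finsupp.lsingle_apply, Module.End.mul_apply, rOp_single]
  have e1 : ∀ x : Fin k, x ≠ c → x ≠ d → (v ∘ Equiv.swap c d) x = v x := fun x h1 h2 ↦ by
    simp [Equiv.swap_apply_of_ne_of_ne h1 h2]
  have e2 : ∀ x : Fin k, x ≠ a → x ≠ b → (v ∘ Equiv.swap a b) x = v x := fun x h1 h2 ↦ by
    simp [Equiv.swap_apply_of_ne_of_ne h1 h2]
  have e3 : (v ∘ Equiv.swap a b) ∘ Equiv.swap c d = (v ∘ Equiv.swap c d) ∘ Equiv.swap a b := by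
    have h : Equiv.swap a b * Equiv.swap c d = Equiv.swap c d * Equiv.swap a b :=
      (Equiv.Perm.disjoint_swap_swap (by simp [*])).commute.eq
    exact congrArg (fun w : Equiv.Perm (Fin k) ↦ v ∘ w) h
  have f1 := e1 a hac had
  have f2 := e1 b hbc hbd
  have f3 := e2 c hac.symm hbc.symm
  have f4 := e2 d had.symm hbd.symm
  unfold rVec
  split_ifs <;>
    simp only [map_add, map_smul, rOp_single, rVec, f1, f2, f3, f4, *, if_true, if_false] <;>
    module

theorem rOp_braid (q : ℂˣ) {k : ℕ} (N : ℕ) (a b c : Fin k) (hab : a ≠ b) (hac : a ≠ c)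
    (hbc : b ≠ c) : rOp q N a b * rOp q N b c * rOp q N a b =
      rOp q N b c * rOp q N a b * rOp q N b c := by
  refine Finsupp.lhom_ext' fun v ↦ LinearMap.ext_ring ?_
  simp only [LinearMap.comp_apply, Finsupp.lsingle_apply, Module.End.mul_apply, rOp_single]
  have e1 : ∀ u : Fin k → Fin N, (u ∘ Equiv.swap a b) a = u b := fun u ↦ by simp
  have e2 : ∀ u : Fin k → Fin N, (u ∘ Equiv.swap a b) b = u a := fun u ↦ by simp
  have e3 : ∀ u : Fin k → Fin N, (u ∘ Equiv.swap a b) c = u c := fun u ↦ by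
    simp [Equiv.swap_apply_of_ne_of_ne hac.symm hbc.symm]
  have e4 : ∀ u : Fin k → Fin N, (u ∘ Equiv.swap b c) a = u a := fun u ↦ by
    simp [Equiv.swap_apply_of_ne_of_ne hab hac]
  have e5 : ∀ u : Fin k → Fin N, (u ∘ Equiv.swap b c) b = u c := fun u ↦ by simp
  have e6 : ∀ u : Fin k → Fin N, (u ∘ Equiv.swap b c) c = u b := fun u ↦ by simp
  have i1 : ∀ u : Fin k → Fin N, (u ∘ Equiv.swap a b) ∘ Equiv.swap a b = u := fun u ↦ by ext; simp
  have i2 : ∀ u : Fin k → Fin N, (u ∘ Equiv.swap b c) ∘ Equiv.swap b c = u := fun u ↦ by ext; simp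
  have br : ((v ∘ Equiv.swap a b) ∘ Equiv.swap b c) ∘ Equiv.swap a b =
      ((v ∘ Equiv.swap b c) ∘ Equiv.swap a b) ∘ Equiv.swap b c := by
    have h : Equiv.swap a b * Equiv.swap b c * Equiv.swap a b =
        Equiv.swap b c * Equiv.swap a b * Equiv.swap b c := by
      rw [Equiv.swap_mul_swap_mul_swap hab hac, Equiv.swap_comm a b, Equiv.swap_comm b c,
        Equiv.swap_mul_swap_mul_swap hbc.symm hac.symm, Equiv.swap_comm]
    exact congrArg (fun w : Equiv.Perm (Fin k) ↦ v ∘ w) h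
  have hq : (q : ℂ) ≠ 0 := q.ne_zero
  have hlt : ∀ {x y : Fin N}, x < y → ¬ y < x := fun h ↦ h.not_gt
  rcases lt_trichotomy (v a) (v b) with h1 | h1 | h1 <;>
  rcases lt_trichotomy (v b) (v c) with h2 | h2 | h2 <;>
  rcases lt_trichotomy (v a) (v c) with h3 | h3 | h3 <;>
  first
  | (exfalso; order)
  | (first | have n1 := h1.ne | skip
     first | have n1' := h1.ne' | skip
     first | have n2 := h2.ne | skip
     first | have n2' := h2.ne' | skip
     first | have n3 := h3.ne | skip
     first | have n3' := h3.ne' | skip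
     first | have m1 := hlt h1 | skip
     first | have m2 := hlt h2 | skip
     first | have m3 := hlt h3 | skip
     simp only [map_add, map_smul, rOp_single, rVec, e1, e2, e3, e4, e5, e6, i1, i2, br, h1, h2, h3,
       *, if_true, if_false, lt_irrefl]
     try unfold qhat
     try (match_scalars <;> field_simp <;> ring))

/-- The representation of `H_k` on `V^{⊗ k}`: `T_n` acts by the `R`-matrix in the tensor factors
`n` and `n + 1`. -/
def rho (q : ℂˣ) (k N : ℕ) : Hecke q k →ₐ[ℂ] Module.End ℂ (TensorPower k N) :=
  heckeLift q k (fun i ↦ rOp q N ⟨i.1, by omega⟩ ⟨i.1 + 1, by omega⟩)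
    (fun _ ↦ rOp_quad q N _ _)
    (fun i j h ↦ by
      obtain ⟨j, hj⟩ := j
      obtain rfl : i.1 + 1 = j := h
      refine rOp_braid q N _ _ _ ?_ ?_ ?_ <;> rw [Ne, Fin.ext_iff] <;> dsimp only <;> omega)
    (fun i j h ↦ by
      refine rOp_comm q N _ _ _ _ ?_ ?_ ?_ ?_ ?_ ?_ <;> rw [Ne, Fin.ext_iff] <;> dsimp only <;> omega)

/-- The content of a word: the number of occurrences of each letter. -/
def content {k N : ℕ} (v : Fin k → Fin N) (j : Fin N) : ℕ :=
  (Finset.univ.filter fun i ↦ v i = j).card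

/-- The projection `E_c` of `V^{⊗ k}` onto the span of the basis vectors of content `c`. -/
def contentProj (k N : ℕ) (c : Fin N → ℕ) : Module.End ℂ (TensorPower k N) :=
  Finsupp.linearCombination ℂ fun v : Fin k → Fin N ↦
    if content v = c then Finsupp.single v 1 else 0

/-- Ram's trace `Tr(h) = ∑_c x^c tr(E_c ρ(h))`, where `c` runs over the `N`-compositions of `k`. -/
def ramTrace (q : ℂˣ) (k N : ℕ) : Hecke q k →ₗ[ℂ] MvPolynomial (Fin N) ℂ :=
  ∑ c ∈ Finset.piAntidiag (Finset.univ : Finset (Fin N)) k,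
    MvPolynomial.monomial (Finsupp.equivFunOnFinite.symm c) ∘ₗ
      LinearMap.trace ℂ (TensorPower k N) ∘ₗ
        LinearMap.mulLeft ℂ (contentProj k N c) ∘ₗ (rho q k N).toLinearMap

/-- `Tr ⊗ Tr`, with values in `ℂ[x_1, …, x_N]`. -/
def ramTrace₂ (q : ℂˣ) (k N : ℕ) : Hecke q k ⊗[ℂ] Hecke q k →ₗ[ℂ] MvPolynomial (Fin N) ℂ :=
  LinearMap.mul' ℂ (MvPolynomial (Fin N) ℂ) ∘ₗ
    TensorProduct.map (ramTrace q k N) (ramTrace q k N)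

/-! ### Schur polynomials -/

/-- Semistandard tableaux of shape `μ` with entries in `{0, …, N - 1}`. -/
abbrev BoundedSSYT (μ : YoungDiagram) (N : ℕ) : Type :=
  {S : SemistandardYoungTableau μ // ∀ c ∈ μ.cells, S c.1 c.2 < N}

instance (μ : YoungDiagram) (N : ℕ) : Finite (BoundedSSYT μ N) :=
  Finite.of_injective
    (fun (S : BoundedSSYT μ N) (c : μ.cells) ↦ (⟨S.1 c.1.1 c.1.2, S.2 c.1 c.2⟩ : Fin N))
    (fun S S' h ↦ Subtype.ext (SemistandardYoungTableau.ext fun i j ↦ by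
      by_cases hc : (i, j) ∈ μ
      · exact congrArg Fin.val (congrFun h ⟨(i, j), hc⟩)
      · rw [S.1.zeros hc, S'.1.zeros hc]))

instance (μ : YoungDiagram) (N : ℕ) : Fintype (BoundedSSYT μ N) := Fintype.ofFinite _

/-- The Schur polynomial `s_μ(x_1, …, x_N)`, as the generating function of semistandard tableaux. -/
def schur (μ : YoungDiagram) (N : ℕ) : MvPolynomial (Fin N) ℂ :=
  ∑ S : BoundedSSYT μ N, ∏ c : μ.cells, MvPolynomial.X ⟨S.1 c.1.1 c.1.2, S.2 c.1 c.2⟩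

end HeckeA

end

open HeckeA

open scoped TensorProduct

set_option linter.unusedSectionVars false

noncomputable section

namespace HeckeA

/-! ### Inversions and lengths of permutations -/

section Perm

variable {k : ℕ}

/-! For transcendental `q` the algebra `H_k` is split semisimple, and this is made explicit. `psi`
is the seminormal representation on the functions on standard tableaux of all shapes at once. The
Jucys–Murphy elements act on it diagonally, by weights `q ^ (2 * content)` that separate the
tableaux, so the image contains every matrix unit whose two tableaux have the same shape. There are
`∑ (f^λ)² = k!` of these (`card_tabPair`), which is the dimension of `H_k` (`finrank_hecke`); hence
`mat` is injective and `H_k` is an algebra of block matrices. In this picture `z_λ` is the identity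
of the block `λ` (`zElt`), and `h ↦ h'` is matrix transposition combined with transposition of
tableaux and signs (`mat_prime`).

Because `T_i' = -T_i⁻¹`, the signs of the antisymmetrizer are absorbed: `A_k = ∑ T_{w⁻¹}' ⊗ T_w`
(`antisymmetrizer_eq`). This is the Casimir element `∑ T_{w⁻¹} ⊗ T_w` with the involution applied to
its first leg, so `A_k (a' ⊗ 1) = A_k (1 ⊗ a)`. Consequently `A_k (z_λ' ⊗ z_λ) = A_k (1 ⊗ z_λ)` and
`A_k² = A_k (1 ⊗ C)` with `C = ∑ T_{w⁻¹} T_w`. Schur orthogonality, a consequence of the Casimir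
identity, shows that `C` is the scalar `t_λ ≠ 0` on the block `λ` (`mat_casimir`). The spectral
decomposition is then just `1 = ∑ z_λ`.

For the traces, the main point is the Frobenius formula `Tr(h) = ∑_μ χ^μ(h) s_μ` (`ramTrace_eq`). A
weight space of the tensor power is the left ideal generated by a Young symmetrizer `x`, so the
trace of `h` on it is the trace of `y ↦ h y x` on `H_k`, divided by a Poincaré polynomial
(`trace_contentProj_mul`). That trace is `∑_μ χ^μ(h) χ^μ(x)`, and `χ^μ(x)` is the Poincaré
polynomial times a Kostka number, because the semistandard fillings index a basis of the invariants
(`chi_symOf`). Inserting `A_k (1 ⊗ z_λ)` and using orthogonality of characters leaves the single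
term `s_{λ'} s_λ`.

It remains to tie the Specht modules, defined as left ideals, to the blocks. A product `y_{λ'} h
x_λ` can only be nonzero on shapes that dominate `λ` and are dominated by `λ`, and on the block `λ`
it has rank at most one since `K_{λλ} = 1` (`exists_basis_specht`, `character_eq_chi`). -/

/-- The first of the two positions exchanged by `s_i`. -/
def lo (i : Fin (k - 1)) : Fin k := ⟨i.1, by omega⟩

/-- The second of the two positions exchanged by `s_i`. -/
def hi (i : Fin (k - 1)) : Fin k := ⟨i.1 + 1, by omega⟩

theorem simple_eq (i : Fin (k - 1)) : simple k i = Equiv.swap (lo i) (hi i) := rfl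

@[simp] theorem lo_val (i : Fin (k - 1)) : (lo i).1 = i.1 := rfl

@[simp] theorem hi_val (i : Fin (k - 1)) : (hi i).1 = i.1 + 1 := rfl

theorem lo_lt_hi (i : Fin (k - 1)) : lo i < hi i := by
  rw [Fin.lt_def]; simp

theorem lo_ne_hi (i : Fin (k - 1)) : lo i ≠ hi i := (lo_lt_hi i).ne

@[simp] theorem simple_lo (i : Fin (k - 1)) : simple k i (lo i) = hi i := Equiv.swap_apply_left _ _

@[simp] theorem simple_hi (i : Fin (k - 1)) : simple k i (hi i) = lo i := Equiv.swap_apply_right _ _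

theorem simple_of_ne (i : Fin (k - 1)) {x : Fin k} (h1 : x ≠ lo i) (h2 : x ≠ hi i) :
    simple k i x = x := Equiv.swap_apply_of_ne_of_ne h1 h2

@[simp] theorem simple_mul_self (i : Fin (k - 1)) : simple k i * simple k i = 1 :=
  Equiv.swap_mul_self _ _

@[simp] theorem simple_inv (i : Fin (k - 1)) : (simple k i)⁻¹ = simple k i := Equiv.swap_inv _ _

@[simp] theorem simple_simple (i : Fin (k - 1)) (x : Fin k) : simple k i (simple k i x) = x := by
  rw [← Equiv.Perm.mul_apply, simple_mul_self, Equiv.Perm.one_apply]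

theorem simple_lt_simple (i : Fin (k - 1)) {a b : Fin k} (hab : a < b)
    (h : ¬ (a = lo i ∧ b = hi i)) : simple k i a < simple k i b := by
  rw [simple_eq, Equiv.swap_apply_def, Equiv.swap_apply_def]
  simp only [Fin.ext_iff, lo_val, hi_val] at *
  rw [Fin.lt_def] at *
  split_ifs <;> simp <;> omega

/-- The inversions of a permutation. -/
def invSet (w : Equiv.Perm (Fin k)) : Finset (Fin k × Fin k) :=
  Finset.univ.filter fun p ↦ p.1 < p.2 ∧ w p.2 < w p.1

theorem mem_invSet {w : Equiv.Perm (Fin k)} {p : Fin k × Fin k} :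
    p ∈ invSet w ↔ p.1 < p.2 ∧ w p.2 < w p.1 := by simp [invSet]

/-- Applying `s_i` to both entries matches the inversions of `w s_i` with those of `w`; only the
pair `(i, i + 1)` itself, which is erased on both sides, would be turned around. -/
theorem card_invSet_erase (w : Equiv.Perm (Fin k)) (i : Fin (k - 1)) :
    ((invSet (w * simple k i)).erase (lo i, hi i)).card =
      ((invSet w).erase (lo i, hi i)).card := by
  have key : ∀ (w : Equiv.Perm (Fin k)) (p : Fin k × Fin k),
      p ∈ (invSet (w * simple k i)).erase (lo i, hi i) →
      (simple k i p.1, simple k i p.2) ∈ (invSet w).erase (lo i, hi i) := by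
    intro w p hp
    rw [Finset.mem_erase, mem_invSet] at hp
    obtain ⟨h1, h2, h3⟩ := hp
    have h1' : ¬ (p.1 = lo i ∧ p.2 = hi i) := fun h ↦ h1 (Prod.ext h.1 h.2)
    rw [Finset.mem_erase, mem_invSet]
    refine ⟨fun h ↦ ?_, simple_lt_simple i h2 h1', h3⟩
    rw [Prod.mk.injEq] at h
    have e1 : p.1 = hi i := by rw [← simple_simple i p.1, h.1, simple_lo]
    have e2 : p.2 = lo i := by rw [← simple_simple i p.2, h.2, simple_hi]
    rw [e1, e2] at h2
    exact lt_asymm h2 (lo_lt_hi i)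
  refine Finset.card_nbij' (fun p ↦ (simple k i p.1, simple k i p.2))
    (fun p ↦ (simple k i p.1, simple k i p.2)) (fun p hp ↦ key w p hp)
    (fun p hp ↦ key (w * simple k i) p ?_) (fun p _ ↦ by simp) (fun p _ ↦ by simp)
  rw [mul_assoc, simple_mul_self, mul_one]
  exact hp

theorem card_invSet_mul_of_lt {w : Equiv.Perm (Fin k)} {i : Fin (k - 1)}
    (h : w (lo i) < w (hi i)) : (invSet (w * simple k i)).card = (invSet w).card + 1 := by
  have h1 : (lo i, hi i) ∉ invSet w := fun h' ↦ lt_asymm h (mem_invSet.1 h').2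
  have h2 : (lo i, hi i) ∈ invSet (w * simple k i) := by
    rw [mem_invSet]; exact ⟨lo_lt_hi i, by simpa using h⟩
  rw [← Finset.card_erase_add_one h2, card_invSet_erase, Finset.erase_eq_of_notMem h1]

theorem card_invSet_mul_of_gt {w : Equiv.Perm (Fin k)} {i : Fin (k - 1)}
    (h : w (hi i) < w (lo i)) : (invSet (w * simple k i)).card + 1 = (invSet w).card := by
  have := card_invSet_mul_of_lt (w := w * simple k i) (i := i) (by simpa using h)
  rw [mul_assoc, simple_mul_self, mul_one] at this
  exact this.symm

theorem lo_lt_hi_or (w : Equiv.Perm (Fin k)) (i : Fin (k - 1)) :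
    w (lo i) < w (hi i) ∨ w (hi i) < w (lo i) :=
  lt_or_gt_of_ne fun h ↦ lo_ne_hi i (w.injective h)

/-- A permutation without descents is increasing, hence an order automorphism of `Fin k`, and the
identity is the only one. -/
theorem exists_descent {w : Equiv.Perm (Fin k)} (hw : w ≠ 1) :
    ∃ i : Fin (k - 1), w (hi i) < w (lo i) := by
  by_contra! hcon
  apply hw
  cases k with
  | zero => exact Subsingleton.elim _ _
  | succ n =>
    have hmono : StrictMono w := Fin.strictMono_iff_lt_succ.2 fun i ↦
      lt_of_le_of_ne (hcon i) fun h ↦ lo_ne_hi (k := n + 1) i (w.injective h)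
    have := Subsingleton.elim (StrictMono.orderIsoOfSurjective w hmono w.surjective)
      (OrderIso.refl _)
    ext x
    exact congrArg Fin.val (congrArg (fun f : Fin (n + 1) ≃o Fin (n + 1) ↦ f x) this)

theorem exists_word_card_invSet (w : Equiv.Perm (Fin k)) :
    ∃ l : List (Fin (k - 1)), l.length = (invSet w).card ∧ wordProd l = w := by
  induction h : (invSet w).card generalizing w with
  | zero =>
    refine ⟨[], rfl, ?_⟩
    by_contra hw
    obtain ⟨i, hi⟩ := exists_descent (Ne.symm hw)
    have := card_invSet_mul_of_gt hi
    omega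
  | succ n ih =>
    have hw : w ≠ 1 := by
      rintro rfl
      have : invSet (1 : Equiv.Perm (Fin k)) = ∅ := by
        ext p
        simp only [mem_invSet, Equiv.Perm.one_apply, Finset.notMem_empty, iff_false]
        exact fun h ↦ lt_asymm h.1 h.2
      simp [this] at h
    obtain ⟨i, hi⟩ := exists_descent hw
    obtain ⟨l, hl, hlw⟩ := ih (w * simple k i) (by have := card_invSet_mul_of_gt hi; omega)
    refine ⟨l ++ [i], by simp [hl], ?_⟩
    have : wordProd (l ++ [i]) = wordProd l * simple k i := by simp [wordProd]
    rw [this, hlw, mul_assoc, simple_mul_self, mul_one]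

theorem len_le_length (l : List (Fin (k - 1))) : len (wordProd l) ≤ l.length :=
  Nat.sInf_le ⟨l, rfl, rfl⟩

theorem wordProd_append_singleton (l : List (Fin (k - 1))) (i : Fin (k - 1)) :
    wordProd (l ++ [i]) = wordProd l * simple k i := by simp [wordProd]

theorem wordProd_cons (i : Fin (k - 1)) (l : List (Fin (k - 1))) :
    wordProd (i :: l) = simple k i * wordProd l := by simp [wordProd]

theorem wordProd_reverse (l : List (Fin (k - 1))) : wordProd l.reverse = (wordProd l)⁻¹ := by
  induction l with
  | nil => simp [wordProd]
  | cons i l ih => rw [List.reverse_cons, wordProd_append_singleton, ih, wordProd_cons, mul_inv_rev,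
      simple_inv]

theorem card_invSet_wordProd_le (l : List (Fin (k - 1))) :
    (invSet (wordProd l)).card ≤ l.length := by
  induction l using List.reverseRecOn with
  | nil =>
    have : invSet (wordProd ([] : List (Fin (k - 1)))) = ∅ := by
      ext p
      simp only [mem_invSet, wordProd, List.map_nil, List.prod_nil, Equiv.Perm.one_apply,
        Finset.notMem_empty, iff_false]
      exact fun h ↦ lt_asymm h.1 h.2
    simp [this]
  | append_singleton l i ih =>
    rw [wordProd_append_singleton, List.length_append, List.length_singleton]
    rcases lo_lt_hi_or (wordProd l) i with h | h
    · have := card_invSet_mul_of_lt h; omega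
    · have := card_invSet_mul_of_gt h; omega

/-- Removing descents one at a time writes `w` with as many letters as it has inversions; conversely
each letter of a word changes the number of inversions by one. -/
theorem len_eq_card_invSet (w : Equiv.Perm (Fin k)) : len w = (invSet w).card := by
  apply le_antisymm
  · obtain ⟨l, hl, rfl⟩ := exists_word_card_invSet w
    exact hl ▸ len_le_length l
  · obtain ⟨l, hl, hw⟩ := exists_reduced w
    rw [← hl, ← hw]
    exact card_invSet_wordProd_le l

theorem len_mul_simple_of_lt {w : Equiv.Perm (Fin k)} {i : Fin (k - 1)}
    (h : w (lo i) < w (hi i)) : len (w * simple k i) = len w + 1 := by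
  rw [len_eq_card_invSet, len_eq_card_invSet, card_invSet_mul_of_lt h]

theorem len_mul_simple_of_gt {w : Equiv.Perm (Fin k)} {i : Fin (k - 1)}
    (h : w (hi i) < w (lo i)) : len (w * simple k i) + 1 = len w := by
  rw [len_eq_card_invSet, len_eq_card_invSet, card_invSet_mul_of_gt h]

theorem len_inv (w : Equiv.Perm (Fin k)) : len w⁻¹ = len w := by
  have key : ∀ w : Equiv.Perm (Fin k), len w⁻¹ ≤ len w := fun w ↦ by
    obtain ⟨l, hl, rfl⟩ := exists_reduced w
    rw [← wordProd_reverse, ← hl, ← List.length_reverse]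
    exact len_le_length _
  exact le_antisymm (key w) (by simpa using key w⁻¹)

theorem len_simple_mul_of_lt {w : Equiv.Perm (Fin k)} {i : Fin (k - 1)}
    (h : w⁻¹ (lo i) < w⁻¹ (hi i)) : len (simple k i * w) = len w + 1 := by
  rw [← len_inv, mul_inv_rev, simple_inv, len_mul_simple_of_lt h, len_inv]

theorem len_simple_mul_of_gt {w : Equiv.Perm (Fin k)} {i : Fin (k - 1)}
    (h : w⁻¹ (hi i) < w⁻¹ (lo i)) : len (simple k i * w) + 1 = len w := by
  rw [← len_inv, mul_inv_rev, simple_inv, len_mul_simple_of_gt h, len_inv]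

@[simp] theorem len_one : len (1 : Equiv.Perm (Fin k)) = 0 :=
  Nat.le_zero.1 (len_le_length (k := k) [])

/-- Induction over the permutations that preserve the fibres of a monotone map. -/
theorem block_induction {α : Type*} [PartialOrder α] {b : Fin k → α} (hb : Monotone b)
    {P : Equiv.Perm (Fin k) → Prop} (one : P 1)
    (mul : ∀ (w : Equiv.Perm (Fin k)) (i : Fin (k - 1)), b ∘ w = b → b (lo i) = b (hi i) →
      w (lo i) < w (hi i) → P w → P (w * simple k i))
    (w : Equiv.Perm (Fin k)) (hw : b ∘ w = b) : P w := by
  induction h : len w using Nat.strong_induction_on generalizing w with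
  | _ n ih =>
    by_cases h1 : w = 1
    · exact h1 ▸ one
    obtain ⟨i, hd⟩ := exists_descent h1
    -- A descent lies inside a fibre of `b`: since `b` is monotone and `b ∘ w = b`, applying `b` to
    -- `w (hi i) < w (lo i)` gives the inequality that monotonicity alone does not.
    have hbi : b (lo i) = b (hi i) := by
      apply le_antisymm (hb (lo_lt_hi i).le)
      have := hb hd.le
      rwa [← Function.comp_apply (f := b) (g := w), ← Function.comp_apply (f := b) (g := w),
        hw] at this
    have hw' : b ∘ (w * simple k i) = b := by
      funext x
      change (b ∘ w) (simple k i x) = b x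
      rw [hw]
      by_cases h1 : x = lo i
      · rw [h1, simple_lo, hbi]
      by_cases h2 : x = hi i
      · rw [h2, simple_hi, hbi]
      rw [simple_of_ne i h1 h2]
    have := mul _ i hw' hbi (by simpa using hd)
      (ih _ (by have := len_mul_simple_of_gt hd; omega) _ hw' rfl)
    rwa [mul_assoc, simple_mul_self, mul_one] at this

end Perm

/-! ### The standard basis of the Hecke algebra -/

section HeckeBasis

variable (q : ℂˣ) {k : ℕ}

variable {q} in
theorem hecke_induction {P : Hecke q k → Prop} (algebraMap : ∀ c : ℂ, P (algebraMap ℂ _ c))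
    (gen : ∀ i, P (T q k i)) (add : ∀ a b, P a → P b → P (a + b))
    (mul : ∀ a b, P a → P b → P (a * b)) (h : Hecke q k) : P h := by
  obtain ⟨f, rfl⟩ := RingQuot.mkAlgHom_surjective ℂ (Rel q k) h
  induction f using FreeAlgebra.induction with
  | grade0 c => rw [AlgHom.commutes]; exact algebraMap c
  | grade1 i => exact gen i
  | add a b ha hb => rw [map_add]; exact add _ _ ha hb
  | mul a b ha hb => rw [map_mul]; exact mul _ _ ha hb

-- Such a subspace is a left ideal containing `1`. Spanning statements about the Hecke algebra are
-- reduced in this way to multiplication by generators.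
variable {q} in
theorem eq_top_of_mul_mem (W : Submodule ℂ (Hecke q k)) (h1 : 1 ∈ W)
    (hT : ∀ i, ∀ x ∈ W, T q k i * x ∈ W) : W = ⊤ := by
  have key : ∀ h : Hecke q k, ∀ x ∈ W, h * x ∈ W := fun h ↦ by
    induction h using hecke_induction with
    | algebraMap c => intro x hx; rw [← Algebra.smul_def]; exact W.smul_mem _ hx
    | gen i => exact hT i
    | add a b ha hb => intro x hx; rw [add_mul]; exact W.add_mem (ha x hx) (hb x hx)
    | mul a b ha hb => intro x hx; rw [mul_assoc]; exact ha _ (hb x hx)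
  exact eq_top_iff.2 fun h _ ↦ by simpa using key h 1 h1

/-! ### Upper bound `k!` for the dimension of the Hecke algebra -/

/-- The inclusion of the Hecke algebra of one index less. -/
def heckeIncl (n : ℕ) : Hecke q (n + 1) →ₐ[ℂ] Hecke q (n + 2) :=
  heckeLift q (n + 1) (fun i : Fin n ↦ T q (n + 2) (i.castSucc : Fin (n + 1)))
    (fun _ ↦ T_quad q _ _) (fun i j h ↦ T_braid q (n + 2) i.castSucc j.castSucc h)
    (fun i j h ↦ T_comm q (n + 2) i.castSucc j.castSucc h)

/-- The generators indexed by all natural numbers. -/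
def Tnat (k a : ℕ) : Hecke q k := if h : a < k - 1 then T q k ⟨a, h⟩ else 1

theorem heckeIncl_Tnat {n a : ℕ} (ha : a < n) :
    heckeIncl q n (Tnat q (n + 1) a) = Tnat q (n + 2) a := by
  rw [Tnat, dif_pos (by simpa using ha), heckeIncl, heckeLift_T, Tnat, dif_pos (by simp; omega)]
  rfl

theorem Tnat_comm {k a b : ℕ} (h : a + 2 ≤ b) :
    Tnat q k a * Tnat q k b = Tnat q k b * Tnat q k a := by
  unfold Tnat
  split_ifs
  · exact T_comm q k _ _ h
  all_goals simp

theorem Tnat_braid {k a : ℕ} (h : a + 1 < k - 1) :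
    Tnat q k a * Tnat q k (a + 1) * Tnat q k a =
      Tnat q k (a + 1) * Tnat q k a * Tnat q k (a + 1) := by
  unfold Tnat
  rw [dif_pos h, dif_pos (by omega)]
  exact T_braid q k _ _ rfl

theorem Tnat_quad {k a : ℕ} (h : a < k - 1) :
    Tnat q k a * Tnat q k a = qhat q • Tnat q k a + 1 := by
  unfold Tnat
  rw [dif_pos h]
  exact T_quad q k _

/-- The product `T_{n-m+1} ⋯ T_n`. -/
def ladder (n : ℕ) : ℕ → Hecke q (n + 2)
  | 0 => 1
  | m + 1 => Tnat q (n + 2) (n - m) * ladder n m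

theorem Tnat_mul_ladder_of_lt {n m a : ℕ} (h : a + m < n) :
    Tnat q (n + 2) a * ladder q n m = ladder q n m * Tnat q (n + 2) a := by
  induction m with
  | zero => simp [ladder]
  | succ m ih =>
    rw [ladder, ← mul_assoc, Tnat_comm q (by omega), mul_assoc, ih (by omega), mul_assoc]

/-- `T_{a+1}` commutes with the factors in front of `T_a T_{a+1}`. There the braid relation turns it
into `T_a`, which commutes with all the later factors. -/
theorem Tnat_mul_ladder_of_gt {n m a : ℕ} (h : n < a + m) (ha : a < n) (hm : m ≤ n + 1) :
    Tnat q (n + 2) (a + 1) * ladder q n m = ladder q n m * Tnat q (n + 2) a := by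
  induction m with
  | zero => omega
  | succ m ih =>
    rcases Nat.lt_or_ge n (a + m) with h' | h'
    · rw [ladder, ← mul_assoc, ← Tnat_comm q (by omega), mul_assoc, ih h' (by omega), mul_assoc]
    · obtain ⟨m, rfl⟩ : ∃ m', m = m' + 1 := ⟨m - 1, by omega⟩
      rw [ladder, ladder]
      have e1 : n - (m + 1) = a := by omega
      have e2 : n - m = a + 1 := by omega
      rw [e1, e2, ← mul_assoc, ← mul_assoc, ← Tnat_braid q (by simp; omega), mul_assoc,
        Tnat_mul_ladder_of_lt q (by omega), mul_assoc, mul_assoc, mul_assoc]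

/-- The ladders are coset representatives of `S_{n+2} / S_{n+1}`. A generator either passes through
a ladder into the smaller algebra, with its index kept or lowered by one, or lengthens the ladder,
or equals its first factor and is absorbed by the quadratic relation. -/
theorem Tnat_mul_ladder_mem {n m a : ℕ} (ha : a ≤ n) (hm : m ≤ n + 1) (x : Hecke q (n + 1)) :
    ∃ f : Fin (n + 2) → Hecke q (n + 1),
      Tnat q (n + 2) a * (ladder q n m * heckeIncl q n x) =
        ∑ j, ladder q n j.1 * heckeIncl q n (f j) := by
  have single : ∀ (m : ℕ) (_ : m ≤ n + 1) (y : Hecke q (n + 1)), ∃ f : Fin (n + 2) →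
      Hecke q (n + 1), ladder q n m * heckeIncl q n y =
        ∑ j, ladder q n j.1 * heckeIncl q n (f j) := fun m hm y ↦ by
    refine ⟨Pi.single ⟨m, by omega⟩ y, ?_⟩
    rw [Finset.sum_eq_single ⟨m, by omega⟩ _ (by simp)]
    · simp
    · intro j _ hj; simp [Pi.single_eq_of_ne hj]
  rcases Nat.lt_trichotomy (a + m) n with h | h | h
  · rw [← mul_assoc, Tnat_mul_ladder_of_lt q h, mul_assoc, ← heckeIncl_Tnat q (by omega), ← map_mul]
    exact single m hm _
  · have : Tnat q (n + 2) a * (ladder q n m * heckeIncl q n x) =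
        ladder q n (m + 1) * heckeIncl q n x := by
      rw [ladder, ← mul_assoc]; congr 3; omega
    rw [this]
    exact single _ (by omega) _
  · rcases Nat.lt_or_ge (n + 1) (a + m) with h' | h'
    · obtain ⟨a, rfl⟩ : ∃ a', a = a' + 1 := ⟨a - 1, by omega⟩
      rw [← mul_assoc, Tnat_mul_ladder_of_gt q (by omega) (by omega) hm, mul_assoc,
        ← heckeIncl_Tnat q (by omega), ← map_mul]
      exact single m hm _
    · obtain ⟨m, rfl⟩ : ∃ m', m = m' + 1 := ⟨m - 1, by omega⟩
      obtain ⟨f, hf⟩ := single (m + 1) hm x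
      obtain ⟨g, hg⟩ := single m (by omega) x
      refine ⟨qhat q • f + g, ?_⟩
      simp only [Pi.add_apply, Pi.smul_apply, map_add, map_smul, mul_add, Finset.sum_add_distrib,
        mul_smul_comm, ← Finset.smul_sum, ← hf, ← hg]
      rw [ladder]
      have : n - m = a := by omega
      rw [this, ← mul_assoc, ← mul_assoc, Tnat_quad q (by simp; omega), add_mul, add_mul, one_mul,
        smul_mul_assoc, smul_mul_assoc]

/-- The spanning map that bounds the dimension of the Hecke algebra. -/
def ladderMap (n : ℕ) : (Fin (n + 2) → Hecke q (n + 1)) →ₗ[ℂ] Hecke q (n + 2) :=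
  ∑ j : Fin (n + 2), LinearMap.mulLeft ℂ (ladder q n j.1) ∘ₗ (heckeIncl q n).toLinearMap ∘ₗ
    LinearMap.proj j

theorem ladderMap_apply (n : ℕ) (f : Fin (n + 2) → Hecke q (n + 1)) :
    ladderMap q n f = ∑ j : Fin (n + 2), ladder q n j.1 * heckeIncl q n (f j) := by
  simp [ladderMap]

theorem ladderMap_surjective (n : ℕ) : Function.Surjective (ladderMap q n) := by
  rw [← LinearMap.range_eq_top]
  apply eq_top_of_mul_mem
  · refine ⟨Pi.single 0 1, ?_⟩
    rw [ladderMap_apply, Finset.sum_eq_single 0 _ (by simp)]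
    · simp [ladder]
    · intro j _ hj; simp [Pi.single_eq_of_ne hj]
  · rintro i _ ⟨f, rfl⟩
    rw [ladderMap_apply, Finset.mul_sum]
    refine Submodule.sum_mem _ fun j _ ↦ ?_
    have hi : T q (n + 2) i = Tnat q (n + 2) i.1 := by rw [Tnat, dif_pos i.2]
    obtain ⟨g, hg⟩ := Tnat_mul_ladder_mem q (n := n) (m := j.1) (a := i.1)
      (by have := i.2; omega) (by have := j.2; omega) (f j)
    exact ⟨g, by rw [ladderMap_apply, hi, hg]⟩

theorem finite_and_finrank_le (k : ℕ) :
    Module.Finite ℂ (Hecke q k) ∧ Module.finrank ℂ (Hecke q k) ≤ k.factorial := by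
  have base : ∀ k, k ≤ 1 → Module.Finite ℂ (Hecke q k) ∧
      Module.finrank ℂ (Hecke q k) ≤ k.factorial := fun k hk ↦ by
    have hs : Function.Surjective (LinearMap.toSpanSingleton ℂ (Hecke q k) 1) := by
      rw [← LinearMap.range_eq_top]
      refine eq_top_of_mul_mem _ ⟨1, by simp⟩ fun i ↦ absurd i.2 (by omega)
    refine ⟨Module.Finite.of_surjective _ hs, ?_⟩
    have := LinearMap.finrank_le_finrank_of_surjective hs
    rw [Module.finrank_self] at this
    exact this.trans k.factorial_pos
  induction k with
  | zero => exact base 0 zero_le_one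
  | succ n ih =>
    cases n with
    | zero => exact base 1 le_rfl
    | succ n =>
      obtain ⟨h1, h2⟩ := ih
      refine ⟨Module.Finite.of_surjective _ (ladderMap_surjective q n), ?_⟩
      have := LinearMap.finrank_le_finrank_of_surjective (ladderMap_surjective q n)
      rw [Module.finrank_pi_fintype] at this
      simp only [Finset.sum_const, Finset.card_univ, Fintype.card_fin, smul_eq_mul] at this
      rw [Nat.factorial_succ (n + 1)]
      exact this.trans (Nat.mul_le_mul_left _ h2)

instance : Module.Finite ℂ (Hecke q k) := (finite_and_finrank_le q k).1

/-! ### Linear independence of the `T_w` through a word with distinct letters -/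

theorem rho_T_single (N : ℕ) (i : Fin (k - 1)) (v : Fin k → Fin N) :
    rho q k N (T q k i) (Finsupp.single v 1) =
      if v (lo i) = v (hi i) then (q : ℂ) • Finsupp.single v 1
      else if v (lo i) < v (hi i) then
        qhat q • Finsupp.single v 1 + Finsupp.single (v ∘ simple k i) 1
      else Finsupp.single (v ∘ simple k i) 1 := by
  rw [rho, heckeLift_T, rOp_single]
  rfl

/-- The word `k - 1, …, 0`, composed with the inverse of a permutation. -/
def permWord (w : Equiv.Perm (Fin k)) : Fin k → Fin k := Fin.rev ∘ ⇑w⁻¹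

theorem permWord_injective : Function.Injective (permWord (k := k)) := fun v w h ↦ by
  have := Fin.rev_injective.comp_left h
  exact inv_injective (DFunLike.coe_injective this)

/-- The action of the Hecke algebra on the word `k - 1, …, 0`. -/
def regMap : Hecke q k →ₗ[ℂ] TensorPower k k :=
  LinearMap.applyₗ (Finsupp.single (permWord 1) 1) ∘ₗ (rho q k k).toLinearMap

theorem regMap_mul (a b : Hecke q k) : regMap q (a * b) = rho q k k a (regMap q b) := by
  simp [regMap]

/-- On words with distinct letters the `R`-matrix copies left multiplication on the elements `T_w`.
The starting word is decreasing because an interchange that increases the length then carries no `q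
- q⁻¹` term. -/
theorem rho_T_permWord (i : Fin (k - 1)) (w : Equiv.Perm (Fin k)) :
    rho q k k (T q k i) (Finsupp.single (permWord w) 1) =
      Finsupp.single (permWord (simple k i * w)) 1 +
        if w⁻¹ (hi i) < w⁻¹ (lo i) then qhat q • Finsupp.single (permWord w) 1 else 0 := by
  have h1 : permWord w ∘ simple k i = permWord (simple k i * w) := by
    ext x; simp [permWord]
  have h2 : permWord w (lo i) < permWord w (hi i) ↔ w⁻¹ (hi i) < w⁻¹ (lo i) := by
    simp only [permWord, Function.comp_apply, Fin.rev_lt_rev]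
  have h3 : permWord w (lo i) ≠ permWord w (hi i) := fun h ↦
    lo_ne_hi i (w⁻¹.injective (Fin.rev_injective h))
  rw [rho_T_single, if_neg h3, h1, if_congr h2 rfl rfl]
  split_ifs
  · exact add_comm _ _
  · rw [add_zero]

theorem regMap_word (l : List (Fin (k - 1))) (hl : l.length = len (wordProd l)) :
    regMap q (l.map (T q k)).prod = Finsupp.single (permWord (wordProd l)) 1 := by
  induction l with
  | nil => simp [regMap, wordProd]
  | cons i l ih =>
    have h1 : len (wordProd l) ≤ l.length := len_le_length l
    rw [wordProd_cons, List.length_cons] at hl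
    have h2 : (wordProd l)⁻¹ (lo i) < (wordProd l)⁻¹ (hi i) := by
      refine (lo_lt_hi_or _ i).resolve_right fun h ↦ ?_
      have := len_simple_mul_of_gt h
      omega
    have h3 := len_simple_mul_of_lt h2
    rw [List.map_cons, List.prod_cons, regMap_mul, ih (by omega), rho_T_permWord,
      if_neg (lt_asymm h2), add_zero, wordProd_cons]

theorem reducedWord_length (w : Equiv.Perm (Fin k)) : (reducedWord w).length = len w :=
  (exists_reduced w).choose_spec.1

theorem wordProd_reducedWord (w : Equiv.Perm (Fin k)) : wordProd (reducedWord w) = w :=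
  (exists_reduced w).choose_spec.2

theorem regMap_Tperm (w : Equiv.Perm (Fin k)) :
    regMap q (Tperm q w) = Finsupp.single (permWord w) 1 := by
  rw [Tperm, regMap_word, wordProd_reducedWord]
  rw [wordProd_reducedWord, reducedWord_length]

theorem linearIndependent_regMap_Tperm :
    LinearIndependent ℂ (regMap q ∘ fun w : Equiv.Perm (Fin k) ↦ Tperm q w) := by
  have : (regMap q ∘ fun w : Equiv.Perm (Fin k) ↦ Tperm q w) =
      (Finsupp.basisSingleOne (R := ℂ)) ∘ permWord := by
    funext w; simp [regMap_Tperm]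
  rw [this]
  exact Finsupp.basisSingleOne.linearIndependent.comp _ permWord_injective

theorem linearIndependent_Tperm :
    LinearIndependent ℂ fun w : Equiv.Perm (Fin k) ↦ Tperm q w :=
  (linearIndependent_regMap_Tperm q).of_comp _

theorem finrank_hecke (k : ℕ) : Module.finrank ℂ (Hecke q k) = k.factorial := by
  apply le_antisymm (finite_and_finrank_le q k).2
  have := (linearIndependent_Tperm q (k := k)).fintype_card_le_finrank
  rwa [Fintype.card_perm, Fintype.card_fin] at this

/-- The basis `T_w` of the Hecke algebra. -/
def Tbasis (k : ℕ) : Module.Basis (Equiv.Perm (Fin k)) ℂ (Hecke q k) :=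
  basisOfLinearIndependentOfCardEqFinrank (linearIndependent_Tperm q)
    (by rw [finrank_hecke, Fintype.card_perm, Fintype.card_fin])

@[simp] theorem Tbasis_apply (w : Equiv.Perm (Fin k)) : Tbasis q k w = Tperm q w := by
  simp [Tbasis]

theorem regMap_injective : Function.Injective (regMap q (k := k)) := by
  have h := Submodule.range_ker_disjoint (linearIndependent_regMap_Tperm q (k := k))
  have h2 : (fun w : Equiv.Perm (Fin k) ↦ Tperm q w) = Tbasis q k := by funext w; simp
  rw [h2, (Tbasis q k).span_eq, top_disjoint] at h
  exact LinearMap.ker_eq_bot.1 h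

/-- Independence of `T_w` from the chosen reduced word (Matsumoto's theorem). It follows from
injectivity of `regMap`, without any discussion of braid moves. -/
theorem Tperm_wordProd (l : List (Fin (k - 1))) (hl : l.length = len (wordProd l)) :
    (l.map (T q k)).prod = Tperm q (wordProd l) :=
  regMap_injective q (by rw [regMap_word q l hl, regMap_Tperm])

@[simp] theorem Tperm_one : Tperm q (1 : Equiv.Perm (Fin k)) = 1 :=
  (Tperm_wordProd q [] (len_one).symm).symm

theorem T_mul_Tperm (i : Fin (k - 1)) (w : Equiv.Perm (Fin k)) :
    T q k i * Tperm q w = Tperm q (simple k i * w) +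
      if w⁻¹ (hi i) < w⁻¹ (lo i) then qhat q • Tperm q w else 0 := by
  apply regMap_injective q
  rw [regMap_mul, regMap_Tperm, rho_T_permWord, map_add, regMap_Tperm]
  split_ifs
  · rw [map_smul, regMap_Tperm]
  · rw [map_zero]

/-- The antiautomorphism with `T_i ↦ T_i`, as a homomorphism to the opposite algebra. -/
def flipOp (k : ℕ) : Hecke q k →ₐ[ℂ] (Hecke q k)ᵐᵒᵖ :=
  heckeLift q k (fun i ↦ MulOpposite.op (T q k i))
    (fun i ↦ by rw [← MulOpposite.op_mul, T_quad]; simp)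
    (fun i j h ↦ MulOpposite.unop_injective (by simpa [mul_assoc] using T_braid q k i j h))
    (fun i j h ↦ MulOpposite.unop_injective (by simpa using (T_comm q k i j h).symm))

theorem flipOp_word (l : List (Fin (k - 1))) :
    flipOp q k (l.map (T q k)).prod = MulOpposite.op (l.reverse.map (T q k)).prod := by
  induction l with
  | nil => simp
  | cons i l ih =>
    rw [List.map_cons, List.prod_cons, map_mul, ih, flipOp, heckeLift_T, ← MulOpposite.op_mul]
    simp

theorem flipOp_Tperm (w : Equiv.Perm (Fin k)) :
    flipOp q k (Tperm q w) = MulOpposite.op (Tperm q w⁻¹) := by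
  have h : wordProd (reducedWord w).reverse = w⁻¹ := by
    rw [wordProd_reverse, wordProd_reducedWord]
  rw [Tperm, flipOp_word, Tperm_wordProd, h]
  rw [h, List.length_reverse, reducedWord_length, len_inv]

theorem Tperm_mul_T (w : Equiv.Perm (Fin k)) (i : Fin (k - 1)) :
    Tperm q w * T q k i = Tperm q (w * simple k i) +
      if w (hi i) < w (lo i) then qhat q • Tperm q w else 0 := by
  have h := congrArg (flipOp q k) (T_mul_Tperm q i w⁻¹)
  rw [map_mul, flipOp_Tperm, map_add, flipOp_Tperm, flipOp, heckeLift_T, ← flipOp,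
    ← MulOpposite.op_mul] at h
  apply MulOpposite.op_injective
  rw [inv_inv] at h
  rw [h, MulOpposite.op_add, mul_inv_rev, inv_inv, simple_inv]
  congr 1
  split_ifs
  · rw [map_smul, flipOp_Tperm, inv_inv]; rfl
  · rw [map_zero]; rfl

/-- The sum `∑ T_{w⁻¹} ⊗ T_w` is a Casimir element. -/
theorem casimir_mul (h : Hecke q k) :
    ∑ w : Equiv.Perm (Fin k), (h * Tperm q w⁻¹) ⊗ₜ[ℂ] Tperm q w =
      ∑ w : Equiv.Perm (Fin k), Tperm q w⁻¹ ⊗ₜ[ℂ] (Tperm q w * h) := by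
  induction h using hecke_induction with
  | algebraMap c =>
    refine Finset.sum_congr rfl fun w _ ↦ ?_
    rw [← Algebra.commutes, ← Algebra.smul_def, ← Algebra.smul_def, TensorProduct.smul_tmul]
  | gen i =>
    simp only [T_mul_Tperm, Tperm_mul_T, TensorProduct.add_tmul, TensorProduct.tmul_add,
      Finset.sum_add_distrib, inv_inv]
    congr 1
    -- Replacing `w` by `w s_i` matches the terms without `q - q⁻¹`. The other terms agree for each
    -- single `w`, as both are present exactly when `w` has a descent at `i`.
    · rw [← Equiv.sum_comp (Equiv.mulRight (simple k i))]
      refine Finset.sum_congr rfl fun w _ ↦ ?_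
      simp [← mul_assoc (simple k i)]
    · refine Finset.sum_congr rfl fun w _ ↦ ?_
      split_ifs
      · rw [TensorProduct.smul_tmul]
      · simp
  | add a b ha hb =>
    simp only [add_mul, mul_add, TensorProduct.add_tmul, TensorProduct.tmul_add,
      Finset.sum_add_distrib, ha, hb]
  | mul a b ha hb =>
    have h1 := congrArg (TensorProduct.map (LinearMap.mulLeft ℂ a) LinearMap.id) hb
    have h2 := congrArg (TensorProduct.map LinearMap.id (LinearMap.mulRight ℂ b)) ha
    simp only [map_sum, TensorProduct.map_tmul, LinearMap.mulLeft_apply, LinearMap.mulRight_apply,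
      LinearMap.id_apply] at h1 h2
    simp only [mul_assoc] at h1 h2 ⊢
    rw [h1, h2]

end HeckeBasis

/-! ### Standard tableaux -/

section Tableaux

variable {k : ℕ}

/-- A standard tableau, given by the sequence of the cells that contain `0, …, k - 1`. -/
structure IsStd (t : Fin k → ℕ × ℕ) : Prop where
  inj : Function.Injective t
  lower : ∀ i u, u ≤ t i → ∃ j ≤ i, t j = u

/-- The standard tableaux with `k` cells. -/
abbrev Tab (k : ℕ) : Type := {t : Fin k → ℕ × ℕ // IsStd t}

/-- The cells of a tableau. -/
def cells (t : Tab k) : Finset (ℕ × ℕ) := Finset.univ.image t.1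

theorem mem_cells {t : Tab k} {u : ℕ × ℕ} : u ∈ cells t ↔ ∃ i, t.1 i = u := by simp [cells]

theorem isLowerSet_cells (t : Tab k) : IsLowerSet (cells t : Set (ℕ × ℕ)) := by
  intro u v hvu hu
  obtain ⟨i, rfl⟩ := mem_cells.1 hu
  obtain ⟨j, -, hj⟩ := t.2.lower i v hvu
  exact mem_cells.2 ⟨j, hj⟩

theorem card_cells (t : Tab k) : (cells t).card = k := by
  rw [cells, Finset.card_image_of_injective _ t.2.inj, Finset.card_univ, Fintype.card_fin]

/-- The shape of a tableau. -/
def shape (t : Tab k) : Shape k := ⟨⟨cells t, isLowerSet_cells t⟩, card_cells t⟩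

theorem shape_eq_iff {s t : Tab k} : shape s = shape t ↔ cells s = cells t :=
  ⟨fun h ↦ congrArg (fun μ : Shape k ↦ μ.1.cells) h,
    fun h ↦ Subtype.ext (YoungDiagram.ext h)⟩

theorem mem_shape {t : Tab k} {u : ℕ × ℕ} : u ∈ (shape t).1 ↔ ∃ i, t.1 i = u := mem_cells

theorem cells_lt (t : Tab k) (i : Fin k) : (t.1 i).1 < k ∧ (t.1 i).2 < k := by
  have := shape_cells_subset (shape t) (mem_cells.2 ⟨i, rfl⟩)
  rwa [Finset.mem_product, Finset.mem_range, Finset.mem_range] at this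

instance : Finite (Tab k) :=
  Finite.of_injective
    (fun (t : Tab k) (i : Fin k) ↦
      ((⟨(t.1 i).1, (cells_lt t i).1⟩ : Fin k), (⟨(t.1 i).2, (cells_lt t i).2⟩ : Fin k)))
    (fun s t h ↦ Subtype.ext (funext fun i ↦ by
      have := congrFun h i
      simp only [Prod.mk.injEq, Fin.mk.injEq] at this
      exact Prod.ext this.1 this.2))

instance : Fintype (Tab k) := Fintype.ofFinite _

instance : DecidableEq (Tab k) := Classical.decEq _

theorem Tab.le_of_le (t : Tab k) {i j : Fin k} (h : t.1 i ≤ t.1 j) : i ≤ j := by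
  obtain ⟨l, hl, e⟩ := t.2.lower j _ h
  rwa [t.2.inj e] at hl

/-- Exchanging two consecutive entries reverses the order of that pair only, so standardness can be
lost only if their two cells are comparable. -/
theorem IsStd.comp_simple_iff {t : Fin k → ℕ × ℕ} (ht : IsStd t) (i : Fin (k - 1)) :
    IsStd (t ∘ simple k i) ↔ ¬ t (lo i) ≤ t (hi i) := by
  constructor
  · intro h hle
    have := Tab.le_of_le ⟨_, h⟩ (i := hi i) (j := lo i) (by simpa using hle)
    exact absurd (lo_lt_hi i) (not_lt.2 this)
  · intro hle
    refine ⟨ht.inj.comp (simple k i).injective, fun x u hu ↦ ?_⟩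
    simp only [Function.comp_apply] at hu ⊢
    obtain ⟨j, hj, rfl⟩ := ht.lower _ _ hu
    refine ⟨simple k i j, ?_, by simp⟩
    by_cases hx1 : x = lo i
    · subst hx1
      rw [simple_lo] at hj hu
      have hne : j ≠ lo i := by rintro rfl; exact hle hu
      by_cases h2 : j = hi i
      · rw [h2, simple_hi]
      · rw [simple_of_ne i hne h2]
        have hne : j.1 ≠ i.1 := fun h ↦ hne (Fin.ext h)
        have h2 : j.1 ≠ i.1 + 1 := fun h ↦ h2 (Fin.ext h)
        rw [Fin.le_def] at hj ⊢
        simp only [lo_val, hi_val] at *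
        omega
    by_cases hx2 : x = hi i
    · subst hx2
      rw [simple_hi] at hj
      by_cases h1 : j = lo i
      · rw [h1, simple_lo]
      have h2 : j ≠ hi i := by rintro rfl; exact absurd (lo_lt_hi i) (not_lt.2 hj)
      rw [simple_of_ne i h1 h2]
      exact hj.trans (lo_lt_hi i).le
    rw [simple_of_ne i hx1 hx2] at hj
    by_cases h1 : j = lo i
    · subst h1
      rw [simple_lo]
      have hx1 : x.1 ≠ i.1 := fun h ↦ hx1 (Fin.ext h)
      have hx2 : x.1 ≠ i.1 + 1 := fun h ↦ hx2 (Fin.ext h)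
      rw [Fin.le_def] at hj ⊢
      simp only [lo_val, hi_val] at *
      omega
    by_cases h2 : j = hi i
    · subst h2
      rw [simple_hi]
      exact (lo_lt_hi i).le.trans hj
    rwa [simple_of_ne i h1 h2]

/-- The content of a cell. -/
def cont (u : ℕ × ℕ) : ℤ := u.2 - u.1

/-- No entry lies between two consecutive ones, so the order interval between their cells contains
nothing but its end points. -/
theorem Tab.adjacent (t : Tab k) {i : Fin (k - 1)} (h : t.1 (lo i) ≤ t.1 (hi i)) :
    t.1 (hi i) = ((t.1 (lo i)).1 + 1, (t.1 (lo i)).2) ∨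
      t.1 (hi i) = ((t.1 (lo i)).1, (t.1 (lo i)).2 + 1) := by
  have key : ∀ u, t.1 (lo i) ≤ u → u ≤ t.1 (hi i) → u = t.1 (lo i) ∨ u = t.1 (hi i) := by
    intro u h1 h2
    obtain ⟨j, hj, rfl⟩ := t.2.lower _ _ h2
    have := t.le_of_le h1
    rw [Fin.le_def] at this hj
    simp only [lo_val, hi_val] at this hj
    rcases Nat.lt_or_ge i.1 j.1 with h3 | h3
    · right; exact congrArg t.1 (Fin.ext (by rw [hi_val]; omega))
    · left; exact congrArg t.1 (Fin.ext (by rw [lo_val]; omega))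
  have hne : t.1 (lo i) ≠ t.1 (hi i) := fun h ↦ lo_ne_hi i (t.2.inj h)
  generalize t.1 (lo i) = u at *
  generalize t.1 (hi i) = v at *
  obtain ⟨a, b⟩ := u
  obtain ⟨c, d⟩ := v
  simp only [Prod.mk_le_mk] at h
  rcases Nat.lt_or_ge a c with h1 | h1
  · left
    have := key (a + 1, b) (by simp) (by simp; omega)
    simp at this ⊢
    omega
  · right
    have hbd : b < d := lt_of_le_of_ne h.2 fun h2 ↦ hne (by ext <;> simp <;> omega)
    have := key (a, b + 1) (by simp) (by simp; omega)
    simp at this ⊢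
    omega

/-- Comparability is thereby read off from the contents, which are all that the seminormal
coefficients depend on. -/
theorem Tab.le_iff (t : Tab k) (i : Fin (k - 1)) : t.1 (lo i) ≤ t.1 (hi i) ↔
    cont (t.1 (hi i)) - cont (t.1 (lo i)) = 1 ∨ cont (t.1 (hi i)) - cont (t.1 (lo i)) = -1 := by
  constructor
  · intro h
    rcases t.adjacent h with h | h
    · right; rw [h, cont, cont]; push_cast; ring
    · left; rw [h, cont, cont]; push_cast; ring
  · intro h
    by_contra hle
    have hle' : ¬ t.1 (hi i) ≤ t.1 (lo i) := fun h ↦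
      absurd (lo_lt_hi i) (not_lt.2 (t.le_of_le h))
    simp only [cont, Prod.le_def] at *
    omega

/-- If two cells lie on one diagonal, the cells below and to the right of the first one carry two
distinct entries strictly in between. -/
theorem Tab.add_three_le (t : Tab k) {i j : Fin k} (hij : i < j)
    (h : cont (t.1 i) = cont (t.1 j)) : i.1 + 3 ≤ j.1 := by
  have hle' : ¬ t.1 j ≤ t.1 i := fun h ↦ absurd hij (not_lt.2 (t.le_of_le h))
  have h1 : ((t.1 i).1 + 1, (t.1 i).2) ≤ t.1 j := by
    simp only [cont, Prod.le_def] at *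
    omega
  have h2 : ((t.1 i).1, (t.1 i).2 + 1) ≤ t.1 j := by
    simp only [cont, Prod.le_def] at *
    omega
  obtain ⟨a, ha, ea⟩ := t.2.lower _ _ h1
  obtain ⟨b, hb, eb⟩ := t.2.lower _ _ h2
  have ia : i ≤ a := t.le_of_le (by rw [ea]; simp [Prod.le_def])
  have ib : i ≤ b := t.le_of_le (by rw [eb]; simp [Prod.le_def])
  have nai : a ≠ i := by rintro rfl; have := congrArg Prod.fst ea; simp at this
  have nbi : b ≠ i := by rintro rfl; have := congrArg Prod.snd eb; simp at this
  have nab : a ≠ b := by rintro rfl; rw [ea] at eb; have := congrArg Prod.fst eb; simp at this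
  have naj : a ≠ j := by
    rintro rfl
    rw [ea, cont, cont] at h; push_cast at h; omega
  have nbj : b ≠ j := by
    rintro rfl
    rw [eb, cont, cont] at h; push_cast at h; omega
  rw [Ne, Fin.ext_iff] at nai nbi nab naj nbj
  rw [Fin.le_def] at *
  omega

/-- At the first disagreement the two cells lie on one diagonal, so one of them is smaller. It must
already have been filled earlier in the other tableau, hence earlier in both, which contradicts
injectivity. -/
theorem Tab.ext_cont {s t : Tab k} (h : ∀ i, cont (s.1 i) = cont (t.1 i)) : s = t := by
  have key : ∀ (s t : Tab k) (i : Fin k), (∀ j < i, s.1 j = t.1 j) →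
      cont (s.1 i) = cont (t.1 i) → ¬ (s.1 i).1 < (t.1 i).1 := by
    intro s t i ih hc hlt
    have hle : s.1 i ≤ t.1 i := by
      simp only [cont, Prod.le_def] at *
      omega
    obtain ⟨j, hj, e⟩ := t.2.lower _ _ hle
    have hji : j < i := lt_of_le_of_ne hj (by rintro rfl; rw [e] at hlt; exact lt_irrefl _ hlt)
    rw [← ih j hji] at e
    exact hji.ne (s.2.inj e)
  have main : ∀ n, ∀ i : Fin k, i.1 = n → s.1 i = t.1 i := by
    intro n
    induction n using Nat.strong_induction_on with
    | _ n ih =>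
      rintro i rfl
      have h1 := key s t i (fun j hj ↦ ih j.1 hj j rfl) (h i)
      have h2 := key t s i (fun j hj ↦ (ih j.1 hj j rfl).symm) (h i).symm
      have h3 := h i
      simp only [cont] at h3
      ext <;> omega
  exact Subtype.ext (funext fun i ↦ main _ i rfl)

/-- A reduced word of `w` can be followed through standard tableaux. If `w` has an ascent at `i` and
`s ∘ (w s_i)` is standard, the cells of `i` and `i + 1` in it are not comparable, because `s` fills
them in the opposite order; so undoing `s_i` preserves standardness. -/
theorem tab_block_induction {α : Type*} [PartialOrder α] {b : Fin k → α} (hb : Monotone b)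
    {P : Tab k → Prop}
    (step : ∀ (t : Tab k) (i : Fin (k - 1)), b (lo i) = b (hi i) →
      ∀ h : IsStd (t.1 ∘ simple k i), P t → P ⟨t.1 ∘ simple k i, h⟩)
    {s t : Tab k} (w : Equiv.Perm (Fin k)) (hw : b ∘ w = b) (hst : t.1 = s.1 ∘ w) (hs : P s) :
    P t := by
  refine block_induction hb (P := fun w ↦ ∀ t : Tab k, t.1 = s.1 ∘ w → P t) ?_ ?_ w hw t hst
  · intro t ht
    rwa [Subtype.ext (a1 := t) (a2 := s) (by rw [ht]; rfl)]
  · intro w i _ hbi hlt ih t ht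
    have h1 : s.1 ∘ w = t.1 ∘ simple k i := by rw [ht]; ext1 x; simp
    have h2 : IsStd (s.1 ∘ w) := by
      rw [h1, t.2.comp_simple_iff, ht]
      intro hle
      simp only [Function.comp_apply, Equiv.Perm.mul_apply, simple_lo, simple_hi] at hle
      exact absurd hlt (not_lt.2 (s.le_of_le hle))
    have h3 : (s.1 ∘ w) ∘ simple k i = t.1 := by rw [ht]; rfl
    have h4 : IsStd ((s.1 ∘ w) ∘ simple k i) := h3.symm ▸ t.2
    have h5 : t = ⟨_, h4⟩ := Subtype.ext h3.symm
    rw [h5]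
    exact step ⟨_, h2⟩ i hbi h4 (ih _ rfl)

theorem exists_perm_of_cells_eq {s t : Tab k} (h : cells s = cells t) :
    ∃ w : Equiv.Perm (Fin k), t.1 = s.1 ∘ w := by
  have : ∀ i, ∃ j, s.1 j = t.1 i := fun i ↦ mem_cells.1 (h ▸ mem_cells.2 ⟨i, rfl⟩)
  choose f hf using this
  have hf' : Function.Injective f := fun a b hab ↦ t.2.inj (by rw [← hf a, ← hf b, hab])
  exact ⟨Equiv.ofBijective f (Finite.injective_iff_bijective.1 hf'), funext fun i ↦ (hf i).symm⟩

/-! ### Counting standard tableaux -/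

theorem bound_of_isLowerSet {s : Finset (ℕ × ℕ)} (hs : IsLowerSet (s : Set (ℕ × ℕ)))
    {u : ℕ × ℕ} (hu : u ∈ s) : u.1 < s.card ∧ u.2 < s.card := by
  have := shape_cells_subset (⟨⟨s, hs⟩, rfl⟩ : Shape s.card) hu
  rwa [Finset.mem_product, Finset.mem_range, Finset.mem_range] at this

open Classical in
/-- The cells that can be added to a Young diagram. -/
def addable (s : Finset (ℕ × ℕ)) : Finset (ℕ × ℕ) :=
  (Finset.range (s.card + 1) ×ˢ Finset.range (s.card + 1)).filter fun u ↦
    u ∉ s ∧ IsLowerSet (insert u s : Set (ℕ × ℕ))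

open Classical in
/-- The cells that can be removed from a Young diagram. -/
def removable (s : Finset (ℕ × ℕ)) : Finset (ℕ × ℕ) :=
  s.filter fun u ↦ IsLowerSet (s.erase u : Set (ℕ × ℕ))

theorem mem_addable {s : Finset (ℕ × ℕ)} {u : ℕ × ℕ} :
    u ∈ addable s ↔ u ∉ s ∧ IsLowerSet (insert u s : Set (ℕ × ℕ)) := by
  classical
  rw [addable, Finset.mem_filter, and_iff_right_iff_imp]
  rintro ⟨h1, h2⟩
  rw [← Finset.coe_insert] at h2
  have := bound_of_isLowerSet h2 (Finset.mem_insert_self u s)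
  rw [Finset.card_insert_of_notMem h1] at this
  simpa using this

theorem mem_removable {s : Finset (ℕ × ℕ)} {u : ℕ × ℕ} :
    u ∈ removable s ↔ u ∈ s ∧ IsLowerSet (s.erase u : Set (ℕ × ℕ)) := by
  classical
  rw [removable, Finset.mem_filter]

theorem mem_addable_iff {μ : YoungDiagram} {i j : ℕ} :
    (i, j) ∈ addable μ.cells ↔ j = μ.rowLen i ∧ (i = 0 ∨ μ.rowLen i < μ.rowLen (i - 1)) := by
  rw [mem_addable]
  constructor
  · rintro ⟨h1, h2⟩
    rw [YoungDiagram.mem_cells, YoungDiagram.mem_iff_lt_rowLen] at h1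
    have hj : j = μ.rowLen i := by
      by_contra hne
      have := h2 (a := (i, j)) (b := (i, j - 1)) (by simp) (by simp)
      simp [YoungDiagram.mem_iff_lt_rowLen] at this
      omega
    refine ⟨hj, or_iff_not_imp_left.2 fun hi ↦ ?_⟩
    have := h2 (a := (i, j)) (b := (i - 1, j)) (by simp) (by simp)
    simp [YoungDiagram.mem_iff_lt_rowLen] at this
    omega
  · rintro ⟨rfl, h⟩
    refine ⟨by simp [YoungDiagram.mem_iff_lt_rowLen], ?_⟩
    rintro ⟨a, b⟩ ⟨c, d⟩ hle hab
    simp only [Set.mem_insert_iff, Finset.mem_coe, YoungDiagram.mem_cells, Prod.mk.injEq] at hab ⊢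
    rcases hab with ⟨rfl, rfl⟩ | hab
    · rw [Prod.mk_le_mk] at hle
      rcases hle.1.eq_or_lt with rfl | hlt
      · rcases hle.2.eq_or_lt with rfl | hlt
        · simp
        · right; exact YoungDiagram.mem_iff_lt_rowLen.2 hlt
      · right
        rw [YoungDiagram.mem_iff_lt_rowLen]
        have := μ.rowLen_anti c (a - 1) (by omega)
        omega
    · right; exact μ.isLowerSet hle hab

theorem mem_removable_iff {μ : YoungDiagram} {i j : ℕ} :
    (i, j) ∈ removable μ.cells ↔ j + 1 = μ.rowLen i ∧ μ.rowLen (i + 1) < μ.rowLen i := by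
  rw [mem_removable]
  constructor
  · rintro ⟨h1, h2⟩
    rw [YoungDiagram.mem_cells, YoungDiagram.mem_iff_lt_rowLen] at h1
    have key : ∀ a b, (i, j) ≤ (a, b) → (a, b) ≠ (i, j) → ¬ b < μ.rowLen a := by
      intro a b hle hne hlt
      have hab : (a, b) ∈ (μ.cells.erase (i, j) : Set (ℕ × ℕ)) := by
        simp only [Finset.coe_erase, Set.mem_sdiff, Finset.mem_coe, YoungDiagram.mem_cells,
          YoungDiagram.mem_iff_lt_rowLen, Set.mem_singleton_iff]
        exact ⟨hlt, hne⟩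
      simpa using h2 hle hab
    have k1 := key i (j + 1) (by simp) (by simp)
    have k2 := key (i + 1) j (by simp) (by simp)
    omega
  · rintro ⟨h1, h2⟩
    refine ⟨by rw [YoungDiagram.mem_cells, YoungDiagram.mem_iff_lt_rowLen]; omega, ?_⟩
    rintro ⟨a, b⟩ ⟨c, d⟩ hle hab
    simp only [Finset.coe_erase, Set.mem_sdiff, Finset.mem_coe, YoungDiagram.mem_cells,
      Set.mem_singleton_iff, Prod.mk.injEq] at hab ⊢
    refine ⟨μ.isLowerSet hle hab.1, ?_⟩
    rintro ⟨rfl, rfl⟩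
    have h3 := YoungDiagram.mem_iff_lt_rowLen.1 hab.1
    rw [Prod.mk_le_mk] at hle
    rcases hle.1.eq_or_lt with rfl | hlt
    · omega
    · have := μ.rowLen_anti (c + 1) a (by omega)
      omega

/-- Corners alternate along the boundary: a cell can be added in row `i + 1` exactly if the last
cell of row `i` can be removed. The addable cell of the top row is left over. -/
theorem card_addable {s : Finset (ℕ × ℕ)} (hs : IsLowerSet (s : Set (ℕ × ℕ))) :
    (addable s).card = (removable s).card + 1 := by
  obtain ⟨μ, rfl⟩ : ∃ μ : YoungDiagram, μ.cells = s := ⟨⟨s, hs⟩, rfl⟩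
  have h0 : (0, μ.rowLen 0) ∈ addable μ.cells := mem_addable_iff.2 ⟨rfl, Or.inl rfl⟩
  rw [← Finset.card_erase_add_one h0]
  congr 1
  refine Finset.card_nbij' (fun p ↦ (p.1 - 1, μ.rowLen (p.1 - 1) - 1))
    (fun p ↦ (p.1 + 1, μ.rowLen (p.1 + 1))) ?_ ?_ ?_ ?_
  · rintro ⟨i, j⟩ hp
    simp only [Finset.mem_coe, Finset.mem_erase, mem_addable_iff, mem_removable_iff, Ne,
      Prod.mk.injEq] at hp ⊢
    obtain ⟨h1, h2, h3⟩ := hp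
    have hi : i ≠ 0 := by rintro rfl; exact h1 ⟨rfl, h2⟩
    have hi' : i - 1 + 1 = i := by omega
    rw [hi']
    have := h3.resolve_left hi
    omega
  · rintro ⟨i, j⟩ hp
    simp only [Finset.mem_coe, Finset.mem_erase, mem_addable_iff, mem_removable_iff, Ne,
      Prod.mk.injEq] at hp ⊢
    simp
    omega
  · rintro ⟨i, j⟩ hp
    simp only [Finset.mem_coe, Finset.mem_erase, mem_addable_iff, Ne, Prod.mk.injEq] at hp ⊢
    obtain ⟨h1, h2, h3⟩ := hp
    have hi : i ≠ 0 := by rintro rfl; exact h1 ⟨rfl, h2⟩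
    have hi' : i - 1 + 1 = i := by omega
    rw [hi', h2]
    simp
  · rintro ⟨i, j⟩ hp
    simp only [Finset.mem_coe, mem_removable_iff, Prod.mk.injEq] at hp ⊢
    simp
    omega

open Classical in
/-- The number of standard tableaux with a given set of cells. -/
def numTab (n : ℕ) (s : Finset (ℕ × ℕ)) : ℕ := ∑ t : Tab n, if cells t = s then 1 else 0

theorem numTab_eq_zero {n : ℕ} {s : Finset (ℕ × ℕ)} (hs : ¬ IsLowerSet (s : Set (ℕ × ℕ))) :
    numTab n s = 0 :=
  Finset.sum_eq_zero fun t _ ↦ if_neg fun h : cells t = s ↦ hs (h ▸ isLowerSet_cells t)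

theorem isStd_snoc {n : ℕ} (t : Tab n) {u : ℕ × ℕ} (hu : u ∈ addable (cells t)) :
    IsStd (Fin.snoc t.1 u : Fin (n + 1) → ℕ × ℕ) := by
  rw [mem_addable] at hu
  constructor
  · rw [Fin.snoc_injective_iff]
    refine ⟨t.2.inj, ?_⟩
    rintro ⟨i, hi⟩
    exact hu.1 (mem_cells.2 ⟨i, hi⟩)
  · intro i v hv
    induction i using Fin.lastCases with
    | last =>
      rw [Fin.snoc_last] at hv
      have := hu.2 hv (Set.mem_insert _ _)
      rcases this with rfl | h
      · exact ⟨Fin.last n, le_rfl, by simp⟩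
      · obtain ⟨j, hj⟩ := mem_cells.1 h
        exact ⟨j.castSucc, Fin.le_last _, by simpa using hj⟩
    | cast i =>
      rw [Fin.snoc_castSucc] at hv
      obtain ⟨j, hj, e⟩ := t.2.lower i v hv
      exact ⟨j.castSucc, by simpa using hj, by simpa using e⟩

theorem isStd_init {n : ℕ} (t : Tab (n + 1)) : IsStd (t.1 ∘ Fin.castSucc) := by
  refine ⟨t.2.inj.comp (Fin.castSucc_injective n), fun i u hu ↦ ?_⟩
  obtain ⟨j, hj, e⟩ := t.2.lower i.castSucc u hu
  have : j ≠ Fin.last n := by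
    rintro rfl
    exact absurd (Fin.castSucc_lt_last i) (not_lt.2 hj)
  obtain ⟨j, rfl⟩ := Fin.exists_castSucc_eq.2 this
  exact ⟨j, by simpa using hj, e⟩

theorem insert_cells_init {n : ℕ} (t : Tab (n + 1)) :
    insert (t.1 (Fin.last n)) (cells ⟨_, isStd_init t⟩) = cells t := by
  ext u
  rw [Finset.mem_insert, mem_cells, mem_cells]
  constructor
  · rintro (rfl | ⟨i, rfl⟩)
    exacts [⟨_, rfl⟩, ⟨_, rfl⟩]
  · rintro ⟨i, rfl⟩
    induction i using Fin.lastCases with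
    | last => exact Or.inl rfl
    | cast i => exact Or.inr ⟨i, rfl⟩

/-- A standard tableau is obtained by adding a cell to a smaller one. -/
def tabSuccEquiv (n : ℕ) : Tab (n + 1) ≃ Σ t : Tab n, {u // u ∈ addable (cells t)} where
  toFun t := ⟨⟨_, isStd_init t⟩, t.1 (Fin.last n), by
    rw [mem_addable, ← Finset.coe_insert, insert_cells_init]
    refine ⟨fun h ↦ ?_, isLowerSet_cells t⟩
    obtain ⟨i, hi⟩ := mem_cells.1 h
    exact (Fin.castSucc_lt_last i).ne (t.2.inj hi)⟩
  invFun p := ⟨_, isStd_snoc p.1 p.2.2⟩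
  left_inv t := Subtype.ext (Fin.snoc_init_self (α := fun _ ↦ ℕ × ℕ) t.1)
  right_inv p := by
    obtain ⟨⟨t, ht⟩, u, hu⟩ := p
    have h1 : (Fin.snoc t u : Fin (n + 1) → ℕ × ℕ) ∘ Fin.castSucc = t := by ext1 i; simp
    have h2 : (Fin.snoc t u : Fin (n + 1) → ℕ × ℕ) (Fin.last n) = u := by simp
    rw [Sigma.mk.injEq]
    refine ⟨Subtype.ext h1, ?_⟩
    congr! 1
    · simp only [h1]

theorem sum_tab_succ {n : ℕ} (G : Finset (ℕ × ℕ) → ℕ) :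
    ∑ t : Tab (n + 1), G (cells t) =
      ∑ t : Tab n, ∑ u ∈ addable (cells t), G (insert u (cells t)) := by
  simp_rw [← Finset.sum_coe_sort (addable _)]
  rw [← Fintype.sum_sigma' (fun (t : Tab n) (u : {u // u ∈ addable (cells t)}) ↦
    G (insert u.1 (cells t)))]
  exact Fintype.sum_equiv (tabSuccEquiv n) _ _ fun t ↦ congrArg G (insert_cells_init t).symm

theorem numTab_succ (n : ℕ) {s : Finset (ℕ × ℕ)} (hs : IsLowerSet (s : Set (ℕ × ℕ))) :
    numTab (n + 1) s = ∑ u ∈ s, numTab n (s.erase u) := by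
  classical
  unfold numTab
  rw [sum_tab_succ (fun c ↦ if c = s then 1 else 0), Finset.sum_comm]
  refine Finset.sum_congr rfl fun t _ ↦ ?_
  rw [← Finset.sum_filter, ← Finset.sum_filter]
  refine Finset.sum_congr ?_ fun _ _ ↦ rfl
  ext u
  rw [Finset.mem_filter, Finset.mem_filter, mem_addable]
  constructor
  · rintro ⟨⟨h1, -⟩, rfl⟩
    exact ⟨Finset.mem_insert_self _ _, by rw [Finset.erase_insert h1]⟩
  · rintro ⟨h1, h2⟩
    rw [h2, ← Finset.coe_insert, Finset.insert_erase h1]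
    exact ⟨⟨Finset.notMem_erase _ _, hs⟩, rfl⟩

/-- This is the relation `DU - UD = 1` of Young's lattice applied to the numbers `f^λ`. Adding `u`
and removing `v` commute for `u ≠ v`, and the surplus of one addable over the removable cells
(`card_addable`) raises the factor from `n` to `n + 1`. -/
theorem sum_numTab_addable (n : ℕ) {s : Finset (ℕ × ℕ)} (hs : IsLowerSet (s : Set (ℕ × ℕ)))
    (hc : s.card = n) : ∑ u ∈ addable s, numTab (n + 1) (insert u s) = (n + 1) * numTab n s := by
  classical
  induction n generalizing s with
  | zero =>
    obtain rfl := Finset.card_eq_zero.1 hc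
    have h1 : addable ∅ = {((0, 0) : ℕ × ℕ)} := by
      ext ⟨i, j⟩
      have h := mem_addable_iff (μ := ⊥) (i := i) (j := j)
      have h0 : ∀ i, (⊥ : YoungDiagram).rowLen i = 0 := fun i ↦ by
        rw [YoungDiagram.rowLen_eq_card]; rfl
      simp only [h0, YoungDiagram.cells_bot] at h
      rw [h]
      simp [and_comm]
    rw [h1, Finset.sum_singleton, numTab_succ]
    · simp
    · intro u v hvu hu
      simp only [insert_empty_eq, Finset.coe_singleton, Set.mem_singleton_iff] at hu ⊢
      subst hu
      exact le_antisymm hvu (by simp [Prod.le_def])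
  | succ n ih =>
    -- Sets that are not Young diagrams have no tableaux, so `v` may range over all of `s`. If `v`
    -- is removable, it can itself be added to `s.erase v`, and this is the extra summand.
    have key : ∀ v ∈ s, ∑ u ∈ addable s, numTab (n + 1) (insert u (s.erase v)) +
        (if v ∈ removable s then numTab (n + 1) s else 0) = (n + 1) * numTab n (s.erase v) := by
      intro v hv
      by_cases hr : v ∈ removable s
      · have hr' := (mem_removable.1 hr).2
        rw [if_pos hr, ← ih hr' (by rw [Finset.card_erase_of_mem hv, hc]; rfl)]
        have hva : v ∈ addable (s.erase v) := by
          rw [mem_addable, ← Finset.coe_insert, Finset.insert_erase hv]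
          exact ⟨Finset.notMem_erase _ _, hs⟩
        rw [← Finset.sum_erase_add _ _ hva, Finset.insert_erase hv]
        congr 1
        symm
        apply Finset.sum_subset
        · intro u hu
          rw [Finset.mem_erase, mem_addable] at hu
          obtain ⟨h1, h2, h3⟩ := hu
          rw [mem_addable]
          refine ⟨fun h ↦ h2 (Finset.mem_erase.2 ⟨h1, h⟩), ?_⟩
          have := hs.union h3
          convert this using 1
          ext x
          simp only [Set.mem_insert_iff, Finset.mem_coe, Finset.coe_erase, Set.mem_union,
            Set.mem_sdiff, Set.mem_singleton_iff]
          tauto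
        · intro u hu hu'
          rw [mem_addable] at hu
          apply numTab_eq_zero
          intro h
          rw [Finset.coe_insert] at h
          apply hu'
          rw [Finset.mem_erase, mem_addable]
          exact ⟨by rintro rfl; exact hu.1 hv, fun h ↦ hu.1 (Finset.mem_of_mem_erase h), h⟩
      · rw [if_neg hr, add_zero, numTab_eq_zero fun h ↦ hr (mem_removable.2 ⟨hv, h⟩), mul_zero]
        refine Finset.sum_eq_zero fun u hu ↦ numTab_eq_zero fun h ↦ hr (mem_removable.2 ⟨hv, ?_⟩)
        rw [mem_addable] at hu
        convert h.inter hs using 1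
        ext x
        simp only [Finset.coe_insert, Finset.coe_erase, Set.mem_inter_iff, Set.mem_insert_iff,
          Set.mem_sdiff, Finset.mem_coe, Set.mem_singleton_iff]
        constructor
        · tauto
        · rintro ⟨rfl | h1, h2⟩
          exacts [absurd h2 hu.1, h1]
    have h1 := Finset.sum_congr rfl key
    rw [Finset.sum_add_distrib, Finset.sum_comm, ← Finset.mul_sum, ← numTab_succ n hs,
      ← Finset.sum_filter, Finset.sum_const, smul_eq_mul] at h1
    have h2 : s.filter (· ∈ removable s) = removable s := by
      ext u
      rw [Finset.mem_filter, and_iff_right_iff_imp]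
      exact fun h ↦ (mem_removable.1 h).1
    have h3 : ∀ u ∈ addable s, numTab (n + 2) (insert u s) =
        numTab (n + 1) s + ∑ v ∈ s, numTab (n + 1) (insert u (s.erase v)) := by
      intro u hu
      rw [mem_addable, ← Finset.coe_insert] at hu
      rw [numTab_succ _ hu.2, Finset.sum_insert hu.1, Finset.erase_insert hu.1]
      congr 1
      refine Finset.sum_congr rfl fun v hv ↦ ?_
      rw [Finset.erase_insert_of_ne]
      rintro rfl
      exact hu.1 hv
    rw [Finset.sum_congr rfl h3, Finset.sum_add_distrib, Finset.sum_const, smul_eq_mul,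
      card_addable hs]
    rw [h2] at h1
    have : (n + 1 + 1) * numTab (n + 1) s = (n + 1) * numTab (n + 1) s + numTab (n + 1) s := by ring
    rw [this, ← h1]
    ring

/-- The sum runs over tableaux and counts for each one those of the same shape, so it is `∑ (f^λ)²`.
-/
theorem sum_numTab_cells (n : ℕ) : ∑ t : Tab n, numTab n (cells t) = n.factorial := by
  induction n with
  | zero =>
    have : ∀ t : Tab 0, cells t = ∅ := fun t ↦ Finset.card_eq_zero.1 (card_cells t)
    have hs : Subsingleton (Tab 0) := ⟨fun s t ↦ Subtype.ext (Subsingleton.elim _ _)⟩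
    have t0 : Tab 0 := ⟨Fin.elim0, fun i ↦ i.elim0, fun i ↦ i.elim0⟩
    have hc : Fintype.card (Tab 0) = 1 := Fintype.card_eq_one_iff.2 ⟨t0, fun t ↦ hs.elim _ _⟩
    simp [numTab, this, hc]
  | succ n ih =>
    rw [sum_tab_succ (numTab (n + 1)), Finset.sum_congr rfl fun t _ ↦
      sum_numTab_addable n (isLowerSet_cells t) (card_cells t), ← Finset.mul_sum, ih,
      Nat.factorial_succ]

/-- Pairs of tableaux of the same shape. -/
abbrev TabPair (k : ℕ) : Type := {p : Tab k × Tab k // shape p.1 = shape p.2}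

instance : Fintype (TabPair k) := Fintype.ofFinite _

theorem card_tabPair (k : ℕ) : Fintype.card (TabPair k) = k.factorial := by
  classical
  rw [← sum_numTab_cells, Fintype.card_subtype, ← Finset.univ_product_univ, Finset.card_filter,
    Finset.sum_product]
  refine Finset.sum_congr rfl fun t _ ↦ Finset.sum_congr rfl fun s _ ↦ ?_
  simp only [shape_eq_iff, eq_comm]

end Tableaux

/-! ### The seminormal representation -/

section Seminormal

/-- The braid relation for the seminormal operators, reduced to scalars. The indices are the six
orders in which three consecutive cells can be filled; `f`, `h`, `k` are the values of a function
after none, one and two operators, and the primes mark the other side of the relation. `x`, `y`, `z`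
are the coefficients of the pairs 12, 23, 13, and `c₁₂`, `c₂₃`, `c₁₃` say that the cells of a pair
are comparable, in which case the exchanged filling is not standard. If no pair is comparable, `hR`
does the work. The alternatives in `e4` and `e4'` cover values that are not needed later. -/
theorem braid_values {q p x y z : ℂ} {c₁₂ c₁₃ c₂₃ : Prop} [Decidable c₁₂] [Decidable c₁₃]
    [Decidable c₂₃] (hqp : q * p = 1)
    (hR : (q - x) * (q - y) = (q - z) * (q + p - x - y))
    (hx : c₁₂ → x = 0 ∨ x = q + p) (hz : c₁₃ → ¬ (c₁₂ ∧ c₂₃) → z = 0 ∨ z = q + p)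
    (hy : c₂₃ → y = 0 ∨ y = q + p) (hxy : c₁₂ → c₂₃ → x = y) (hxz : c₁₂ → c₁₃ → ¬ c₂₃ → x + z = q + p)
    (hyz : c₂₃ → c₁₃ → ¬ c₁₂ → y + z = q + p)
    {f123 f213 f132 f231 f312 f321 : ℂ}
    (z213 : c₁₂ → f213 = 0)
    (z132 : c₂₃ → f132 = 0)
    (z231 : c₁₂ ∨ c₁₃ → f231 = 0)
    (z312 : c₂₃ ∨ c₁₃ → f312 = 0)
    (z321 : c₁₂ ∨ c₂₃ → f321 = 0)
    {h123 h132 h213 h231 k123 k213 h123' h132' h213' h312' k123' k132' : ℂ}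
    (e1 : h123 = q * f123 + x * (f213 - f123))
    (e2 : h132 = if c₂₃ then 0 else q * f132 + z * (f312 - f132))
    (e3 : h213 = if c₁₂ then 0 else q * f213 + (q + p - x) * (f123 - f213))
    (e4 : c₁₂ ∨ h231 = if c₁₃ then 0 else q * f231 + y * (f321 - f231))
    (e5 : k123 = q * h123 + y * (h132 - h123))
    (e6 : k213 = if c₁₂ then 0 else q * h213 + z * (h231 - h213))
    (e1' : h123' = q * f123 + y * (f132 - f123))
    (e2' : h132' = if c₂₃ then 0 else q * f132 + (q + p - y) * (f123 - f132))
    (e3' : h213' = if c₁₂ then 0 else q * f213 + z * (f231 - f213))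
    (e4' : c₂₃ ∨ h312' = if c₁₃ then 0 else q * f312 + x * (f321 - f312))
    (e5' : k123' = q * h123' + x * (h213' - h123'))
    (e6' : k132' = if c₂₃ then 0 else q * h132' + z * (h312' - h132')) :
    q * k123 + x * (k213 - k123) = q * k123' + y * (k132' - k123') := by
  by_cases c12 : c₁₂ <;> by_cases c13 : c₁₃ <;> by_cases c23 : c₂₃ <;>
    simp only [c12, c13, c23, not_true_eq_false, not_false_eq_true, and_self, and_true, and_false, true_implies, false_implies, if_true, if_false, false_or, true_or, or_true, or_false, or_self, forall_const] at hx hy hz hxy hxz hyz z213 z132 z231 z312 z321 e2 e3 e4 e6 e2' e3' e4' e6' <;> subst_vars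
  · ring
  · obtain rfl := eq_sub_of_add_eq' hxz
    rcases hx with rfl | rfl 
    · grind
    · grind
  · ring
  · rcases hx with rfl | rfl 
    · grind
    · grind
  · obtain rfl := eq_sub_of_add_eq' hyz
    rcases hy with rfl | rfl 
    · grind
    · grind
  · rcases hz with rfl | rfl 
    · grind
    · grind
  · rcases hy with rfl | rfl 
    · grind
    · grind
  · grind

variable (q : ℂˣ)

/-- The coefficient `(q⁻¹ b - q a) / (b - a)` of the seminormal representation. -/
def gco (a b : ℂ) : ℂ := ((q : ℂ)⁻¹ * b - q * a) / (b - a)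

/-- The weight `q ^ (2 c)` of a cell of content `c`. -/
def wt (u : ℕ × ℕ) : ℂ := (q : ℂ) ^ (2 * cont u)

theorem wt_ne_zero (u : ℕ × ℕ) : wt q u ≠ 0 := zpow_ne_zero _ q.ne_zero

theorem gco_swap {a b : ℂ} (h : a ≠ b) : gco q b a = q + (q : ℂ)⁻¹ - gco q a b := by
  have h1 : a - b ≠ 0 := sub_ne_zero.2 h
  have h2 : b - a ≠ 0 := sub_ne_zero.2 h.symm
  have hq := q.ne_zero
  rw [gco, gco, ← neg_sub b a]
  field_simp
  ring

theorem gco_relation {a b c : ℂ} (hab : a ≠ b) (hac : a ≠ c) (hbc : b ≠ c) :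
    (q - gco q a b) * (q - gco q b c) =
      (q - gco q a c) * (q + (q : ℂ)⁻¹ - gco q a b - gco q b c) := by
  have h1 : b - a ≠ 0 := sub_ne_zero.2 hab.symm
  have h2 : c - a ≠ 0 := sub_ne_zero.2 hac.symm
  have h3 : c - b ≠ 0 := sub_ne_zero.2 hbc.symm
  have hq := q.ne_zero
  unfold gco
  field_simp
  ring

theorem wt_eq_of_sub {u v : ℕ × ℕ} (h : cont v - cont u = 1) : wt q v = q ^ 2 * wt q u := by
  have : cont v = cont u + 1 := by omega
  rw [wt, wt, this, mul_add, zpow_add₀ q.ne_zero, mul_comm]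
  rfl

variable {k : ℕ}

open Classical in
/-- Extension by zero of a function on the standard tableaux. -/
def ext0 (f : Tab k → ℂ) (t : Fin k → ℕ × ℕ) : ℂ := if h : IsStd t then f ⟨t, h⟩ else 0

theorem ext0_tab (f : Tab k → ℂ) (t : Tab k) : ext0 f t.1 = f t := dif_pos t.2

theorem ext0_of_not {f : Tab k → ℂ} {t : Fin k → ℕ × ℕ} (h : ¬ IsStd t) : ext0 f t = 0 := dif_neg h

/-- The weight coefficient of a sequence of cells at the `i`-th simple transposition. -/
def gAt (i : Fin (k - 1)) (t : Fin k → ℕ × ℕ) : ℂ := gco q (wt q (t (lo i))) (wt q (t (hi i)))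

/-- The operator by which `T_i` acts in the seminormal representation. -/
def snOp (i : Fin (k - 1)) : Module.End ℂ (Tab k → ℂ) where
  toFun f t := q * f t + gAt q i t.1 * (ext0 f (t.1 ∘ simple k i) - f t)
  map_add' f g := by
    funext t
    simp only [ext0, Pi.add_apply]
    split_ifs <;> ring
  map_smul' c f := by
    funext t
    simp only [ext0, Pi.smul_apply, smul_eq_mul, RingHom.id_apply]
    split_ifs <;> ring

open Classical in
theorem ext0_snOp (i : Fin (k - 1)) (f : Tab k → ℂ) (t : Fin k → ℕ × ℕ) :
    ext0 (snOp q i f) t = if IsStd t then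
      q * ext0 f t + gAt q i t * (ext0 f (t ∘ simple k i) - ext0 f t) else 0 := by
  by_cases h : IsStd t
  · have h1 : ext0 f t = f ⟨t, h⟩ := ext0_tab f ⟨t, h⟩
    rw [if_pos h, h1]
    exact ext0_tab _ ⟨t, h⟩
  · rw [if_neg h, ext0_of_not h]

theorem ite_of_iff_not {P Q : Prop} [Decidable P] [Decidable Q] (h : P ↔ ¬ Q) (a : ℂ) :
    (if P then a else 0) = if Q then 0 else a := by
  by_cases hQ : Q
  · rw [if_pos hQ, if_neg fun hP ↦ h.1 hP hQ]
  · rw [if_neg hQ, if_pos (h.2 hQ)]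

theorem comp_simple_comp_simple (t : Fin k → ℕ × ℕ) (i : Fin (k - 1)) :
    (t ∘ simple k i) ∘ simple k i = t := by ext1 x; simp

theorem not_isStd_of_le {t : Fin k → ℕ × ℕ} {a b : Fin k} (hab : a < b) (h : t b ≤ t a) :
    ¬ IsStd t := fun ht ↦ absurd hab (not_lt.2 (Tab.le_of_le ⟨t, ht⟩ h))

theorem Tab.cont_lo_ne (t : Tab k) (i : Fin (k - 1)) : cont (t.1 (lo i)) ≠ cont (t.1 (hi i)) :=
  fun h ↦ by have := t.add_three_le (lo_lt_hi i) h; simp at this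

variable [hq : Fact (Transcendental ℚ (q : ℂ))]

theorem zpow_eq_one_iff_of_transcendental {n : ℤ} : (q : ℂ) ^ n = 1 ↔ n = 0 := by
  have key : ∀ m : ℕ, (q : ℂ) ^ m = 1 → m = 0 := fun m hm ↦ by
    by_contra h
    exact hq.out ((IsAlgebraic.of_pow (Nat.pos_of_ne_zero h) (hm ▸ isAlgebraic_one)))
  constructor
  · intro h
    obtain ⟨m, rfl | rfl⟩ := n.eq_nat_or_neg
    · rw [zpow_natCast] at h
      simp [key m h]
    · rw [zpow_neg, inv_eq_one, zpow_natCast] at h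
      simp [key m h]
  · rintro rfl; simp

theorem zpow_injective_of_transcendental {m n : ℤ} (h : (q : ℂ) ^ m = (q : ℂ) ^ n) : m = n := by
  have : (q : ℂ) ^ (m - n) = 1 := by
    rw [zpow_sub₀ q.ne_zero, h, div_self (zpow_ne_zero _ q.ne_zero)]
  have := (zpow_eq_one_iff_of_transcendental q).1 this
  omega

theorem wt_eq_iff {u v : ℕ × ℕ} : wt q u = wt q v ↔ cont u = cont v :=
  ⟨fun h ↦ by have := zpow_injective_of_transcendental q h; omega, fun h ↦ by rw [wt, wt, h]⟩

/-- For neighbours in a row the coefficient vanishes and `T_i` acts by `q`. For neighbours in a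
column it is `q + q⁻¹` (`gco_wt_of_sub'`) and `T_i` acts by `-q⁻¹`, since the exchanged filling
contributes zero. -/
theorem gco_wt_of_sub {u v : ℕ × ℕ} (h : cont v - cont u = 1) : gco q (wt q u) (wt q v) = 0 := by
  rw [gco, wt_eq_of_sub q h, div_eq_zero_iff]
  left
  have := q.ne_zero
  field_simp
  ring

theorem gco_wt_of_sub' {u v : ℕ × ℕ} (h : cont v - cont u = -1) :
    gco q (wt q u) (wt q v) = q + (q : ℂ)⁻¹ := by
  have hne : wt q v ≠ wt q u := by rw [Ne, wt_eq_iff]; omega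
  rw [gco_swap q hne, gco_wt_of_sub q (by omega), sub_zero]

theorem gco_wt_eq_zero_iff {u v : ℕ × ℕ} (h : cont u ≠ cont v) :
    gco q (wt q u) (wt q v) = 0 ↔ cont v - cont u = 1 := by
  refine ⟨fun h0 ↦ ?_, gco_wt_of_sub q⟩
  have hne : wt q v - wt q u ≠ 0 := by rw [sub_ne_zero, Ne, wt_eq_iff]; omega
  rw [gco, div_eq_zero_iff, or_iff_left hne, sub_eq_zero, inv_mul_eq_iff_eq_mul₀ q.ne_zero,
    ← mul_assoc, ← pow_two, wt, wt, ← zpow_natCast, ← zpow_add₀ q.ne_zero] at h0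
  have := zpow_injective_of_transcendental q h0
  push_cast at this
  omega

theorem snOp_quad (i : Fin (k - 1)) :
    snOp q i * snOp q i = qhat q • snOp q i + (1 : Module.End ℂ (Tab k → ℂ)) := by
  classical
  refine LinearMap.ext fun f ↦ funext fun t ↦ ?_
  rw [← ext0_tab (f := (snOp q i * snOp q i) f), Module.End.mul_apply, ext0_snOp, if_pos t.2,
    ext0_snOp, if_pos t.2, ext0_snOp, comp_simple_comp_simple]
  change _ = qhat q * snOp q i f t + f t
  rw [← ext0_tab (f := snOp q i f), ext0_snOp, if_pos t.2, ext0_tab, t.2.comp_simple_iff]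
  have hqp : (q : ℂ) * (q : ℂ)⁻¹ = 1 := mul_inv_cancel₀ q.ne_zero
  have hne := t.cont_lo_ne i
  have hw : wt q (t.1 (lo i)) ≠ wt q (t.1 (hi i)) := by rwa [Ne, wt_eq_iff]
  have hswap : gAt q i (t.1 ∘ simple k i) = q + (q : ℂ)⁻¹ - gAt q i t.1 := by
    rw [gAt, gAt, ← gco_swap q hw]; simp
  rw [hswap]
  unfold qhat
  generalize (q : ℂ)⁻¹ = p at *
  by_cases h : t.1 (lo i) ≤ t.1 (hi i)
  · rw [if_neg (not_not.2 h), ext0_of_not (fun h' ↦ (t.2.comp_simple_iff i).1 h' h)]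
    have : gAt q i t.1 = 0 ∨ gAt q i t.1 = q + (q : ℂ)⁻¹ :=
      ((t.le_iff i).1 h).imp (gco_wt_of_sub q) (gco_wt_of_sub' q)
    have hp : p = (q : ℂ)⁻¹ := (inv_eq_of_mul_eq_one_right hqp).symm
    rw [← hp] at this
    rcases this with h | h <;> rw [h] <;> linear_combination f t * hqp
  · rw [if_pos h]
    linear_combination f t * hqp

theorem snOp_comm (i j : Fin (k - 1)) (hij : i.1 + 2 ≤ j.1) :
    snOp q i * snOp q j = snOp q j * (snOp q i : Module.End ℂ (Tab k → ℂ)) := by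
  classical
  refine LinearMap.ext fun f ↦ funext fun t ↦ ?_
  have n1 : lo i ≠ lo j := fun h ↦ by have := congrArg Fin.val h; simp at this; omega
  have n2 : lo i ≠ hi j := fun h ↦ by have := congrArg Fin.val h; simp at this; omega
  have n3 : hi i ≠ lo j := fun h ↦ by have := congrArg Fin.val h; simp at this; omega
  have n4 : hi i ≠ hi j := fun h ↦ by have := congrArg Fin.val h; simp at this; omega
  have hc : (t.1 ∘ simple k i) ∘ simple k j = (t.1 ∘ simple k j) ∘ simple k i := by
    have h : simple k i * simple k j = simple k j * simple k i :=
      (Equiv.Perm.disjoint_swap_swap (by simp [Fin.ext_iff]; omega)).commute.eq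
    exact congrArg (fun w : Equiv.Perm (Fin k) ↦ t.1 ∘ w) h
  rw [← ext0_tab (f := (snOp q i * snOp q j) f), ← ext0_tab (f := (snOp q j * snOp q i) f),
    Module.End.mul_apply, Module.End.mul_apply]
  simp only [ext0_snOp, if_pos t.2]
  have g1 : gAt q j (t.1 ∘ simple k i) = gAt q j t.1 := by
    simp [gAt, simple_of_ne i n1.symm n3.symm, simple_of_ne i n2.symm n4.symm]
  have g2 : gAt q i (t.1 ∘ simple k j) = gAt q i t.1 := by
    simp [gAt, simple_of_ne j n1 n2, simple_of_ne j n3 n4]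
  rw [g1, g2, hc]
  have s1 : IsStd (t.1 ∘ simple k i) → IsStd (t.1 ∘ simple k j) →
      IsStd ((t.1 ∘ simple k j) ∘ simple k i) := fun h1 h2 ↦ by
    rw [h2.comp_simple_iff]
    simpa [simple_of_ne j n1 n2, simple_of_ne j n3 n4] using (t.2.comp_simple_iff i).1 h1
  have s2 : IsStd ((t.1 ∘ simple k j) ∘ simple k i) →
      IsStd (t.1 ∘ simple k i) ∧ IsStd (t.1 ∘ simple k j) := fun h ↦ by
    constructor
    · rw [t.2.comp_simple_iff]
      intro hle
      refine not_isStd_of_le (lo_lt_hi i) ?_ h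
      simpa [simple_of_ne j n1 n2, simple_of_ne j n3 n4] using hle
    · rw [t.2.comp_simple_iff]
      intro hle
      rw [← hc] at h
      refine not_isStd_of_le (lo_lt_hi j) ?_ h
      simpa [simple_of_ne i n1.symm n3.symm, simple_of_ne i n2.symm n4.symm] using hle
  by_cases h1 : IsStd (t.1 ∘ simple k i) <;> by_cases h2 : IsStd (t.1 ∘ simple k j)
  · rw [if_pos h1, if_pos h2]; ring
  · rw [if_pos h1, if_neg h2, ext0_of_not h2, ext0_of_not fun h ↦ h2 (s2 h).2]; ring
  · rw [if_pos h2, if_neg h1, ext0_of_not h1, ext0_of_not fun h ↦ h1 (s2 h).1]; ring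
  · rw [if_neg h1, if_neg h2, ext0_of_not h1, ext0_of_not h2]; ring

theorem snOp_braid (i j : Fin (k - 1)) (hij : i.1 + 1 = j.1) :
    snOp q i * snOp q j * snOp q i = snOp q j * snOp q i * (snOp q j : Module.End ℂ (Tab k → ℂ)) := by
  classical
  refine LinearMap.ext fun f ↦ funext fun t ↦ ?_
  have ej : lo j = hi i := Fin.ext hij.symm
  have n1 : hi j ≠ lo i := fun h ↦ by have := congrArg Fin.val h; simp at this; omega
  have n2 : hi j ≠ hi i := fun h ↦ by have := congrArg Fin.val h; simp at this; omega
  have a1 : simple k i (hi j) = hi j := simple_of_ne i n1 n2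
  have a2 : simple k j (lo i) = lo i := simple_of_ne j (ej ▸ lo_ne_hi i) n1.symm
  have a3 : simple k j (hi i) = hi j := ej ▸ simple_lo j
  have a4 : simple k j (hi j) = hi i := ej ▸ simple_hi j
  have lt1 : lo i < hi i := lo_lt_hi i
  have lt2 : hi i < hi j := ej ▸ lo_lt_hi j
  have hbr : ((t.1 ∘ simple k i) ∘ simple k j) ∘ simple k i =
      ((t.1 ∘ simple k j) ∘ simple k i) ∘ simple k j := by
    have h : simple k i * simple k j * simple k i = simple k j * simple k i * simple k j := by
      rw [simple_eq, simple_eq, ej, Equiv.swap_mul_swap_mul_swap (lo_ne_hi i) n1.symm,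
        Equiv.swap_comm (lo i), Equiv.swap_comm (hi i) (hi j),
        Equiv.swap_mul_swap_mul_swap n2 n1, Equiv.swap_comm]
    exact congrArg (fun w : Equiv.Perm (Fin k) ↦ t.1 ∘ w) h
  have c12 : cont (t.1 (lo i)) ≠ cont (t.1 (hi i)) := t.cont_lo_ne i
  have c23 : cont (t.1 (hi i)) ≠ cont (t.1 (hi j)) := ej ▸ t.cont_lo_ne j
  have c13 : cont (t.1 (lo i)) ≠ cont (t.1 (hi j)) := fun h ↦ by
    have := t.add_three_le (lt1.trans lt2) h; simp at this; omega
  have sw : ∀ u v : ℕ × ℕ, cont u ≠ cont v →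
      gco q (wt q v) (wt q u) = q + (q : ℂ)⁻¹ - gco q (wt q u) (wt q v) := fun u v h ↦
    gco_swap q (by rwa [Ne, wt_eq_iff])
  have s1 := t.2.comp_simple_iff i
  have s2 := t.2.comp_simple_iff j
  rw [ej] at s2
  have l12 := t.le_iff i
  have l23 := t.le_iff j
  rw [ej] at l23
  -- The outer two of the three entries are not consecutive. If another pair is incomparable,
  -- exchanging that pair gives a standard tableau in which these two cells hold consecutive
  -- entries, so `Tab.le_iff` applies there.
  have l13 : ¬ (t.1 (lo i) ≤ t.1 (hi i) ∧ t.1 (hi i) ≤ t.1 (hi j)) →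
      (t.1 (lo i) ≤ t.1 (hi j) ↔ cont (t.1 (hi j)) - cont (t.1 (lo i)) = 1 ∨
        cont (t.1 (hi j)) - cont (t.1 (lo i)) = -1) := fun h ↦ by
    rw [not_and_or] at h
    rcases h with h | h
    · simpa [ej, a1] using Tab.le_iff ⟨_, s1.2 h⟩ j
    · simpa [a2, a3] using Tab.le_iff ⟨_, s2.2 h⟩ i
  have s12 : ¬ t.1 (lo i) ≤ t.1 (hi i) →
      (IsStd ((t.1 ∘ simple k i) ∘ simple k j) ↔ ¬ t.1 (lo i) ≤ t.1 (hi j)) := fun h ↦ by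
    simpa [ej, a1] using (s1.2 h).comp_simple_iff j
  have s21 : ¬ t.1 (hi i) ≤ t.1 (hi j) →
      (IsStd ((t.1 ∘ simple k j) ∘ simple k i) ↔ ¬ t.1 (lo i) ≤ t.1 (hi j)) := fun h ↦ by
    simpa [a2, a3] using (s2.2 h).comp_simple_iff i
  rw [← ext0_tab (f := (snOp q i * snOp q j * snOp q i) f),
    ← ext0_tab (f := (snOp q j * snOp q i * snOp q j) f)]
  simp only [Module.End.mul_apply]
  have g1 : gAt q i (t.1 ∘ simple k i) = q + (q : ℂ)⁻¹ - gAt q i t.1 := by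
    rw [gAt, gAt, ← sw _ _ c12]; simp
  have g2 : gAt q j (t.1 ∘ simple k j) = q + (q : ℂ)⁻¹ - gAt q j t.1 := by
    rw [gAt, gAt, ej, ← sw _ _ c23]; simp [a3, a4]
  have g3 : gAt q j (t.1 ∘ simple k i) = gAt q i (t.1 ∘ simple k j) := by
    simp [gAt, ej, a1, a2, a3]
  have g4 : gAt q i ((t.1 ∘ simple k i) ∘ simple k j) = gAt q j t.1 := by
    simp [gAt, ej, a1, a2, a3]
  have g5 : gAt q j ((t.1 ∘ simple k j) ∘ simple k i) = gAt q i t.1 := by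
    simp [gAt, ej, a1, a2, a4]
  have e12 : gAt q i t.1 = gco q (wt q (t.1 (lo i))) (wt q (t.1 (hi i))) := rfl
  have e23 : gAt q j t.1 = gco q (wt q (t.1 (hi i))) (wt q (t.1 (hi j))) := by rw [gAt, ej]
  have e13 : gAt q i (t.1 ∘ simple k j) = gco q (wt q (t.1 (lo i))) (wt q (t.1 (hi j))) := by
    simp [gAt, a2, a3]
  have gval : ∀ u v : ℕ × ℕ, (cont v - cont u = 1 ∧ gco q (wt q u) (wt q v) = 0) ∨
      (cont v - cont u = -1 ∧ gco q (wt q u) (wt q v) = q + (q : ℂ)⁻¹) ∨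
      ¬ (cont v - cont u = 1 ∨ cont v - cont u = -1) := fun u v ↦ by
    by_cases h1 : cont v - cont u = 1
    · exact Or.inl ⟨h1, gco_wt_of_sub q h1⟩
    by_cases h2 : cont v - cont u = -1
    · exact Or.inr (Or.inl ⟨h2, gco_wt_of_sub' q h2⟩)
    · exact Or.inr (Or.inr (not_or.2 ⟨h1, h2⟩))
  have v12 := gval (t.1 (lo i)) (t.1 (hi i))
  have v23 := gval (t.1 (hi i)) (t.1 (hi j))
  have v13 := gval (t.1 (lo i)) (t.1 (hi j))
  have hR : (q - gAt q i t.1) * (q - gAt q j t.1) = (q - gAt q i (t.1 ∘ simple k j)) *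
      (q + (q : ℂ)⁻¹ - gAt q i t.1 - gAt q j t.1) := by
    rw [e12, e23, e13]
    exact gco_relation q (by rwa [Ne, wt_eq_iff]) (by rwa [Ne, wt_eq_iff]) (by rwa [Ne, wt_eq_iff])
  rw [← e12] at v12
  rw [← e23] at v23
  rw [← e13] at v13
  rw [ext0_snOp q i (snOp q j (snOp q i f)) t.1, ext0_snOp q j (snOp q i (snOp q j f)) t.1,
    if_pos t.2, if_pos t.2]
  refine braid_values (q := q) (p := (q : ℂ)⁻¹) (x := gAt q i t.1) (y := gAt q j t.1)
    (z := gAt q i (t.1 ∘ simple k j)) (c₁₂ := t.1 (lo i) ≤ t.1 (hi i))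
    (c₁₃ := t.1 (lo i) ≤ t.1 (hi j)) (c₂₃ := t.1 (hi i) ≤ t.1 (hi j))
    (f123 := ext0 f t.1) (f213 := ext0 f (t.1 ∘ simple k i)) (f132 := ext0 f (t.1 ∘ simple k j))
    (f231 := ext0 f ((t.1 ∘ simple k i) ∘ simple k j))
    (f312 := ext0 f ((t.1 ∘ simple k j) ∘ simple k i))
    (f321 := ext0 f (((t.1 ∘ simple k i) ∘ simple k j) ∘ simple k i))
    (h123 := ext0 (snOp q i f) t.1) (h132 := ext0 (snOp q i f) (t.1 ∘ simple k j))
    (h213 := ext0 (snOp q i f) (t.1 ∘ simple k i))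
    (h231 := ext0 (snOp q i f) ((t.1 ∘ simple k i) ∘ simple k j))
    (h123' := ext0 (snOp q j f) t.1) (h132' := ext0 (snOp q j f) (t.1 ∘ simple k j))
    (h213' := ext0 (snOp q j f) (t.1 ∘ simple k i))
    (h312' := ext0 (snOp q j f) ((t.1 ∘ simple k j) ∘ simple k i))
    (mul_inv_cancel₀ q.ne_zero) hR ?_ ?_ ?_ ?_ ?_ ?_ ?_ ?_ ?_ ?_ ?_ ?_ ?_ ?_ ?_ ?_ ?_ ?_ ?_ ?_ ?_ ?_ ?_
  · intro h
    rcases v12 with ⟨-, h1⟩ | ⟨-, h1⟩ | h1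
    exacts [Or.inl h1, Or.inr h1, absurd (l12.1 h) h1]
  · intro h h'
    rcases v13 with ⟨-, h1⟩ | ⟨-, h1⟩ | h1
    exacts [Or.inl h1, Or.inr h1, absurd ((l13 h').1 h) h1]
  · intro h
    rcases v23 with ⟨-, h1⟩ | ⟨-, h1⟩ | h1
    exacts [Or.inl h1, Or.inr h1, absurd (l23.1 h) h1]
  · intro h1 h2
    rcases v12 with ⟨d1, e1⟩ | ⟨d1, e1⟩ | d1
    · rcases v23 with ⟨d2, e2⟩ | ⟨d2, e2⟩ | d2
      · rw [e1, e2]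
      · exact absurd (by omega) c13
      · exact absurd (l23.1 h2) d2
    · rcases v23 with ⟨d2, e2⟩ | ⟨d2, e2⟩ | d2
      · exact absurd (by omega) c13
      · rw [e1, e2]
      · exact absurd (l23.1 h2) d2
    · exact absurd (l12.1 h1) d1
  · intro h1 h2 h3
    rcases v12 with ⟨d1, e1⟩ | ⟨d1, e1⟩ | d1
    · rcases v13 with ⟨d2, e2⟩ | ⟨d2, e2⟩ | d2
      · exact absurd (by omega) c23
      · rw [e1, e2, zero_add]
      · exact absurd ((l13 fun h ↦ h3 h.2).1 h2) d2
    · rcases v13 with ⟨d2, e2⟩ | ⟨d2, e2⟩ | d2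
      · rw [e1, e2, add_zero]
      · exact absurd (by omega) c23
      · exact absurd ((l13 fun h ↦ h3 h.2).1 h2) d2
    · exact absurd (l12.1 h1) d1
  · intro h1 h2 h3
    rcases v23 with ⟨d1, e1⟩ | ⟨d1, e1⟩ | d1
    · rcases v13 with ⟨d2, e2⟩ | ⟨d2, e2⟩ | d2
      · exact absurd (by omega) c12
      · rw [e1, e2, zero_add]
      · exact absurd ((l13 fun h ↦ h3 h.1).1 h2) d2
    · rcases v13 with ⟨d2, e2⟩ | ⟨d2, e2⟩ | d2
      · rw [e1, e2, add_zero]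
      · exact absurd (by omega) c12
      · exact absurd ((l13 fun h ↦ h3 h.1).1 h2) d2
    · exact absurd (l23.1 h1) d1
  · exact fun h ↦ ext0_of_not fun h' ↦ s1.1 h' h
  · exact fun h ↦ ext0_of_not fun h' ↦ s2.1 h' h
  · rintro (h | h) <;> apply ext0_of_not
    · exact not_isStd_of_le (lt1.trans lt2) (by simpa [a1, a2, a4] using h)
    · exact not_isStd_of_le lt2 (by simpa [a1, a3, a4] using h)
  · rintro (h | h) <;> apply ext0_of_not
    · exact not_isStd_of_le (lt1.trans lt2) (by simpa [a1, a3, a4] using h)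
    · exact not_isStd_of_le lt1 (by simpa [a2, a3] using h)
  · rintro (h | h) <;> apply ext0_of_not
    · exact not_isStd_of_le lt2 (by simpa [a1, a2, a4] using h)
    · exact not_isStd_of_le lt1 (by simpa [a1, a2, a3] using h)
  · rw [ext0_snOp, if_pos t.2]
  · rw [ext0_snOp]
    exact ite_of_iff_not s2 _
  · rw [ext0_snOp, g1, comp_simple_comp_simple]
    exact ite_of_iff_not s1 _
  · rw [or_iff_not_imp_left]
    intro h
    rw [ext0_snOp, g4]
    exact ite_of_iff_not (s12 h) _
  · rw [ext0_snOp, if_pos t.2]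
  · rw [ext0_snOp, g3]
    exact ite_of_iff_not s1 _
  · rw [ext0_snOp, if_pos t.2]
  · rw [ext0_snOp, g2, comp_simple_comp_simple]
    exact ite_of_iff_not s2 _
  · rw [ext0_snOp, g3]
    exact ite_of_iff_not s1 _
  · rw [or_iff_not_imp_left]
    intro h
    rw [ext0_snOp, g5, hbr]
    exact ite_of_iff_not (s21 h) _
  · rw [ext0_snOp, if_pos t.2]
  · rw [ext0_snOp]
    exact ite_of_iff_not s2 _

/-- The seminormal representation of the Hecke algebra on the functions on the standard tableaux. -/
def psi (k : ℕ) : Hecke q k →ₐ[ℂ] Module.End ℂ (Tab k → ℂ) :=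
  heckeLift q k (snOp q) (snOp_quad q) (snOp_braid q) (snOp_comm q)

theorem psi_T (i : Fin (k - 1)) : psi q k (T q k i) = snOp q i := heckeLift_T ..

theorem psi_T_apply (i : Fin (k - 1)) (f : Tab k → ℂ) (t : Tab k) :
    psi q k (T q k i) f t = q * f t + gAt q i t.1 * (ext0 f (t.1 ∘ simple k i) - f t) := by
  rw [psi_T]; rfl

end Seminormal

/-! ### Jucys–Murphy elements and matrix units -/

section MatrixUnits

variable (q : ℂˣ) {k : ℕ}

variable (k) in
/-- The Jucys–Murphy elements, in multiplicative form. -/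
def jm : ℕ → Hecke q k
  | 0 => 1
  | m + 1 => Tnat q k m * jm m * Tnat q k m

variable [hq : Fact (Transcendental ℚ (q : ℂ))]

/-- Induction along `L_{m+1} = T_m L_m T_m`. The seminormal coefficient is exactly the one for which
the off-diagonal term of this product cancels. -/
theorem psi_jm (m : ℕ) (hm : m < k) (f : Tab k → ℂ) (t : Tab k) :
    psi q k (jm q k m) f t = wt q (t.1 ⟨m, hm⟩) * f t := by
  induction m generalizing f t with
  | zero =>
    have h0 : t.1 ⟨0, hm⟩ = (0, 0) := by
      obtain ⟨j, hj, e⟩ := t.2.lower ⟨0, hm⟩ (0, 0) (by simp [Prod.le_def])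
      have hj' : j = ⟨0, hm⟩ := Fin.ext (Nat.le_zero.1 hj)
      rwa [hj'] at e
    simp [jm, h0, wt, cont]
  | succ m ih =>
    have hm' : m < k - 1 := by omega
    have hlo : lo ⟨m, hm'⟩ = (⟨m, by omega⟩ : Fin k) := rfl
    have hhi : hi ⟨m, hm'⟩ = (⟨m + 1, hm⟩ : Fin k) := rfl
    rw [jm, Tnat, dif_pos hm', ← hhi]
    have ih' := ih (by omega)
    rw [← hlo] at ih'
    generalize (⟨m, hm'⟩ : Fin (k - 1)) = i at *
    generalize jm q k m = L at *
    rw [map_mul, map_mul, Module.End.mul_apply, Module.End.mul_apply, psi_T_apply, ih', psi_T_apply]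
    have hqp : (q : ℂ) * (q : ℂ)⁻¹ = 1 := mul_inv_cancel₀ q.ne_zero
    have hne := t.cont_lo_ne i
    have hw : wt q (t.1 (lo i)) ≠ wt q (t.1 (hi i)) := by rwa [Ne, wt_eq_iff]
    by_cases h : IsStd (t.1 ∘ simple k i)
    · have e1 : ∀ f : Tab k → ℂ, ext0 f (t.1 ∘ simple k i) = f ⟨_, h⟩ := fun f ↦ ext0_tab f ⟨_, h⟩
      rw [e1, e1, ih', psi_T_apply]
      simp only [comp_simple_comp_simple, ext0_tab, Function.comp_apply, simple_lo, gAt, simple_hi]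
      rw [gco_swap q hw, gco]
      have h2 : wt q (t.1 (hi i)) - wt q (t.1 (lo i)) ≠ 0 := sub_ne_zero.2 hw.symm
      have := q.ne_zero
      field_simp
      ring
    · rw [ext0_of_not h, ext0_of_not h]
      rw [t.2.comp_simple_iff, not_not, t.le_iff] at h
      rcases h with h | h
      · rw [gAt, gco_wt_of_sub q h, wt_eq_of_sub q h]
        ring
      · have h' : cont (t.1 (lo i)) - cont (t.1 (hi i)) = 1 := by omega
        rw [gAt, gco_wt_of_sub' q h, wt_eq_of_sub q h']
        linear_combination
          ((q : ℂ) * (q : ℂ)⁻¹ + 1) * wt q (t.1 (hi i)) * f t * hqp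

/-- Lagrange interpolation in the Jucys–Murphy elements: by `Tab.ext_cont` any two tableaux differ
in the content of some entry, and distinct contents have distinct weights. -/
theorem exists_psi_eq_indicator_of_notMem (t₀ : Tab k) (S : Finset (Tab k)) (hS : t₀ ∉ S) :
    ∃ (h : Hecke q k) (d : Tab k → ℂ), (∀ f t, psi q k h f t = d t * f t) ∧ d t₀ = 1 ∧
      ∀ t ∈ S, d t = 0 := by
  induction S using Finset.induction_on with
  | empty => exact ⟨1, 1, fun f t ↦ by simp, rfl, by simp⟩
  | insert s S hs ih =>
    rw [Finset.mem_insert, not_or] at hS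
    obtain ⟨h, d, h1, h2, h3⟩ := ih hS.2
    obtain ⟨i, hi⟩ : ∃ i, cont (t₀.1 i) ≠ cont (s.1 i) := by
      by_contra! hcon
      exact hS.1 (Tab.ext_cont hcon)
    have hw : wt q (t₀.1 i) - wt q (s.1 i) ≠ 0 := by rwa [sub_ne_zero, Ne, wt_eq_iff]
    refine ⟨(wt q (t₀.1 i) - wt q (s.1 i))⁻¹ • ((jm q k i.1 - wt q (s.1 i) • 1) * h),
      fun t ↦ (wt q (t₀.1 i) - wt q (s.1 i))⁻¹ * ((wt q (t.1 i) - wt q (s.1 i)) * d t), ?_, ?_, ?_⟩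
    · intro f t
      rw [map_smul, map_mul, map_sub, map_smul, map_one, LinearMap.smul_apply,
        Module.End.mul_apply, LinearMap.sub_apply, LinearMap.smul_apply, Module.End.one_apply,
        Pi.smul_apply, Pi.sub_apply, Pi.smul_apply, psi_jm q i.1 i.2, h1]
      simp only [smul_eq_mul]
      ring
    · simp only [h2, mul_one, inv_mul_cancel₀ hw]
    · intro t ht
      rcases Finset.mem_insert.1 ht with rfl | ht
      · simp
      · simp [h3 t ht]

theorem exists_psi_eq_single (t : Tab k) :
    ∃ h : Hecke q k, ∀ f u, psi q k h f u = if u = t then f t else 0 := by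
  obtain ⟨h, d, h1, h2, h3⟩ := exists_psi_eq_indicator_of_notMem q t (Finset.univ.erase t)
    (Finset.notMem_erase _ _)
  refine ⟨h, fun f u ↦ ?_⟩
  rw [h1]
  split_ifs with hu
  · rw [hu, h2, one_mul]
  · rw [h3 u (Finset.mem_erase.2 ⟨hu, Finset.mem_univ _⟩), zero_mul]

theorem gAt_ne_zero {i : Fin (k - 1)} (t : Tab k) (h : IsStd (t.1 ∘ simple k i)) :
    gAt q i t.1 ≠ 0 := by
  rw [gAt, Ne, gco_wt_eq_zero_iff q (t.cont_lo_ne i)]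
  intro h1
  exact (t.2.comp_simple_iff i).1 h ((t.le_iff i).2 (Or.inl h1))

/-- Starting from the diagonal unit at `t`, one passes to `s` through standard tableaux. Each
exchange multiplies by `e T_i`, where the diagonal projection `e` isolates the off-diagonal
coefficient of `T_i`; this coefficient is invertible by `gAt_ne_zero`. -/
theorem exists_psi_eq_unit {s t : Tab k} (hst : shape s = shape t) :
    ∃ h : Hecke q k, ∀ f u, psi q k h f u = if u = s then f t else 0 := by
  obtain ⟨w, hw⟩ := exists_perm_of_cells_eq (shape_eq_iff.1 hst.symm)
  refine tab_block_induction (b := fun _ : Fin k ↦ ()) (fun _ _ _ ↦ le_rfl)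
    (P := fun s ↦ ∃ h : Hecke q k, ∀ f u, psi q k h f u = if u = s then f t else 0) ?_ w rfl hw
    (exists_psi_eq_single q t)
  rintro s i - hs ⟨h, hh⟩
  obtain ⟨e, he⟩ := exists_psi_eq_single q ⟨s.1 ∘ simple k i, hs⟩
  have hs' : IsStd ((s.1 ∘ simple k i) ∘ simple k i) := by
    rw [comp_simple_comp_simple]; exact s.2
  refine ⟨(gAt q i (s.1 ∘ simple k i))⁻¹ • (e * T q k i * h), fun f u ↦ ?_⟩
  rw [map_smul, map_mul, map_mul, LinearMap.smul_apply, Pi.smul_apply, Module.End.mul_apply,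
    Module.End.mul_apply, he, psi_T_apply]
  simp only [comp_simple_comp_simple, ext0_tab]
  split_ifs with hu
  · have hne : (⟨s.1 ∘ simple k i, hs⟩ : Tab k) ≠ s := fun h ↦ by
      have h2 := congrFun (congrArg Subtype.val h) (lo i)
      simp only [Function.comp_apply, simple_lo] at h2
      exact lo_ne_hi i (s.2.inj h2.symm)
    rw [hh, hh, if_pos rfl, if_neg hne, smul_eq_mul, mul_zero, zero_add, sub_zero,
      inv_mul_cancel_left₀ (gAt_ne_zero q ⟨_, hs⟩ hs')]
  · simp

/-- The element of the Hecke algebra that acts as a matrix unit in the seminormal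
representation. -/
def eunit (p : TabPair k) : Hecke q k := (exists_psi_eq_unit q p.2).choose

/-- The seminormal representation by matrices. -/
def mat (k : ℕ) : Hecke q k →ₐ[ℂ] Matrix (Tab k) (Tab k) ℂ :=
  (LinearMap.toMatrixAlgEquiv' (R := ℂ) (n := Tab k)).toAlgHom.comp (psi q k)

theorem mat_apply (h : Hecke q k) (s t : Tab k) : mat q k h s t = psi q k h (Pi.single t 1) s := by
  simp [mat, LinearMap.toMatrixAlgEquiv'_apply]

theorem mat_eunit (p : TabPair k) : mat q k (eunit q p) = Matrix.single p.1.1 p.1.2 1 := by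
  ext s t
  rw [mat_apply, eunit, (exists_psi_eq_unit q p.2).choose_spec, Matrix.single_apply, Pi.single_apply]
  split_ifs <;> simp_all

theorem linearIndependent_mat_eunit :
    LinearIndependent ℂ ((mat q k).toLinearMap ∘ eunit q (k := k)) := by
  have : ((mat q k).toLinearMap ∘ eunit q (k := k)) =
      Matrix.stdBasis ℂ (Tab k) (Tab k) ∘ Subtype.val := by
    funext p
    obtain ⟨⟨s, t⟩, hp⟩ := p
    simp [mat_eunit, Matrix.stdBasis_eq_single]
  rw [this]
  exact (Matrix.stdBasis ℂ (Tab k) (Tab k)).linearIndependent.comp _ Subtype.val_injective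

/-- The basis of matrix units of the Hecke algebra. -/
def Ebasis (k : ℕ) : Module.Basis (TabPair k) ℂ (Hecke q k) :=
  basisOfLinearIndependentOfCardEqFinrank' (eunit q)
    (LinearIndependent.of_comp _ (linearIndependent_mat_eunit q))
    (by rw [finrank_hecke, card_tabPair])

@[simp] theorem Ebasis_apply (p : TabPair k) : Ebasis q k p = eunit q p := by
  simp [Ebasis]

/-- The `k!` elements `eunit` form a basis and have linearly independent images. Identities in the
Hecke algebra may from here on be checked entry by entry. -/
theorem mat_injective : Function.Injective (mat q k) := by
  have h := Submodule.range_ker_disjoint (linearIndependent_mat_eunit q (k := k))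
  have h2 : eunit q (k := k) = Ebasis q k := by funext p; simp
  rw [h2, (Ebasis q k).span_eq, top_disjoint] at h
  exact LinearMap.ker_eq_bot.1 h

theorem mat_eq_zero (h : Hecke q k) {s t : Tab k} (hst : shape s ≠ shape t) :
    mat q k h s t = 0 := by
  rw [← (Ebasis q k).sum_repr h, map_sum, Matrix.sum_apply]
  refine Finset.sum_eq_zero fun p _ ↦ ?_
  rw [map_smul, Ebasis_apply, mat_eunit, Matrix.smul_apply, Matrix.single_apply, if_neg, smul_zero]
  rintro ⟨h1, h2⟩
  exact hst (by rw [← h1, ← h2, p.2])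

theorem psi_apply_eq_sum (h : Hecke q k) (f : Tab k → ℂ) (s : Tab k) :
    psi q k h f s = ∑ t, mat q k h s t * f t := by
  have : psi q k h = Matrix.toLin' (mat q k h) := by
    simp [mat, LinearMap.toMatrixAlgEquiv', Matrix.toLin'_toMatrix']
  rw [this, Matrix.toLin'_apply]
  rfl

end MatrixUnits

section Characters

variable (q : ℂˣ) {k : ℕ}

instance : DecidableEq (Shape k) := Classical.decEq _

/-! ### Transposition of tableaux and the involution -/

/-- The transpose of a standard tableau. -/
def Tab.conj (t : Tab k) : Tab k :=
  ⟨Prod.swap ∘ t.1, Prod.swap_injective.comp t.2.inj, fun i u hu ↦ by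
    obtain ⟨j, hj, e⟩ := t.2.lower i u.swap (by simpa [Prod.le_def, and_comm] using hu)
    exact ⟨j, hj, by simp [e]⟩⟩

@[simp] theorem Tab.conj_conj (t : Tab k) : t.conj.conj = t :=
  Subtype.ext (funext fun i ↦ by simp [Tab.conj])

/-- Transposition of standard tableaux as an equivalence. -/
def conjEquiv : Tab k ≃ Tab k := ⟨Tab.conj, Tab.conj, Tab.conj_conj, Tab.conj_conj⟩

theorem shape_conj (t : Tab k) : shape t.conj = (shape t).conj := by
  refine Subtype.ext (YoungDiagram.ext (Finset.ext fun u ↦ ?_))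
  have h1 : u ∈ (shape t).conj.1.cells ↔ u.swap ∈ (shape t).1 := YoungDiagram.mem_transpose
  rw [h1, mem_shape, YoungDiagram.mem_cells, mem_shape]
  refine exists_congr fun i ↦ ?_
  change (t.1 i).swap = u ↔ _
  rw [← Prod.swap_inj, Prod.swap_swap]

@[simp] theorem Shape.conj_conj (μ : Shape k) : μ.conj.conj = μ :=
  Subtype.ext μ.1.transpose_transpose

theorem shape_conj_eq_iff {t : Tab k} {μ : Shape k} : shape t.conj = μ ↔ shape t = μ.conj := by
  rw [shape_conj]
  constructor
  · rintro rfl; simp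
  · intro h; rw [h]; simp

theorem cont_swap (u : ℕ × ℕ) : cont u.swap = -cont u := by simp [cont]

theorem exists_perm_of_shape (t : Tab k) :
    ∃ w : Equiv.Perm (Fin k),
      t.1 = (Classical.epsilon (h := ⟨t⟩) fun s : Tab k ↦ shape s = shape t).1 ∘ w :=
  exists_perm_of_cells_eq (shape_eq_iff.1 (Classical.epsilon_spec (p := fun s : Tab k ↦
    shape s = shape t) ⟨t, rfl⟩))

/-- The sign of a standard tableau, relative to a chosen standard tableau of the same shape. -/
def tabSign (t : Tab k) : ℤˣ := Equiv.Perm.sign (exists_perm_of_shape t).choose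

theorem tabSign_comp (t : Tab k) (i : Fin (k - 1)) (h : IsStd (t.1 ∘ simple k i)) :
    tabSign ⟨_, h⟩ = -tabSign t := by
  have hs : shape (⟨_, h⟩ : Tab k) = shape t := by
    rw [shape_eq_iff]
    ext u
    rw [mem_cells, mem_cells]
    exact (simple k i).exists_congr_left.trans (by simp)
  have h1 := (exists_perm_of_shape t).choose_spec
  have h2 := (exists_perm_of_shape (⟨_, h⟩ : Tab k)).choose_spec
  unfold tabSign
  simp only [hs] at h2 ⊢
  generalize (exists_perm_of_shape t).choose = v at *
  generalize Exists.choose _ = w at *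
  have h3 : w = v * simple k i := by
    ext1 x
    refine (Classical.epsilon (h := ⟨t⟩) fun s : Tab k ↦ shape s = shape t).2.inj ?_
    have := congrFun h2 x
    simp only [Function.comp_apply, h1] at this
    simpa using this.symm
  rw [h3, Equiv.Perm.sign_mul, simple_eq, Equiv.Perm.sign_swap (lo_ne_hi i), mul_neg, mul_one]

theorem prime_mul (a b : Hecke q k) : prime q k (a * b) = prime q k b * prime q k a := by
  simp [prime]

theorem prime_T (i : Fin (k - 1)) : prime q k (T q k i) = qhat q • 1 - T q k i := by
  have : prime q k (T q k i) = -(T q k i - qhat q • 1) := by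
    simp only [prime, LinearMap.comp_apply, AlgHom.toLinearMap_apply, primeOp, heckeLift_T]
    rfl
  rw [this, neg_sub]

theorem prime_algebraMap (c : ℂ) : prime q k (algebraMap ℂ _ c) = algebraMap ℂ _ c := by
  simp only [prime, LinearMap.comp_apply, AlgHom.toLinearMap_apply, AlgHom.commutes]
  rfl

variable [hq : Fact (Transcendental ℚ (q : ℂ))]

theorem mat_T (i : Fin (k - 1)) (s t : Tab k) :
    mat q k (T q k i) s t = (if s = t then q - gAt q i s.1 else 0) +
      if s.1 ∘ simple k i = t.1 then gAt q i s.1 else 0 := by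
  rw [mat_apply, psi_T_apply]
  have h : ext0 (Pi.single t 1) (s.1 ∘ simple k i) = if s.1 ∘ simple k i = t.1 then 1 else 0 := by
    by_cases h : IsStd (s.1 ∘ simple k i)
    · rw [show s.1 ∘ simple k i = (⟨_, h⟩ : Tab k).1 from rfl, ext0_tab, Pi.single_apply]
      exact if_congr Subtype.ext_iff rfl rfl
    · rw [ext0_of_not h, if_neg]
      intro h'
      exact h (h' ▸ t.2)
  rw [h, Pi.single_apply]
  split_ifs <;> ring

theorem gAt_conj (i : Fin (k - 1)) (t : Tab k) :
    gAt q i t.conj.1 = q + (q : ℂ)⁻¹ - gAt q i t.1 := by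
  have h : ∀ u, wt q (Prod.swap u) = (wt q u)⁻¹ := fun u ↦ by
    rw [wt, wt, cont_swap, mul_neg, zpow_neg]
  have hw : wt q (t.1 (lo i)) ≠ wt q (t.1 (hi i)) := by
    rw [Ne, wt_eq_iff]; exact t.cont_lo_ne i
  have e : gAt q i t.1 = gco q (wt q (t.1 (lo i))) (wt q (t.1 (hi i))) := rfl
  rw [e, ← gco_swap q hw]
  change gco q (wt q (Prod.swap _)) (wt q (Prod.swap _)) = _
  rw [h, h]
  have h1 := wt_ne_zero q (t.1 (lo i))
  have h2 := wt_ne_zero q (t.1 (hi i))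
  have h3 := sub_ne_zero.2 hw
  have h4 := sub_ne_zero.2 hw.symm
  have h5 : (wt q (t.1 (hi i)))⁻¹ - (wt q (t.1 (lo i)))⁻¹ ≠ 0 := by
    rw [sub_ne_zero, Ne, inv_inj]; exact hw.symm
  rw [gco, gco, div_eq_div_iff h5 h3]
  field_simp

/-- Both sides reverse products, so the generators suffice. Transposing a tableau turns the
coefficient `g` into `q + q⁻¹ - g`, which on the diagonal is the effect of `T_i ↦ q - q⁻¹ - T_i`;
off the diagonal the minus sign is the relative sign of two tableaux that differ by one exchange. -/
theorem mat_prime (h : Hecke q k) (s t : Tab k) :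
    mat q k (prime q k h) s t =
      ((tabSign s * tabSign t : ℤˣ) : ℂ) * mat q k h t.conj s.conj := by
  have hsq : ∀ t : Tab k, ((tabSign t : ℤ) : ℂ) * ((tabSign t : ℤ) : ℂ) = 1 := fun t ↦ by
    rcases Int.units_eq_one_or (tabSign t) with h | h <;> rw [h] <;> simp
  have hinj : ∀ s t : Tab k, t.conj = s.conj ↔ s = t := fun s t ↦
    conjEquiv.injective.eq_iff.trans eq_comm
  induction h using hecke_induction generalizing s t with
  | algebraMap c =>
    rw [prime_algebraMap, AlgHom.commutes, Matrix.algebraMap_matrix_apply,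
      Matrix.algebraMap_matrix_apply]
    by_cases h : s = t
    · subst h; simp [hsq]
    · rw [if_neg h, if_neg fun h' ↦ h ((hinj s t).1 h'), mul_zero]
  | gen i =>
    rw [prime_T, map_sub, map_smul, map_one, Matrix.sub_apply, Matrix.smul_apply, mat_T, mat_T,
      gAt_conj, Matrix.one_apply]
    have h1 : t.conj.1 ∘ simple k i = s.conj.1 ↔ s.1 ∘ simple k i = t.1 := by
      constructor
      · intro h
        have := congrArg (fun f : Fin k → ℕ × ℕ ↦ (Prod.swap ∘ f) ∘ simple k i) h
        ext1 x
        simpa [Tab.conj] using (congrFun this x).symm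
      · intro h
        ext1 x
        simp [Tab.conj, ← h]
    simp only [hinj, h1]
    by_cases h2 : s = t
    · subst h2
      have h3 : s.1 ∘ simple k i ≠ s.1 := fun h ↦ by
        have h4 := congrFun h (hi i)
        rw [Function.comp_apply, simple_hi] at h4
        exact lo_ne_hi i (s.2.inj h4)
      simp only [h3, if_true, if_false]
      push_cast
      rw [hsq, qhat]
      simp
      ring
    · by_cases h3 : s.1 ∘ simple k i = t.1
      · have h4 : IsStd (s.1 ∘ simple k i) := h3 ▸ t.2
        obtain rfl : t = ⟨_, h4⟩ := Subtype.ext h3.symm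
        have hw : wt q (s.1 (lo i)) ≠ wt q (s.1 (hi i)) := by
          rw [Ne, wt_eq_iff]; exact s.cont_lo_ne i
        have h5 : gAt q i (s.1 ∘ simple k i) = q + (q : ℂ)⁻¹ - gAt q i s.1 := by
          rw [gAt, gAt, ← gco_swap q hw]; simp
        rw [tabSign_comp]
        simp only [h2, if_true, if_false, h5]
        push_cast
        linear_combination gAt q i s.1 * hsq s
      · simp [h2, h3]
  | add a b ha hb =>
    rw [map_add, map_add, Matrix.add_apply, ha, hb, map_add, Matrix.add_apply, mul_add]
  | mul a b ha hb =>
    rw [prime_mul, map_mul, Matrix.mul_apply, map_mul, Matrix.mul_apply, Finset.mul_sum]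
    refine Fintype.sum_equiv conjEquiv _ _ fun u ↦ ?_
    rw [ha, hb]
    change _ = _ * (mat q k a t.conj u.conj * mat q k b u.conj s.conj)
    push_cast
    linear_combination ((tabSign s : ℤ) : ℂ) * ((tabSign t : ℤ) : ℂ) *
      (mat q k a t.conj u.conj * mat q k b u.conj s.conj) * hsq u

end Characters

section Antisymmetrizer

variable (q : ℂˣ) {k : ℕ}

/-! ### The antisymmetrizer as a twisted Casimir element -/

/-- Each letter contributes one factor `-1`, absorbed by `T_i' = -T_i⁻¹`. The word is reversed under
`prime` because that map reverses products. -/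
theorem sigmaHom_word (l : List (Fin (k - 1))) :
    (-1 : ℂ) ^ l.length • ((sigmaHom q k (l.map (braidGen k)).prod : (Hecke q k ⊗[ℂ] Hecke q k)ˣ) :
      Hecke q k ⊗[ℂ] Hecke q k) =
      prime q k (l.reverse.map (T q k)).prod ⊗ₜ[ℂ] (l.map (T q k)).prod := by
  induction l with
  | nil =>
    have h : prime q k 1 = 1 := by simpa using prime_algebraMap q (k := k) 1
    simp [h, Algebra.TensorProduct.one_def]
  | cons i l ih =>
    have h1 : sigmaHom q k (braidGen k i) = sigmaUnit q k i := PresentedGroup.toGroup.of ..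
    have h2 : prime q k ((i :: l).reverse.map (T q k)).prod =
        prime q k (T q k i) * prime q k (l.reverse.map (T q k)).prod := by
      rw [List.reverse_cons, List.map_append, List.prod_append, prime_mul]
      simp
    rw [h2, List.map_cons, List.map_cons, List.prod_cons, List.prod_cons, map_mul, Units.val_mul, h1,
      ← Algebra.TensorProduct.tmul_mul_tmul, ← ih, List.length_cons, pow_succ, mul_smul_comm,
      mul_smul, ← smul_mul_assoc]
    congr 2
    rw [prime_T, ← neg_sub, TensorProduct.neg_tmul, neg_one_smul]
    rfl

theorem antisymmetrizer_eq :
    antisymmetrizer q k = ∑ w : Equiv.Perm (Fin k), prime q k (Tperm q w⁻¹) ⊗ₜ[ℂ] Tperm q w := by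
  rw [antisymmetrizer, braidAntisymmetrizer, map_sum]
  refine Finset.sum_congr rfl fun w _ ↦ ?_
  have h : wordProd (reducedWord w).reverse = w⁻¹ := by
    rw [wordProd_reverse, wordProd_reducedWord]
  have h1 : Tperm q w⁻¹ = ((reducedWord w).reverse.map (T q k)).prod := by
    rw [Tperm_wordProd, h]
    rw [h, List.length_reverse, reducedWord_length, len_inv]
  rw [h1, Tperm, ← sigmaHom_word, map_smul, reducedWord_length]
  congr 1
  simp [sigmaAlgHom, braidLift]

/-- The Casimir identity with `prime` applied to its first leg: left multiplication by `a` there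
becomes right multiplication by `a'`. -/
theorem antisymmetrizer_mul_prime (a : Hecke q k) :
    antisymmetrizer q k * (prime q k a ⊗ₜ 1) = antisymmetrizer q k * (1 ⊗ₜ a) := by
  have h := congrArg (TensorProduct.map (prime q k) LinearMap.id) (casimir_mul q a)
  simp only [map_sum, TensorProduct.map_tmul, LinearMap.id_apply, prime_mul] at h
  rw [antisymmetrizer_eq, Finset.sum_mul, Finset.sum_mul]
  simp only [Algebra.TensorProduct.tmul_mul_tmul, mul_one]
  exact h

/-- The image of the Casimir element in the centre of the Hecke algebra. -/
def casimir (k : ℕ) : Hecke q k := ∑ w : Equiv.Perm (Fin k), Tperm q w⁻¹ * Tperm q w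

/-- The first leg of every summand of the right-hand factor is carried over to the second leg, where
the summands add up to `casimir`. -/
theorem antisymmetrizer_mul_self :
    antisymmetrizer q k * antisymmetrizer q k = antisymmetrizer q k * (1 ⊗ₜ casimir q k) := by
  conv_lhs => rw [antisymmetrizer_eq q (k := k), Finset.mul_sum]
  rw [← antisymmetrizer_eq, casimir, TensorProduct.tmul_sum, Finset.mul_sum]
  refine Finset.sum_congr rfl fun w _ ↦ ?_
  have h1 : prime q k (Tperm q w⁻¹) ⊗ₜ[ℂ] Tperm q w =
      prime q k (Tperm q w⁻¹) ⊗ₜ[ℂ] 1 * 1 ⊗ₜ[ℂ] Tperm q w := by simp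
  rw [h1, ← mul_assoc, antisymmetrizer_mul_prime, mul_assoc, Algebra.TensorProduct.tmul_mul_tmul,
    mul_one]

theorem antisymmetrizer_mul_comm {z : Hecke q k} (hz : ∀ h, z * h = h * z) :
    (1 ⊗ₜ z) * antisymmetrizer q k = antisymmetrizer q k * (1 ⊗ₜ z) := by
  rw [antisymmetrizer_eq, Finset.sum_mul, Finset.mul_sum]
  simp [hz]

theorem antisymmetrizer_mul_tmul (z : Hecke q k) :
    antisymmetrizer q k * (prime q k z ⊗ₜ z) = antisymmetrizer q k * (1 ⊗ₜ (z * z)) := by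
  have h1 : prime q k z ⊗ₜ[ℂ] z = prime q k z ⊗ₜ[ℂ] 1 * 1 ⊗ₜ[ℂ] z := by simp
  rw [h1, ← mul_assoc, antisymmetrizer_mul_prime, mul_assoc, Algebra.TensorProduct.tmul_mul_tmul,
    mul_one]

/-! ### Characters, orthogonality and central idempotents -/

variable [hq : Fact (Transcendental ℚ (q : ℂ))]

/-- The character of the seminormal representation of a given shape. -/
def chi (μ : Shape k) : Hecke q k →ₗ[ℂ] ℂ where
  toFun h := ∑ t : Tab k, if shape t = μ then mat q k h t t else 0
  map_add' a b := by
    rw [← Finset.sum_add_distrib]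
    refine Finset.sum_congr rfl fun t _ ↦ ?_
    split_ifs <;> simp
  map_smul' c a := by
    rw [RingHom.id_apply, smul_eq_mul, Finset.mul_sum]
    refine Finset.sum_congr rfl fun t _ ↦ ?_
    split_ifs <;> simp

theorem chi_apply (μ : Shape k) (h : Hecke q k) :
    chi q μ h = ∑ t : Tab k, if shape t = μ then mat q k h t t else 0 := rfl

theorem chi_prime (μ : Shape k) (h : Hecke q k) : chi q μ (prime q k h) = chi q μ.conj h := by
  rw [chi_apply, chi_apply]
  refine Fintype.sum_equiv conjEquiv _ _ fun t ↦ ?_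
  have h1 : shape (conjEquiv t) = μ.conj ↔ shape t = μ := by
    refine shape_conj_eq_iff.trans ?_
    rw [Shape.conj_conj]
  simp only [h1, mat_prime]
  congr 1
  rcases Int.units_eq_one_or (tabSign t) with h | h <;> rw [h] <;> simp <;> rfl

/-- The minimal central idempotent of a shape. -/
def zElt (μ : Shape k) : Hecke q k :=
  ∑ t : Tab k, if shape t = μ then eunit q ⟨(t, t), rfl⟩ else 0

theorem mat_zElt (μ : Shape k) :
    mat q k (zElt q μ) = Matrix.diagonal fun t ↦ if shape t = μ then 1 else 0 := by
  ext s t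
  rw [zElt, map_sum, Matrix.sum_apply, Finset.sum_eq_single t]
  · by_cases ht : shape t = μ
    · rw [if_pos ht, mat_eunit, Matrix.single_apply, Matrix.diagonal_apply]
      by_cases h : s = t
      · subst h; simp [ht]
      · rw [if_neg h, if_neg fun h' ↦ h h'.1.symm]
    · simp only [ht, if_false, map_zero, Matrix.zero_apply, Matrix.diagonal_apply]
      split_ifs with h1 h2
      · exact absurd (h1 ▸ h2) ht
      · rfl
      · rfl
  · intro u _ hu
    split_ifs
    · rw [mat_eunit, Matrix.single_apply, if_neg fun h ↦ hu h.2]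
    · simp
  · simp

theorem mat_mul_zElt (h : Hecke q k) (μ : Shape k) (s t : Tab k) :
    mat q k (h * zElt q μ) s t = if shape t = μ then mat q k h s t else 0 := by
  rw [map_mul, mat_zElt, Matrix.mul_diagonal]
  split_ifs <;> simp

theorem mat_zElt_mul (h : Hecke q k) (μ : Shape k) (s t : Tab k) :
    mat q k (zElt q μ * h) s t = if shape s = μ then mat q k h s t else 0 := by
  rw [map_mul, mat_zElt, Matrix.diagonal_mul]
  split_ifs <;> simp

theorem zElt_comm (μ : Shape k) (h : Hecke q k) : zElt q μ * h = h * zElt q μ := by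
  apply mat_injective q
  ext s t
  rw [mat_mul_zElt, mat_zElt_mul]
  by_cases hst : shape s = shape t
  · rw [hst]
  · rw [mat_eq_zero q h hst]; simp

theorem zElt_mul_zElt (μ ν : Shape k) :
    zElt q μ * zElt q ν = if μ = ν then zElt q μ else 0 := by
  apply mat_injective q
  ext s t
  rw [mat_mul_zElt]
  split_ifs with h1 h2 h2
  · rfl
  · rw [map_zero, Matrix.zero_apply, mat_zElt, Matrix.diagonal_apply]
    split_ifs with h3 h4
    · subst h3; exact absurd (h4.symm.trans h1) h2
    · rfl
    · rfl
  · subst h2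
    rw [mat_zElt, Matrix.diagonal_apply]
    split_ifs with h3 h4
    · subst h3; exact absurd h4 h1
    · rfl
    · rfl
  · simp

theorem sum_zElt : ∑ μ : Shape k, zElt q μ = 1 := by
  apply mat_injective q
  rw [map_sum, map_one]
  ext s t
  rw [Matrix.sum_apply]
  simp only [mat_zElt, Matrix.diagonal_apply, Matrix.one_apply]
  split_ifs <;> simp

theorem prime_zElt (μ : Shape k) : prime q k (zElt q μ) = zElt q μ.conj := by
  apply mat_injective q
  ext s t
  rw [mat_prime, mat_zElt, mat_zElt, Matrix.diagonal_apply, Matrix.diagonal_apply]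
  by_cases h : s = t
  · subst h
    rw [if_pos rfl, if_pos rfl, if_congr shape_conj_eq_iff rfl rfl]
    rcases Int.units_eq_one_or (tabSign s) with h | h <;> rw [h] <;> simp
  · have h1 : t.conj ≠ s.conj := fun h' ↦ h (conjEquiv.injective h').symm
    rw [if_neg h, if_neg h1, mul_zero]

theorem chi_mul_zElt (μ ν : Shape k) (h : Hecke q k) :
    chi q μ (h * zElt q ν) = if μ = ν then chi q μ h else 0 := by
  simp only [chi_apply, mat_mul_zElt]
  split_ifs with hμ
  · subst hμ
    refine Finset.sum_congr rfl fun t _ ↦ ?_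
    split_ifs <;> rfl
  · refine Finset.sum_eq_zero fun t _ ↦ ?_
    split_ifs with h1 h2
    · exact absurd (h1.symm.trans h2) hμ
    · rfl
    · rfl

/-! ### Schur orthogonality for the seminormal matrix entries -/

/-- Sums of products of matrix entries over the standard basis. -/
def entrySum (s t u v : Tab k) : ℂ :=
  ∑ w : Equiv.Perm (Fin k), mat q k (Tperm q w⁻¹) s t * mat q k (Tperm q w) u v

theorem entrySum_swap (s t u v : Tab k) : entrySum q s t u v = entrySum q u v s t := by
  rw [entrySum, entrySum, ← Equiv.sum_comp (Equiv.inv _)]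
  refine Finset.sum_congr rfl fun w _ ↦ ?_
  simp [mul_comm]

theorem sum_mat_mul (h : Hecke q k) (s t u v : Tab k) :
    ∑ w : Equiv.Perm (Fin k), mat q k (h * Tperm q w⁻¹) s t * mat q k (Tperm q w) u v =
      ∑ w : Equiv.Perm (Fin k), mat q k (Tperm q w⁻¹) s t * mat q k (Tperm q w * h) u v := by
  let φ : Tab k → Tab k → Hecke q k →ₗ[ℂ] ℂ := fun s t ↦
    Matrix.entryLinearMap ℂ ℂ s t ∘ₗ (mat q k).toLinearMap
  have := congrArg (LinearMap.mul' ℂ ℂ ∘ₗ TensorProduct.map (φ s t) (φ u v)) (casimir_mul q h)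
  simpa [φ, Matrix.entryLinearMap_apply] using this

theorem mat_eunit_mul (p : TabPair k) (h : Hecke q k) (s t : Tab k) :
    mat q k (eunit q p * h) s t = if s = p.1.1 then mat q k h p.1.2 t else 0 := by
  rw [map_mul, mat_eunit]
  split_ifs with hs
  · subst hs; simp
  · rw [Matrix.single_mul_apply_of_ne _ _ _ _ _ hs]

theorem mat_mul_eunit (p : TabPair k) (h : Hecke q k) (s t : Tab k) :
    mat q k (h * eunit q p) s t = if t = p.1.2 then mat q k h s p.1.1 else 0 := by
  rw [map_mul, mat_eunit]
  split_ifs with hs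
  · subst hs; simp
  · rw [Matrix.mul_single_apply_of_ne _ _ _ _ _ hs]

/-- The Casimir identity for a matrix unit. Its special cases are the Schur orthogonality relations:
vanishing for mismatched indices and independence of the tableaux within a shape. -/
theorem entrySum_relation (p : TabPair k) (s t u v : Tab k) :
    (if s = p.1.1 then entrySum q p.1.2 t u v else 0) =
      if v = p.1.2 then entrySum q s t u p.1.1 else 0 := by
  have := sum_mat_mul q (eunit q p) s t u v
  simp only [mat_eunit_mul, mat_mul_eunit] at this
  unfold entrySum
  split_ifs at this ⊢ <;> simpa using this

theorem entrySum_eq_zero {s t u v : Tab k} (h : v ≠ s) : entrySum q s t u v = 0 := by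
  simpa [h] using entrySum_relation q ⟨(s, s), rfl⟩ s t u v

theorem entrySum_eq_zero' {s t u v : Tab k} (h : t ≠ u) : entrySum q s t u v = 0 := by
  rw [entrySum_swap, entrySum_eq_zero q h]

theorem entrySum_shape {s t : Tab k} (h : shape s = shape t) (u : Tab k) :
    entrySum q s u u s = entrySum q t u u t := by
  simpa using (entrySum_relation q ⟨(s, t), h⟩ s u u t).symm

/-- The sum of the squares of a character, over the standard basis. -/
def tChi (μ : Shape k) : ℂ :=
  ∑ w : Equiv.Perm (Fin k), chi q μ (Tperm q w) * chi q μ (Tperm q w⁻¹)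

theorem sum_chi_mul_chi (μ ν : Shape k) :
    ∑ w : Equiv.Perm (Fin k), chi q μ (Tperm q w⁻¹) * chi q ν (Tperm q w) =
      if μ = ν then ∑ t : Tab k, if shape t = μ then entrySum q t t t t else 0 else 0 := by
  have : ∑ w : Equiv.Perm (Fin k), chi q μ (Tperm q w⁻¹) * chi q ν (Tperm q w) =
      ∑ s : Tab k, ∑ t : Tab k,
        if shape s = μ ∧ shape t = ν then entrySum q s s t t else 0 := by
    simp only [chi_apply, Finset.sum_mul_sum]
    rw [Finset.sum_comm]
    refine Finset.sum_congr rfl fun s _ ↦ ?_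
    rw [Finset.sum_comm]
    refine Finset.sum_congr rfl fun t _ ↦ ?_
    unfold entrySum
    by_cases h1 : shape s = μ <;> by_cases h2 : shape t = ν <;> simp [h1, h2]
  rw [this]
  have h2 : ∀ s : Tab k, (∑ t : Tab k,
      if shape s = μ ∧ shape t = ν then entrySum q s s t t else 0) =
        if shape s = μ ∧ shape s = ν then entrySum q s s s s else 0 := fun s ↦ by
    refine Finset.sum_eq_single s (fun t _ ht ↦ ?_) (by simp)
    rw [entrySum_eq_zero q ht]; simp
  simp only [h2]
  split_ifs with h
  · subst h; simp
  · refine Finset.sum_eq_zero fun s _ ↦ if_neg ?_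
    rintro ⟨h1, h2⟩
    exact h (h1.symm.trans h2)

theorem tChi_eq_sum (μ : Shape k) :
    tChi q μ = ∑ t : Tab k, if shape t = μ then entrySum q t t t t else 0 := by
  have := sum_chi_mul_chi q μ μ
  rw [if_pos rfl] at this
  rw [← this, tChi]
  exact Finset.sum_congr rfl fun w _ ↦ mul_comm _ _

theorem sum_chi_mul_chi_eq (μ ν : Shape k) :
    ∑ w : Equiv.Perm (Fin k), chi q μ (Tperm q w⁻¹) * chi q ν (Tperm q w) =
      if μ = ν then tChi q μ else 0 := by
  rw [sum_chi_mul_chi, tChi_eq_sum]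

/-- Otherwise, by orthogonality, `∑ mat(T_{w⁻¹})_{tt} T_w` would have only zero entries. But the
`T_w` are independent, and the coefficient at `w = 1` is `1`. -/
theorem entrySum_ne_zero (t : Tab k) : entrySum q t t t t ≠ 0 := by
  intro h0
  have h1 : ∑ w : Equiv.Perm (Fin k), mat q k (Tperm q w⁻¹) t t • Tperm q w = 0 := by
    apply mat_injective q
    ext u v
    rw [map_sum, Matrix.sum_apply]
    simp only [map_smul, Matrix.smul_apply, smul_eq_mul, map_zero, Matrix.zero_apply]
    change entrySum q t t u v = 0
    by_cases hv : v = t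
    · by_cases hu : t = u
      · subst hv; subst hu; exact h0
      · exact entrySum_eq_zero' q hu
    · exact entrySum_eq_zero q hv
  have h2 := Fintype.linearIndependent_iff.1 (linearIndependent_Tperm q (k := k)) _ h1 1
  simp at h2

theorem entrySum_eq_of_shape {s t : Tab k} (h : shape s = shape t) :
    entrySum q s t t s = entrySum q t t t t := entrySum_shape q h t

theorem entrySum_diag_eq {s t : Tab k} (h : shape s = shape t) :
    entrySum q s s s s = entrySum q t t t t := by
  rw [← entrySum_shape q h.symm s, entrySum_swap, entrySum_shape q h t]

/-- `t_λ` is the degree `f^λ` times the Schur element of the block; this gives its non-vanishing and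
its appearance as the eigenvalue of `casimir`. -/
theorem tChi_eq_card_mul (t : Tab k) :
    tChi q (shape t) =
      ((Finset.univ.filter fun s : Tab k ↦ shape s = shape t).card : ℂ) * entrySum q t t t t := by
  rw [tChi_eq_sum, ← Finset.sum_filter, Finset.sum_congr rfl fun s hs ↦
    entrySum_diag_eq q (Finset.mem_filter.1 hs).2, Finset.sum_const, nsmul_eq_mul]

theorem tChi_shape_ne_zero (t : Tab k) : tChi q (shape t) ≠ 0 := by
  rw [tChi_eq_card_mul]
  refine mul_ne_zero (Nat.cast_ne_zero.2 (Finset.card_ne_zero.2 ⟨t, ?_⟩)) (entrySum_ne_zero q t)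
  simp

/-- A diagonal entry is a sum over the intermediate tableaux of the same shape, and all `f^λ`
summands equal the same Schur element. -/
theorem mat_casimir (s v : Tab k) :
    mat q k (casimir q k) s v = if s = v then tChi q (shape s) else 0 := by
  have h : mat q k (casimir q k) s v = ∑ t, entrySum q s t t v := by
    unfold entrySum
    rw [Finset.sum_comm, casimir, map_sum, Matrix.sum_apply]
    refine Finset.sum_congr rfl fun w _ ↦ ?_
    rw [map_mul, Matrix.mul_apply]
  rw [h]
  split_ifs with hsv
  · subst hsv
    rw [tChi_eq_card_mul, ← nsmul_eq_mul, ← Finset.sum_const, Finset.sum_filter]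
    refine Finset.sum_congr rfl fun t _ ↦ ?_
    split_ifs with ht
    · rw [entrySum_eq_of_shape q ht.symm, entrySum_diag_eq q ht]
    · refine Finset.sum_eq_zero fun w _ ↦ ?_
      rw [mat_eq_zero q _ (Ne.symm ht), zero_mul]
  · exact Finset.sum_eq_zero fun t _ ↦ entrySum_eq_zero q (Ne.symm hsv)

theorem casimir_mul_zElt (μ : Shape k) : casimir q k * zElt q μ = tChi q μ • zElt q μ := by
  apply mat_injective q
  ext s t
  rw [mat_mul_zElt, mat_casimir, map_smul, Matrix.smul_apply, mat_zElt, Matrix.diagonal_apply]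
  by_cases hst : s = t
  · subst hst
    by_cases hs : shape s = μ
    · subst hs; simp
    · simp [hs]
  · simp [hst]

theorem one_tmul_mul (a b : Hecke q k) :
    (1 ⊗ₜ[ℂ] a : Hecke q k ⊗[ℂ] Hecke q k) * 1 ⊗ₜ[ℂ] b = 1 ⊗ₜ[ℂ] (a * b) := by
  rw [Algebra.TensorProduct.tmul_mul_tmul, mul_one]

theorem antisymmetrizer_zElt_mul (μ ν : Shape k) :
    (antisymmetrizer q k * (1 ⊗ₜ[ℂ] zElt q μ)) * (antisymmetrizer q k * (1 ⊗ₜ[ℂ] zElt q ν)) =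
      if μ = ν then tChi q μ • (antisymmetrizer q k * (1 ⊗ₜ[ℂ] zElt q μ)) else 0 := by
  rw [mul_assoc, ← mul_assoc (1 ⊗ₜ[ℂ] zElt q μ), antisymmetrizer_mul_comm q (zElt_comm q μ),
    mul_assoc, ← mul_assoc, antisymmetrizer_mul_self, one_tmul_mul, zElt_mul_zElt]
  split_ifs
  · rw [mul_assoc, one_tmul_mul, casimir_mul_zElt, TensorProduct.tmul_smul, mul_smul_comm]
  · simp

end Antisymmetrizer

/-! ### Fillings and lexicographic standardization -/

section Fillings

variable {k : ℕ}

/-- The filling of the diagram of `t` that is obtained by replacing every entry `i` by `b i`. -/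
def fil (b : Fin k → ℕ) (t : Fin k → ℕ × ℕ) (u : ℕ × ℕ) : ℕ := ∑ i, if t i = u then b i else 0

theorem fil_apply (b : Fin k → ℕ) {t : Fin k → ℕ × ℕ} (ht : Function.Injective t) (i : Fin k) :
    fil b t (t i) = b i := by
  rw [fil, Finset.sum_eq_single i]
  · simp
  · intro j _ hj
    rw [if_neg fun h ↦ hj (ht h)]
  · simp

theorem fil_eq_zero (b : Fin k → ℕ) {t : Tab k} {u : ℕ × ℕ} (hu : u ∉ (shape t).1) :
    fil b t.1 u = 0 :=
  Finset.sum_eq_zero fun i _ ↦ if_neg fun h ↦ hu (mem_shape.2 ⟨i, h⟩)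

theorem fil_comp (b : Fin k → ℕ) (t : Fin k → ℕ × ℕ) {w : Equiv.Perm (Fin k)} (hw : b ∘ w = b) :
    fil b (t ∘ w) = fil b t := by
  ext u
  rw [fil, fil, ← Equiv.sum_comp w fun i ↦ if t i = u then b i else 0]
  refine Finset.sum_congr rfl fun i _ ↦ ?_
  rw [Function.comp_apply, show b (w i) = b i from congrFun hw i]

theorem exists_perm_of_fil_eq {b : Fin k → ℕ} {s t : Tab k} (h : shape s = shape t)
    (hf : fil b s.1 = fil b t.1) : ∃ w : Equiv.Perm (Fin k), b ∘ w = b ∧ t.1 = s.1 ∘ w := by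
  obtain ⟨w, hw⟩ := exists_perm_of_cells_eq (shape_eq_iff.1 h)
  refine ⟨w, funext fun i ↦ ?_, hw⟩
  rw [Function.comp_apply, ← fil_apply b s.2.1 (w i), ← fil_apply b t.2.1 i, hf, hw,
    Function.comp_apply]

/-- A filling is strictly increasing along columns. -/
def IsSemi (F : ℕ × ℕ → ℕ) (μ : YoungDiagram) : Prop :=
  ∀ r c, (r + 1, c) ∈ μ → F (r, c) < F (r + 1, c)

instance (F : ℕ × ℕ → ℕ) (μ : YoungDiagram) : Decidable (IsSemi F μ) := Classical.dec _

instance : DecidableEq (ℕ × ℕ → ℕ) := Classical.decEq _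

theorem fil_mono {b : Fin k → ℕ} (hb : Monotone b) (t : Tab k) {u v : ℕ × ℕ} (huv : u ≤ v)
    (hv : v ∈ (shape t).1) : fil b t.1 u ≤ fil b t.1 v := by
  obtain ⟨i, rfl⟩ := mem_shape.1 hv
  obtain ⟨j, rfl⟩ := mem_shape.1 ((shape t).1.isLowerSet huv hv)
  rw [fil_apply b t.2.1, fil_apply b t.2.1]
  exact hb (t.le_of_le huv)

/-- The lexicographic key of a cell: its entry, then its column, then its row. -/
def cellKey (F : ℕ × ℕ → ℕ) (u : ℕ × ℕ) : ℕ ×ₗ ℕ ×ₗ ℕ := toLex (F u, toLex (u.2, u.1))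

theorem cellKey_injective (F : ℕ × ℕ → ℕ) : Function.Injective (cellKey F) := fun u v h ↦ by
  have h1 : toLex (u.2, u.1) = toLex (v.2, v.1) := congrArg (fun x ↦ (ofLex x).2) h
  have h2 : (u.2, u.1) = (v.2, v.1) := toLex.injective h1
  rw [Prod.mk.injEq] at h2
  exact Prod.ext h2.2 h2.1

theorem cellKey_lt {F : ℕ × ℕ → ℕ} {u v : ℕ × ℕ} : cellKey F u < cellKey F v ↔
    F u < F v ∨ F u = F v ∧ (u.2 < v.2 ∨ u.2 = v.2 ∧ u.1 < v.1) := by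
  simp [cellKey, Prod.Lex.toLex_lt_toLex]

/-- The cells are listed by increasing key. Since `F` is weakly increasing and ties are broken by
column and then by row, a smaller cell always precedes a larger one. -/
theorem exists_standardization (μ : Shape k) {F : ℕ × ℕ → ℕ}
    (hF : ∀ u v, u ≤ v → v ∈ μ.1 → F u ≤ F v) :
    ∃ t : Tab k, shape t = μ ∧ StrictMono (fun i ↦ cellKey F (t.1 i)) := by
  have hc : (μ.1.cells.image (cellKey F)).card = k := by
    rw [Finset.card_image_of_injective _ (cellKey_injective F)]
    exact μ.2
  let e := (μ.1.cells.image (cellKey F)).orderEmbOfFin hc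
  have he : ∀ i, ∃ u ∈ μ.1.cells, cellKey F u = e i := fun i ↦
    Finset.mem_image.1 (Finset.orderEmbOfFin_mem _ hc i)
  choose t ht hte using he
  have hmem : ∀ u ∈ μ.1.cells, ∃ i, t i = u := fun u hu ↦ by
    have : cellKey F u ∈ Set.range e := by
      rw [Finset.range_orderEmbOfFin]
      exact Finset.mem_coe.2 (Finset.mem_image_of_mem _ hu)
    obtain ⟨i, hi⟩ := this
    exact ⟨i, cellKey_injective F ((hte i).trans hi)⟩
  have hmono : StrictMono fun i ↦ cellKey F (t i) := by
    simp only [hte]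
    exact e.strictMono
  have hstd : IsStd t := by
    refine ⟨fun i j h ↦ hmono.injective (congrArg (cellKey F) h), fun i u hu ↦ ?_⟩
    obtain ⟨j, rfl⟩ := hmem u (μ.1.isLowerSet hu (ht i))
    refine ⟨j, ?_, rfl⟩
    by_contra hij
    have h1 := cellKey_lt.1 (hmono (not_le.1 hij))
    have h2 := hF _ _ hu (ht i)
    have h3 := hu.1
    have h4 := hu.2
    omega
  refine ⟨⟨t, hstd⟩, Subtype.ext (YoungDiagram.ext (Finset.ext fun u ↦ ?_)), hmono⟩
  refine mem_cells.trans ⟨?_, hmem u⟩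
  rintro ⟨i, rfl⟩
  exact ht i

theorem monotone_of_cellKey {F : ℕ × ℕ → ℕ} {t : Fin k → ℕ × ℕ}
    (h : StrictMono fun i ↦ cellKey F (t i)) : Monotone fun i ↦ F (t i) := by
  intro i j hij
  rcases hij.eq_or_lt with rfl | hlt
  · rfl
  · have := cellKey_lt.1 (h hlt)
    dsimp only
    omega

theorem eq_of_card_eq {f g : Fin k → ℕ} (hf : Monotone f) (hg : Monotone g)
    (h : ∀ m, (Finset.univ.filter fun i ↦ f i = m).card =
      (Finset.univ.filter fun i ↦ g i = m).card) : f = g := by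
  have e : ∀ m, Nonempty ({i // f i = m} ≃ {i // g i = m}) := fun m ↦
    Fintype.card_eq.1 (by rw [Fintype.card_subtype, Fintype.card_subtype, h])
  let w : Equiv.Perm (Fin k) := Equiv.ofFiberEquiv fun m ↦ (e m).some
  have hw : g ∘ w = f := funext fun i ↦ Equiv.ofFiberEquiv_map _ i
  have := Tuple.unique_monotone (f := g) (σ := w) (τ := 1) (by rwa [hw]) (by simpa using hg)
  rw [← hw, this]
  rfl

theorem exists_tab_of_filling {b : Fin k → ℕ} (hb : Monotone b) (μ : Shape k) {F : ℕ × ℕ → ℕ}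
    (hF : ∀ u v, u ≤ v → v ∈ μ.1 → F u ≤ F v)
    (hc : ∀ m, (μ.1.cells.filter fun u ↦ F u = m).card =
      (Finset.univ.filter fun i ↦ b i = m).card) :
    ∃ t : Tab k, shape t = μ ∧ (∀ i, F (t.1 i) = b i) ∧
      StrictMono (fun i ↦ cellKey F (t.1 i)) := by
  obtain ⟨t, rfl, hmono⟩ := exists_standardization μ hF
  refine ⟨t, rfl, fun i ↦ congrFun (?_ : (fun i ↦ F (t.1 i)) = b) i, hmono⟩
  refine eq_of_card_eq (monotone_of_cellKey hmono) hb fun m ↦ ?_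
  rw [← hc, ← Finset.card_image_of_injective _ t.2.1]
  congr 1
  ext u
  simp only [Finset.mem_image, Finset.mem_filter, Finset.mem_univ, true_and]
  constructor
  · rintro ⟨i, hi, rfl⟩
    exact ⟨mem_cells.2 ⟨i, rfl⟩, hi⟩
  · rintro ⟨hu, hm⟩
    obtain ⟨i, rfl⟩ := mem_cells.1 hu
    exact ⟨i, hm, rfl⟩

theorem card_fil_eq (b : Fin k → ℕ) (t : Tab k) (m : ℕ) :
    ((shape t).1.cells.filter fun u ↦ fil b t.1 u = m).card =
      (Finset.univ.filter fun i ↦ b i = m).card := by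
  rw [← Finset.card_image_of_injective (Finset.univ.filter fun i ↦ b i = m) t.2.1]
  congr 1
  ext u
  simp only [Finset.mem_image, Finset.mem_filter, Finset.mem_univ, true_and]
  constructor
  · rintro ⟨hu, hm⟩
    obtain ⟨i, rfl⟩ := mem_cells.1 hu
    exact ⟨i, by rwa [fil_apply b t.2.1] at hm, rfl⟩
  · rintro ⟨i, hi, rfl⟩
    exact ⟨mem_cells.2 ⟨i, rfl⟩, by rwa [fil_apply b t.2.1]⟩

/-- If two vertical neighbours have the same entry, no cell has its key between theirs, because keys
compare entry, column, row in that order. In the standardization they therefore hold consecutive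
numbers. -/
theorem exists_tab_of_not_isSemi {b : Fin k → ℕ} (hb : Monotone b) (t : Tab k)
    (h : ¬ IsSemi (fil b t.1) (shape t).1) :
    ∃ (s : Tab k) (i : Fin (k - 1)), shape s = shape t ∧ fil b s.1 = fil b t.1 ∧
      b (lo i) = b (hi i) ∧ s.1 (hi i) = ((s.1 (lo i)).1 + 1, (s.1 (lo i)).2) := by
  simp only [IsSemi, not_forall, not_lt] at h
  obtain ⟨r, c, hv, hle⟩ := h
  have huv : ((r, c) : ℕ × ℕ) ≤ (r + 1, c) := ⟨Nat.le_succ r, le_rfl⟩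
  have heq := le_antisymm hle (fil_mono hb t huv hv)
  obtain ⟨s, hs, hsb, hmono⟩ := exists_tab_of_filling hb (shape t)
    (fun u v huv hv ↦ fil_mono hb t huv hv) (card_fil_eq b t)
  have hsf : fil b s.1 = fil b t.1 := by
    ext u
    by_cases hu : u ∈ (shape s).1
    · obtain ⟨i, rfl⟩ := mem_shape.1 hu
      rw [fil_apply b s.2.1, hsb]
    · rw [fil_eq_zero b hu, fil_eq_zero b (hs ▸ hu)]
  rw [← hs] at hv
  obtain ⟨i, hi'⟩ := mem_shape.1 hv
  obtain ⟨j, hj'⟩ := mem_shape.1 ((shape s).1.isLowerSet huv hv)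
  have hji : j < i := by
    by_contra hn
    rcases (not_lt.1 hn).eq_or_lt with h | h
    · rw [h, hj'] at hi'
      simp at hi'
    · have := cellKey_lt.1 (hmono h)
      rw [hi', hj'] at this
      simp at this
      omega
  have hsucc : i.1 = j.1 + 1 := by
    by_contra hn
    have hjm : j < ⟨j.1 + 1, by omega⟩ := Fin.lt_def.2 (Nat.lt_succ_self _)
    have hmi : (⟨j.1 + 1, by omega⟩ : Fin k) < i := Fin.lt_def.2 (by
      have := Fin.lt_def.1 hji
      dsimp only
      omega)
    have h1 := cellKey_lt.1 (hmono hjm)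
    have h2 := cellKey_lt.1 (hmono hmi)
    rw [hj'] at h1
    rw [hi'] at h2
    dsimp only at h1 h2
    omega
  have hlo : lo (⟨j.1, by omega⟩ : Fin (k - 1)) = j := rfl
  have hhi : hi (⟨j.1, by omega⟩ : Fin (k - 1)) = i := Fin.ext hsucc.symm
  refine ⟨s, ⟨j.1, by omega⟩, hs, hsf, ?_, ?_⟩
  · rw [hlo, hhi, ← hsb, ← hsb, hi', hj', heq]
  · rw [hlo, hhi, hi', hj']

theorem exists_tab (μ : Shape k) : ∃ t : Tab k, shape t = μ :=
  (exists_standardization μ (F := fun _ ↦ 0) fun _ _ _ _ ↦ le_rfl).imp fun _ h ↦ h.1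

theorem le_fil_of_isSemi {F : ℕ × ℕ → ℕ} {μ : YoungDiagram} (h : IsSemi F μ) {r c : ℕ}
    (hu : (r, c) ∈ μ) : r ≤ F (r, c) := by
  induction r with
  | zero => exact Nat.zero_le _
  | succ r ih =>
    exact (ih (μ.isLowerSet (show ((r, c) : ℕ × ℕ) ≤ (r + 1, c) from ⟨Nat.le_succ r, le_rfl⟩)
      hu)).trans_lt (h r c hu)

end Fillings

/-! ### Invariants of Young subgroups -/

section Invariants

variable (q : ℂˣ) {k : ℕ}

/-- The stabilizer of a block map. -/
def blockPerms (b : Fin k → ℕ) : Finset (Equiv.Perm (Fin k)) :=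
  Finset.univ.filter fun w ↦ b ∘ w = b

theorem mem_blockPerms {b : Fin k → ℕ} {w : Equiv.Perm (Fin k)} :
    w ∈ blockPerms b ↔ b ∘ w = b := by simp [blockPerms]

/-- The symmetrizer of a Young subgroup for a character `T_i ↦ c`. -/
def symOf (c : ℂ) (b : Fin k → ℕ) : Hecke q k := ∑ w ∈ blockPerms b, c ^ len w • Tperm q w

/-- The Poincaré polynomial of a Young subgroup. -/
def poincare (c : ℂ) (b : Fin k → ℕ) : ℂ := ∑ w ∈ blockPerms b, c ^ len w * c ^ len w

theorem comp_simple_of_eq {b : Fin k → ℕ} {i : Fin (k - 1)} (h : b (lo i) = b (hi i)) :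
    b ∘ simple k i = b := by
  ext x
  rw [Function.comp_apply]
  by_cases h1 : x = lo i
  · rw [h1, simple_lo, h]
  · by_cases h2 : x = hi i
    · rw [h2, simple_hi, h]
    · rw [simple_of_ne i h1 h2]

theorem simple_mul_mem_blockPerms {b : Fin k → ℕ} {i : Fin (k - 1)} (h : b (lo i) = b (hi i))
    {w : Equiv.Perm (Fin k)} : simple k i * w ∈ blockPerms b ↔ w ∈ blockPerms b := by
  rw [mem_blockPerms, mem_blockPerms, Equiv.Perm.coe_mul, ← Function.comp_assoc,
    comp_simple_of_eq h]

variable {c : ℂ}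

/-- The summands of `w` and `s_i w` are paired. The hypothesis on `c` is that it solves the
quadratic relation, so the symmetrizer (`c = q`) and the antisymmetrizer (`c = -q⁻¹`) are treated
together. -/
theorem T_mul_symOf (hc : c * c = qhat q * c + 1) {b : Fin k → ℕ} {i : Fin (k - 1)}
    (h : b (lo i) = b (hi i)) : T q k i * symOf q c b = c • symOf q c b := by
  have h1 : ∑ w ∈ blockPerms b, c ^ len w • Tperm q (simple k i * w) =
      ∑ w ∈ blockPerms b, c ^ len (simple k i * w) • Tperm q w := by
    refine Finset.sum_bij' (fun w _ ↦ simple k i * w) (fun w _ ↦ simple k i * w) ?_ ?_ ?_ ?_ ?_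
    · exact fun w hw ↦ (simple_mul_mem_blockPerms h).2 hw
    · exact fun w hw ↦ (simple_mul_mem_blockPerms h).2 hw
    all_goals simp [← mul_assoc, simple_mul_self]
  rw [symOf, Finset.mul_sum, Finset.smul_sum]
  simp only [mul_smul_comm, T_mul_Tperm, smul_add, Finset.sum_add_distrib]
  rw [h1, ← Finset.sum_add_distrib]
  refine Finset.sum_congr rfl fun w _ ↦ ?_
  rcases lo_lt_hi_or w⁻¹ i with hw | hw
  · rw [if_neg hw.not_gt, len_simple_mul_of_lt hw, smul_zero, add_zero, smul_smul, pow_succ']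
  · rw [if_pos hw, ← len_simple_mul_of_gt hw, smul_smul, smul_smul, ← add_smul]
    congr 1
    rw [pow_succ]
    linear_combination -(c ^ len (simple k i * w)) * hc

theorem q_mul_self : (q : ℂ) * q = qhat q * q + 1 := by
  have hq : (q : ℂ) ≠ 0 := q.ne_zero
  rw [qhat]
  field_simp
  ring

theorem neg_inv_mul_self : (-(q : ℂ)⁻¹) * -(q : ℂ)⁻¹ = qhat q * -(q : ℂ)⁻¹ + 1 := by
  have hq : (q : ℂ) ≠ 0 := q.ne_zero
  rw [qhat]
  field_simp
  ring

theorem inv_mem_blockPerms {b : Fin k → ℕ} {w : Equiv.Perm (Fin k)} (hw : w ∈ blockPerms b) :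
    w⁻¹ ∈ blockPerms b := by
  rw [mem_blockPerms] at *
  ext x
  conv_lhs => rw [← hw]
  simp

theorem flipOp_symOf (b : Fin k → ℕ) :
    flipOp q k (symOf q c b) = MulOpposite.op (symOf q c b) := by
  rw [symOf, map_sum, Finset.op_sum]
  refine Finset.sum_bij' (fun w _ ↦ w⁻¹) (fun w _ ↦ w⁻¹) (fun w ↦ inv_mem_blockPerms)
    (fun w ↦ inv_mem_blockPerms) (by simp) (by simp) fun w _ ↦ ?_
  rw [map_smul, flipOp_Tperm, len_inv, MulOpposite.op_smul]

theorem Tperm_mul_simple {w : Equiv.Perm (Fin k)} {i : Fin (k - 1)} (h : w (lo i) < w (hi i)) :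
    Tperm q (w * simple k i) = Tperm q w * T q k i := by
  rw [Tperm_mul_T, if_neg h.not_gt, add_zero]

theorem Tperm_smul_of_forall {M : Type*} [AddCommGroup M] [Module ℂ M]
    (ψ : Hecke q k →ₐ[ℂ] Module.End ℂ M) {b : Fin k → ℕ} (hb : Monotone b) {f : M}
    (hf : ∀ i, b (lo i) = b (hi i) → ψ (T q k i) f = c • f)
    {w : Equiv.Perm (Fin k)} (hw : w ∈ blockPerms b) :
    ψ (Tperm q w) f = c ^ len w • f := by
  refine block_induction hb (P := fun w ↦ ψ (Tperm q w) f = c ^ len w • f) ?_ ?_ w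
    (mem_blockPerms.1 hw)
  · rw [Tperm_one, map_one, len_one, pow_zero, one_smul, Module.End.one_apply]
  · intro w i _ hi hlt ih
    rw [Tperm_mul_simple q hlt, map_mul, Module.End.mul_apply, hf i hi, map_smul, ih, smul_smul,
      len_mul_simple_of_lt hlt, pow_succ']

theorem symOf_smul_of_forall {M : Type*} [AddCommGroup M] [Module ℂ M]
    (ψ : Hecke q k →ₐ[ℂ] Module.End ℂ M) {b : Fin k → ℕ} (hb : Monotone b) {f : M}
    (hf : ∀ i, b (lo i) = b (hi i) → ψ (T q k i) f = c • f) :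
    ψ (symOf q c b) f = poincare c b • f := by
  rw [symOf, map_sum, LinearMap.sum_apply, poincare, Finset.sum_smul]
  refine Finset.sum_congr rfl fun w hw ↦ ?_
  rw [map_smul, LinearMap.smul_apply, Tperm_smul_of_forall q ψ hb hf hw, smul_smul]

/-- It is a rational polynomial evaluated at `c`, and the polynomial is nonzero because its value at
`1` is the order of the subgroup. -/
theorem poincare_ne_zero (hc : Transcendental ℚ c) (b : Fin k → ℕ) : poincare c b ≠ 0 := by
  let p : Polynomial ℚ := ∑ w ∈ blockPerms b, Polynomial.X ^ len w * Polynomial.X ^ len w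
  have hp : p ≠ 0 := fun h ↦ by
    have h1 := congrArg (Polynomial.eval 1) h
    simp only [p, Polynomial.eval_finsetSum, Polynomial.eval_mul, Polynomial.eval_pow,
      Polynomial.eval_X, one_pow, mul_one, Finset.sum_const, nsmul_eq_mul,
      Polynomial.eval_zero] at h1
    have h2 : (blockPerms b).card = 0 := by exact_mod_cast h1
    rw [Finset.card_eq_zero] at h2
    have h3 : (1 : Equiv.Perm (Fin k)) ∈ blockPerms b := mem_blockPerms.2 rfl
    rw [h2] at h3
    simp at h3
  intro h
  refine hc ⟨p, hp, ?_⟩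
  simpa [p, poincare] using h

variable [hq : Fact (Transcendental ℚ (q : ℂ))]

theorem add_inv_ne_zero : (q : ℂ) + (q : ℂ)⁻¹ ≠ 0 := by
  intro h
  have h0 : (q : ℂ) ≠ 0 := q.ne_zero
  have h1 : (q : ℂ) ^ 2 = -1 := by
    field_simp at h
    linear_combination h
  have h2 : (q : ℂ) ^ (4 : ℤ) = 1 := by
    norm_cast
    calc (q : ℂ) ^ 4 = ((q : ℂ) ^ 2) ^ 2 := by ring
      _ = 1 := by rw [h1]; norm_num
  exact absurd ((zpow_eq_one_iff_of_transcendental q).1 h2) (by norm_num)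

/-! ### Invariants of a Young subgroup and Kostka numbers -/

/-- Invariance under a Young subgroup, in the seminormal representation. -/
def IsInv (b : Fin k → ℕ) (f : Tab k → ℂ) : Prop :=
  ∀ i, b (lo i) = b (hi i) → psi q k (T q k i) f = (q : ℂ) • f

/-- The equation `T_i f = q f` at `t` says that `g * (f (t ∘ s_i) - f t) = 0` with `g ≠ 0`, so `f`
is constant along exchanges within a block. -/
theorem IsInv.apply_eq {b : Fin k → ℕ} (hb : Monotone b) {f : Tab k → ℂ} (hf : IsInv q b f)
    {s t : Tab k} (h : shape s = shape t) (hst : fil b s.1 = fil b t.1) : f t = f s := by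
  obtain ⟨w, hw, hts⟩ := exists_perm_of_fil_eq h hst
  refine tab_block_induction hb (P := fun t ↦ f t = f s) ?_ w hw hts rfl
  intro t i hi h ht
  have h1 := congrFun (hf i hi) t
  rw [psi_T_apply, Pi.smul_apply, smul_eq_mul, add_eq_left] at h1
  have h2 := (mul_eq_zero.1 h1).resolve_left (gAt_ne_zero q t h)
  rw [ext0, dif_pos h] at h2
  rw [sub_eq_zero.1 h2, ht]

/-- A filling that is not column-strict is also the filling of a tableau with vertical neighbours
`i`, `i + 1` in one block. There `T_i` acts by `-q⁻¹`, which differs from `q`. -/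
theorem IsInv.apply_eq_zero {b : Fin k → ℕ} (hb : Monotone b) {f : Tab k → ℂ}
    (hf : IsInv q b f) {t : Tab k} (h : ¬ IsSemi (fil b t.1) (shape t).1) : f t = 0 := by
  obtain ⟨s, i, hs, hsf, hi, hsi⟩ := exists_tab_of_not_isSemi hb t h
  rw [hf.apply_eq q hb hs hsf]
  have hle : s.1 (lo i) ≤ s.1 (HeckeA.hi i) := by
    rw [hsi]; exact ⟨Nat.le_succ _, le_rfl⟩
  have h1 := congrFun (hf i hi) s
  rw [psi_T_apply, Pi.smul_apply, smul_eq_mul, add_eq_left,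
    ext0_of_not fun h' ↦ (s.2.comp_simple_iff i).1 h' hle, gAt, gco_wt_of_sub', zero_sub] at h1
  · exact neg_eq_zero.1 ((mul_eq_zero.1 h1).resolve_left (add_inv_ne_zero q))
  · rw [hsi]; simp only [cont]; push_cast; ring

/-- The indicator function of the tableaux with a given shape and filling. -/
def filInd (b : Fin k → ℕ) (t₀ : Tab k) (t : Tab k) : ℂ :=
  if shape t = shape t₀ ∧ fil b t.1 = fil b t₀.1 then 1 else 0

theorem shape_comp_simple (t : Tab k) (i : Fin (k - 1)) (h : IsStd (t.1 ∘ simple k i)) :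
    shape ⟨_, h⟩ = shape t := by
  rw [shape_eq_iff]
  ext u
  rw [mem_cells, mem_cells]
  exact ⟨fun ⟨j, hj⟩ ↦ ⟨simple k i j, hj⟩, fun ⟨j, hj⟩ ↦ ⟨simple k i j, by
    change t.1 (simple k i (simple k i j)) = u
    rw [simple_simple, hj]⟩⟩

/-- The converse of the two preceding facts: together they show that the indicators of the
semistandard fillings are a basis of the invariants. -/
theorem isInv_filInd (b : Fin k → ℕ) {t₀ : Tab k} (h : IsSemi (fil b t₀.1) (shape t₀).1) :
    IsInv q b (filInd b t₀) := by
  intro i hi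
  ext t
  rw [psi_T_apply, Pi.smul_apply, smul_eq_mul, add_eq_left]
  by_cases hs : IsStd (t.1 ∘ simple k i)
  · rw [ext0, dif_pos hs, filInd, filInd, shape_comp_simple t i hs,
      fil_comp b t.1 (comp_simple_of_eq hi), sub_self, mul_zero]
  · rw [ext0_of_not hs]
    rw [t.2.comp_simple_iff, not_not] at hs
    rcases t.adjacent hs with h1 | h1
    · rw [filInd, if_neg, sub_zero, mul_zero]
      rintro ⟨h2, h3⟩
      have h4 := h (t.1 (lo i)).1 (t.1 (lo i)).2 (by rw [← h2, ← h1]; exact mem_shape.2 ⟨_, rfl⟩)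
      rw [← h1, ← h3, Prod.mk.eta, fil_apply b t.2.1, fil_apply b t.2.1, hi] at h4
      exact lt_irrefl _ h4
    · rw [gAt, gco_wt_of_sub, zero_mul]
      rw [h1]; simp only [cont]; push_cast; ring

theorem isInv_mat_symOf (b : Fin k → ℕ) (t : Tab k) :
    IsInv q b fun s ↦ mat q k (symOf q q b) s t := by
  have h1 : (fun s ↦ mat q k (symOf q q b) s t) = psi q k (symOf q q b) (Pi.single t 1) :=
    funext fun s ↦ mat_apply q _ s t
  intro i hi
  rw [h1, ← Module.End.mul_apply, ← map_mul, T_mul_symOf q (q_mul_self q) hi, map_smul, LinearMap.smul_apply]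

/-- The semistandard fillings of a shape with the content of a block map. -/
def fils (b : Fin k → ℕ) (μ : Shape k) : Finset (ℕ × ℕ → ℕ) :=
  (Finset.univ.filter fun t : Tab k ↦ shape t = μ ∧ IsSemi (fil b t.1) μ.1).image
    fun t ↦ fil b t.1

/-- The value of a character on a symmetrizer is a Kostka number. -/
theorem chi_symOf {b : Fin k → ℕ} (hb : Monotone b) (μ : Shape k) :
    chi q μ (symOf q q b) = poincare (q : ℂ) b * (fils b μ).card := by
  have h1 : chi q μ (symOf q q b) = ∑ t ∈ Finset.univ.filter fun t : Tab k ↦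
      shape t = μ ∧ IsSemi (fil b t.1) μ.1, mat q k (symOf q q b) t t := by
    rw [chi_apply, Finset.sum_filter]
    refine Finset.sum_congr rfl fun t _ ↦ ?_
    by_cases h1 : shape t = μ
    · subst h1
      by_cases h2 : IsSemi (fil b t.1) (shape t).1
      · rw [if_pos rfl, if_pos ⟨rfl, h2⟩]
      · rw [if_pos rfl, if_neg fun h ↦ h2 h.2]
        exact (isInv_mat_symOf q b t).apply_eq_zero q hb h2
    · rw [if_neg h1, if_neg fun h ↦ h1 h.1]
  rw [h1, ← Finset.sum_fiberwise_of_maps_to (t := fils b μ) (g := fun t : Tab k ↦ fil b t.1)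
    fun t ht ↦ Finset.mem_image_of_mem _ ht, mul_comm, ← nsmul_eq_mul, ← Finset.sum_const]
  refine Finset.sum_congr rfl fun F hF ↦ ?_
  obtain ⟨t₀, ht₀, rfl⟩ := Finset.mem_image.1 hF
  obtain ⟨rfl, hs⟩ := (Finset.mem_filter.1 ht₀).2
  -- The symmetrizer multiplies the indicator of a filling by the Poincaré polynomial, so the
  -- entries of row `t₀` over the tableaux with this filling sum to it. Each column of the matrix is
  -- invariant, so these entries equal the diagonal ones.
  have h2 := congrFun (symOf_smul_of_forall q (psi q k) hb (isInv_filInd q b hs)) t₀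
  rw [psi_apply_eq_sum, Pi.smul_apply, smul_eq_mul, filInd, if_pos ⟨rfl, rfl⟩, mul_one] at h2
  rw [← h2, Finset.filter_filter, Finset.sum_filter]
  refine Finset.sum_congr rfl fun t _ ↦ ?_
  rw [filInd]
  by_cases ht : shape t = shape t₀ ∧ fil b t.1 = fil b t₀.1
  · rw [if_pos ⟨⟨ht.1, by rw [ht.2]; exact hs⟩, ht.2⟩, if_pos ht, mul_one]
    exact (isInv_mat_symOf q b t).apply_eq q hb ht.1.symm ht.2.symm
  · rw [if_neg fun h ↦ ht ⟨h.1.1, h.2⟩, if_neg ht, mul_zero]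

end Invariants

/-! ### Blocks and dominance -/

section Blocks

variable {k : ℕ}

theorem card_filter_row_lt (μ : YoungDiagram) (r : ℕ) :
    (μ.cells.filter fun u ↦ u.1 < r).card = ∑ j ∈ Finset.range r, μ.rowLen j := by
  rw [Finset.card_eq_sum_card_fiberwise (f := Prod.fst) (t := Finset.range r)
    fun u hu ↦ Finset.mem_coe.2 (Finset.mem_range.2 (Finset.mem_filter.1 hu).2)]
  refine Finset.sum_congr rfl fun j hj ↦ ?_
  rw [YoungDiagram.rowLen_eq_card, YoungDiagram.row, Finset.filter_filter]
  congr 1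
  ext u
  simp only [Finset.mem_filter]
  have := Finset.mem_range.1 hj
  constructor
  · exact fun h ↦ ⟨h.1, h.2.2⟩
  · exact fun h ↦ ⟨h.1, h.2 ▸ this, h.2⟩

theorem sum_rowLen_le (μ : Shape k) (r : ℕ) : ∑ j ∈ Finset.range r, μ.1.rowLen j ≤ k := by
  rw [← card_filter_row_lt]
  exact (Finset.card_le_card (Finset.filter_subset _ _)).trans μ.2.le

theorem sum_rowLen_of_le (μ : Shape k) {r : ℕ} (h : k ≤ r) :
    ∑ j ∈ Finset.range r, μ.1.rowLen j = k := by
  rw [← card_filter_row_lt, Finset.filter_true_of_mem]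
  · exact μ.2
  intro u hu
  have := (Finset.mem_product.1 (shape_cells_subset μ hu)).1
  exact (Finset.mem_range.1 this).trans_le h

/-- The partial sums of the row lengths increase, so the set counted by `block` is an initial
segment. -/
theorem block_lt_iff (μ : Shape k) (i : Fin k) (r : ℕ) :
    block μ i < r ↔ i.1 < ∑ j ∈ Finset.range r, μ.1.rowLen j := by
  have hmono : Monotone fun r ↦ ∑ j ∈ Finset.range r, μ.1.rowLen j := fun a b hab ↦
    Finset.sum_le_sum_of_subset (Finset.range_mono hab)
  constructor
  · intro h
    by_contra hn
    have hr : r ≤ k := by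
      by_contra hk
      rw [sum_rowLen_of_le μ (not_le.1 hk).le] at hn
      exact hn i.2
    have h1 : Finset.range r ⊆ (Finset.range k).filter fun r ↦
        ∑ j ∈ Finset.range (r + 1), μ.1.rowLen j ≤ i.1 := fun s hs ↦ by
      have hs' := Finset.mem_range.1 hs
      exact Finset.mem_filter.2 ⟨Finset.mem_range.2 (hs'.trans_le hr),
        (hmono (Nat.succ_le_of_lt hs')).trans (not_lt.1 hn)⟩
    have h2 := Finset.card_le_card h1
    rw [Finset.card_range] at h2
    exact absurd h (not_lt.2 h2)
  · intro h
    cases r with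
    | zero => simp at h
    | succ r =>
      have h1 : ((Finset.range k).filter fun r ↦
          ∑ j ∈ Finset.range (r + 1), μ.1.rowLen j ≤ i.1) ⊆ Finset.range r := fun s hs ↦ by
        rw [Finset.mem_range]
        by_contra hn
        have h3 := (Finset.mem_filter.1 hs).2
        have h4 := hmono (Nat.succ_le_succ (not_lt.1 hn))
        dsimp only at h4
        simp only [Nat.succ_eq_add_one] at h4
        omega
      have h2 := Finset.card_le_card h1
      rw [Finset.card_range] at h2
      exact Nat.lt_succ_of_le h2

theorem block_monotone (μ : Shape k) : Monotone (block μ) := fun i j hij ↦ by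
  rw [← Nat.lt_succ_iff, block_lt_iff]
  exact (Fin.le_def.1 hij).trans_lt ((block_lt_iff μ j _).1 (Nat.lt_succ_self _))

theorem card_block_lt (μ : Shape k) (r : ℕ) :
    (Finset.univ.filter fun i ↦ block μ i < r).card = ∑ j ∈ Finset.range r, μ.1.rowLen j := by
  have h : (Finset.univ.filter fun i ↦ block μ i < r).map Fin.valEmbedding =
      Finset.range (∑ j ∈ Finset.range r, μ.1.rowLen j) := by
    ext m
    simp only [Finset.mem_map, Finset.mem_filter, Finset.mem_univ, true_and, block_lt_iff,
      Fin.valEmbedding_apply, Finset.mem_range]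
    exact ⟨fun ⟨i, hi, h⟩ ↦ h ▸ hi, fun h ↦ ⟨⟨m, h.trans_le (sum_rowLen_le μ r)⟩, h, rfl⟩⟩
  rw [← Finset.card_map Fin.valEmbedding, h, Finset.card_range]

theorem card_block_eq (μ : Shape k) (m : ℕ) :
    (Finset.univ.filter fun i ↦ block μ i = m).card = μ.1.rowLen m := by
  have h : (Finset.univ.filter fun i ↦ block μ i < m + 1) =
      (Finset.univ.filter fun i ↦ block μ i < m) ∪
        Finset.univ.filter fun i ↦ block μ i = m := by
    ext i
    simp only [Finset.mem_union, Finset.mem_filter, Finset.mem_univ, true_and]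
    omega
  have h2 := card_block_lt μ (m + 1)
  rw [h, Finset.card_union_of_disjoint, card_block_lt, Finset.sum_range_succ] at h2
  · omega
  · refine Finset.disjoint_filter.2 fun i _ h1 h2 ↦ ?_
    omega

theorem fst_le_of_isSemi {b : Fin k → ℕ} {t : Tab k} (h : IsSemi (fil b t.1) (shape t).1)
    (i : Fin k) : (t.1 i).1 ≤ b i := by
  rw [← fil_apply b t.2.1 i]
  exact le_fil_of_isSemi h (mem_shape.2 ⟨i, rfl⟩)

/-- A nonzero Kostka number forces dominance: in a column-strict filling the entries below `r` all
lie in the first `r` rows. -/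
theorem sum_rowLen_le_of_isSemi {μ : Shape k} {t : Tab k}
    (h : IsSemi (fil (block μ) t.1) (shape t).1) (r : ℕ) :
    ∑ j ∈ Finset.range r, μ.1.rowLen j ≤ ∑ j ∈ Finset.range r, (shape t).1.rowLen j := by
  rw [← card_block_lt, ← card_filter_row_lt]
  refine Finset.card_le_card_of_injOn t.1 (fun i hi ↦ ?_) t.2.1.injOn
  rw [Finset.mem_coe, Finset.mem_filter] at *
  exact ⟨mem_cells.2 ⟨i, rfl⟩, (fst_le_of_isSemi h i).trans_lt hi.2⟩

theorem lt_of_isSemi {F : ℕ × ℕ → ℕ} {μ : YoungDiagram} (h : IsSemi F μ) {r s c : ℕ}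
    (hrs : r < s) (hs : (s, c) ∈ μ) : F (r, c) < F (s, c) := by
  induction s, hrs using Nat.le_induction with
  | base => exact h _ _ hs
  | succ s hrs ih =>
    exact (ih (μ.isLowerSet (show ((s, c) : ℕ × ℕ) ≤ (s + 1, c) from ⟨Nat.le_succ s, le_rfl⟩)
      hs)).trans (h _ _ hs)

/-- The reverse dominance, for fillings of the transposed shape. Among the cells of `t` in the first
`r` rows, those of block `m` of `μ'` lie in distinct rows, so there are at most `min r μ'_m` of
them; this is the number of cells of `μ` in column `m` and the first `r` rows. -/
theorem sum_rowLen_le_of_isSemi_conj {μ : Shape k} {t : Tab k}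
    (h : IsSemi (fil (block μ.conj) t.conj.1) (shape t.conj).1) (r : ℕ) :
    ∑ j ∈ Finset.range r, (shape t).1.rowLen j ≤ ∑ j ∈ Finset.range r, μ.1.rowLen j := by
  have htc : ∀ i, t.conj.1 i = (t.1 i).swap := fun _ ↦ rfl
  have hR : (Finset.univ.filter fun i ↦ (t.1 i).1 < r).card =
      ∑ j ∈ Finset.range r, (shape t).1.rowLen j := by
    rw [← card_filter_row_lt, ← Finset.card_image_of_injective _ t.2.1]
    congr 1
    ext u
    simp only [Finset.mem_image, Finset.mem_filter, Finset.mem_univ, true_and]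
    constructor
    · rintro ⟨i, hi, rfl⟩
      exact ⟨mem_cells.2 ⟨i, rfl⟩, hi⟩
    · rintro ⟨hu, hm⟩
      obtain ⟨i, rfl⟩ := mem_cells.1 hu
      exact ⟨i, hm, rfl⟩
  rw [← hR, ← card_filter_row_lt]
  have hm : ∀ i, block μ.conj i ∈ Finset.range k := fun i ↦ by
    rw [Finset.mem_range, block_lt_iff, sum_rowLen_of_le _ le_rfl]
    exact i.2
  rw [Finset.card_eq_sum_card_fiberwise (f := block μ.conj) (t := Finset.range k)
      fun i _ ↦ Finset.mem_coe.2 (hm i),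
    Finset.card_eq_sum_card_fiberwise (f := Prod.snd) (t := Finset.range k)
      fun u hu ↦ (Finset.mem_product.1 (shape_cells_subset μ (Finset.mem_filter.1 hu).1)).2]
  refine Finset.sum_le_sum fun m _ ↦ ?_
  have hright : ((μ.1.cells.filter fun u ↦ u.1 < r).filter fun u ↦ u.2 = m).card =
      min r (μ.1.colLen m) := by
    rw [← Finset.card_range (min r (μ.1.colLen m)),
      ← Finset.card_image_of_injective (Finset.range _) (f := fun j ↦ (j, m))
        fun a b hab ↦ congrArg Prod.fst hab]
    congr 1
    ext ⟨j, c⟩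
    simp only [Finset.mem_filter, Finset.mem_image, Finset.mem_range, lt_min_iff, Prod.mk.injEq,
      YoungDiagram.mem_cells]
    constructor
    · rintro ⟨⟨h1, h2⟩, rfl⟩
      exact ⟨j, ⟨h2, YoungDiagram.mem_iff_lt_colLen.1 h1⟩, rfl, rfl⟩
    · rintro ⟨j', ⟨h1, h2⟩, rfl, rfl⟩
      exact ⟨⟨YoungDiagram.mem_iff_lt_colLen.2 h2, h1⟩, rfl⟩
  rw [hright]
  refine le_min ?_ ?_
  · refine (Finset.card_le_card_of_injOn (t := Finset.range r) (fun i ↦ (t.1 i).1)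
      (fun i hi ↦ ?_) ?_).trans_eq (Finset.card_range r)
    · exact Finset.mem_coe.2 (Finset.mem_range.2
        (Finset.mem_filter.1 (Finset.mem_filter.1 (Finset.mem_coe.1 hi)).1).2)
    · intro i hi j hj hij
      have h1 := (Finset.mem_filter.1 (Finset.mem_coe.1 hi)).2
      have h2 := (Finset.mem_filter.1 (Finset.mem_coe.1 hj)).2
      dsimp only at hij
      by_contra hne
      wlog hlt : (t.1 i).2 < (t.1 j).2 generalizing i j
      · refine this hj hi hij.symm h2 h1 (Ne.symm hne) ?_
        refine lt_of_le_of_ne (not_lt.1 hlt) fun h3 ↦ hne (t.2.1 (Prod.ext hij h3.symm))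
      have h3 := lt_of_isSemi h (c := (t.1 i).1) hlt (mem_shape.2 ⟨j, by rw [htc, hij]; rfl⟩)
      have e1 : (((t.1 i).2, (t.1 i).1) : ℕ × ℕ) = t.conj.1 i := rfl
      have e2 : (((t.1 j).2, (t.1 i).1) : ℕ × ℕ) = t.conj.1 j := by rw [htc, hij]; rfl
      rw [e1, e2, fil_apply _ t.conj.2.1, fil_apply _ t.conj.2.1, h1, h2] at h3
      exact lt_irrefl _ h3
  · have := card_block_eq μ.conj m
    rw [show μ.conj.1.rowLen m = μ.1.colLen m from YoungDiagram.rowLen_transpose ..] at this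
    rw [← this]
    exact Finset.card_le_card (Finset.filter_subset_filter _ (Finset.subset_univ _))

theorem shape_eq_of_sum_rowLen {μ ν : Shape k} (h : ∀ r, ∑ j ∈ Finset.range r, μ.1.rowLen j =
    ∑ j ∈ Finset.range r, ν.1.rowLen j) : μ = ν := by
  have hr : ∀ r, μ.1.rowLen r = ν.1.rowLen r := fun r ↦ by
    have := h (r + 1)
    rw [Finset.sum_range_succ, Finset.sum_range_succ, h r] at this
    omega
  refine Subtype.ext (YoungDiagram.ext (Finset.ext fun ⟨i, j⟩ ↦ ?_))
  rw [YoungDiagram.mem_cells, YoungDiagram.mem_cells, YoungDiagram.mem_iff_lt_rowLen,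
    YoungDiagram.mem_iff_lt_rowLen, hr]

theorem shape_eq_of_isSemi {μ : Shape k} {s t : Tab k} (hst : shape s = shape t)
    (h : IsSemi (fil (block μ) s.1) (shape s).1)
    (h' : IsSemi (fil (block μ.conj) t.conj.1) (shape t.conj).1) : shape s = μ :=
  shape_eq_of_sum_rowLen fun r ↦ le_antisymm (hst ▸ sum_rowLen_le_of_isSemi_conj h' r)
    (sum_rowLen_le_of_isSemi h r)

theorem exists_superstandard (μ : Shape k) :
    ∃ t : Tab k, shape t = μ ∧ ∀ i, (t.1 i).1 = block μ i := by
  obtain ⟨t, h1, h2, -⟩ := exists_tab_of_filling (block_monotone μ) μ (F := Prod.fst)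
    (fun u v huv _ ↦ huv.1) fun m ↦ by
      rw [card_block_eq, YoungDiagram.rowLen_eq_card, YoungDiagram.row]
  exact ⟨t, h1, h2⟩

theorem isSemi_of_fst_eq {b : Fin k → ℕ} {t : Tab k} (h : ∀ i, (t.1 i).1 = b i) :
    IsSemi (fil b t.1) (shape t).1 := by
  have h1 : ∀ u ∈ (shape t).1, fil b t.1 u = u.1 := fun u hu ↦ by
    obtain ⟨i, rfl⟩ := mem_shape.1 hu
    rw [fil_apply b t.2.1, h]
  intro r c hu
  rw [h1 _ hu, h1 _ ((shape t).1.isLowerSet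
    (show ((r, c) : ℕ × ℕ) ≤ (r + 1, c) from ⟨Nat.le_succ r, le_rfl⟩) hu)]
  exact Nat.lt_succ_self r

/-- This is `K_{μμ} = 1`: the row index of a cell is at most its entry, and both have the same sum
over the diagram. -/
theorem fst_eq_of_isSemi {s t : Tab k} {μ : Shape k} (hs : shape s = μ) (ht : shape t = μ)
    (h : ∀ i, (s.1 i).1 = block μ i) (h' : IsSemi (fil (block μ) t.1) (shape t).1) (i : Fin k) :
    (t.1 i).1 = block μ i := by
  have hsum : ∀ t : Tab k, ∑ i, (t.1 i).1 = ∑ u ∈ (shape t).1.cells, u.1 := fun t ↦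
    (Finset.sum_image (g := t.1) (f := Prod.fst) fun _ _ _ _ h ↦ t.2.1 h).symm
  have h1 : ∑ i, (t.1 i).1 = ∑ i, block μ i := by
    rw [hsum, ht, ← hs, ← hsum]
    exact Finset.sum_congr rfl fun i _ ↦ hs ▸ h i
  exact (Finset.sum_eq_sum_iff_of_le fun i _ ↦ fst_le_of_isSemi h' i).1 h1 i (Finset.mem_univ i)

theorem fil_eq_of_isSemi {s t : Tab k} {μ : Shape k} (hs : shape s = μ) (ht : shape t = μ)
    (h : ∀ i, (s.1 i).1 = block μ i) (h' : IsSemi (fil (block μ) t.1) (shape t).1) :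
    fil (block μ) s.1 = fil (block μ) t.1 := by
  ext u
  by_cases hu : u ∈ μ.1
  · obtain ⟨i, hi⟩ := mem_shape.1 (show u ∈ (shape s).1 by rwa [hs])
    obtain ⟨j, hj⟩ := mem_shape.1 (show u ∈ (shape t).1 by rwa [ht])
    conv_lhs => rw [← hi]
    conv_rhs => rw [← hj]
    rw [fil_apply _ s.2.1, fil_apply _ t.2.1, ← h, ← fst_eq_of_isSemi hs ht h h', hi, hj]
  · rw [fil_eq_zero _ (by rwa [hs]), fil_eq_zero _ (by rwa [ht])]

end Blocks

/-! ### Symmetrizers and antisymmetrizers -/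

section Specht

variable (q : ℂˣ) {k : ℕ}

theorem youngSubgroup_eq (μ : Shape k) : youngSubgroup μ = blockPerms (block μ) := by
  ext w
  rw [mem_blockPerms, youngSubgroup, Finset.mem_filter]
  exact ⟨fun h ↦ funext h.2, fun h ↦ ⟨Finset.mem_univ _, congrFun h⟩⟩

theorem symElt_eq (μ : Shape k) : symElt q μ = symOf q q (block μ) := by
  rw [symElt, youngSubgroup_eq, symOf]

theorem altElt_eq (μ : Shape k) : altElt q μ = symOf q (-(q : ℂ)⁻¹) (block μ) := by
  rw [altElt, youngSubgroup_eq, symOf]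

/-- The composition of the antiautomorphism `prime` with the one that fixes the generators. -/
def primeFlip (k : ℕ) : Hecke q k →ₐ[ℂ] Hecke q k :=
  AlgHom.ofLinearMap
    (prime q k ∘ₗ (MulOpposite.opLinearEquiv ℂ).symm.toLinearMap ∘ₗ (flipOp q k).toLinearMap)
    (by
      change prime q k (flipOp q k 1).unop = 1
      rw [map_one]
      simpa using prime_algebraMap q (k := k) 1)
    (fun a b ↦ by
      change prime q k (flipOp q k (a * b)).unop =
        prime q k (flipOp q k a).unop * prime q k (flipOp q k b).unop
      rw [map_mul, MulOpposite.unop_mul, prime_mul])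

theorem primeFlip_T (i : Fin (k - 1)) : primeFlip q k (T q k i) = qhat q • 1 - T q k i := by
  change prime q k (flipOp q k (T q k i)).unop = _
  have h2 : flipOp q k (T q k i) = MulOpposite.op (T q k i) := by
    simpa using flipOp_word q [i]
  rw [h2, MulOpposite.unop_op, prime_T]

theorem primeFlip_symOf (c : ℂ) (b : Fin k → ℕ) :
    primeFlip q k (symOf q c b) = prime q k (symOf q c b) := by
  change prime q k (flipOp q k (symOf q c b)).unop = _
  rw [flipOp_symOf, MulOpposite.unop_op]

/-- The automorphism `primeFlip` sends `T_i` to `q - q⁻¹ - T_i`, so a `d`-eigenvector of `T_i`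
becomes a `c`-eigenvector for the twisted action. With `mat_prime` this carries statements about
symmetrizers over to antisymmetrizers of the transposed shapes. -/
theorem prime_symOf_mul_symOf {c d : ℂ} (hd : d * d = qhat q * d + 1) (hcd : c + d = qhat q)
    {b : Fin k → ℕ} (hb : Monotone b) :
    prime q k (symOf q c b) * symOf q d b = poincare c b • symOf q d b := by
  have := symOf_smul_of_forall q (c := c) ((Algebra.lmul ℂ (Hecke q k)).comp (primeFlip q k)) hb
    (f := symOf q d b) (fun i hi ↦ by
      rw [AlgHom.comp_apply, primeFlip_T]
      change (qhat q • 1 - T q k i) * symOf q d b = c • symOf q d b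
      rw [sub_mul, smul_mul_assoc, one_mul,
        T_mul_symOf q hd hi, ← sub_smul, ← hcd, add_sub_cancel_right])
  rwa [AlgHom.comp_apply, primeFlip_symOf] at this

theorem sub_inv_eq_qhat : (q : ℂ) + -(q : ℂ)⁻¹ = qhat q := by rw [qhat, sub_eq_add_neg]

variable [hq : Fact (Transcendental ℚ (q : ℂ))]

theorem transcendental_neg_inv : Transcendental ℚ (-(q : ℂ)⁻¹) := fun h ↦
  hq.out (by simpa using h.neg.inv)

theorem isSemi_of_mat_symElt_ne_zero {μ : Shape k} {s t : Tab k}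
    (h : mat q k (symElt q μ) s t ≠ 0) : IsSemi (fil (block μ) s.1) (shape s).1 := by
  rw [symElt_eq] at h
  by_contra hn
  exact h ((isInv_mat_symOf q (block μ) t).apply_eq_zero q (block_monotone μ) hn)

theorem exists_isSemi_of_mat_altElt_ne_zero {μ : Shape k} {s t : Tab k}
    (h : mat q k (altElt q μ) s t ≠ 0) :
    ∃ u, shape u = shape s ∧ IsSemi (fil (block μ) u.conj.1) (shape u.conj).1 := by
  have h1 := prime_symOf_mul_symOf q (c := q) (neg_inv_mul_self q) (sub_inv_eq_qhat q)
    (block_monotone μ)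
  rw [← altElt_eq, ← symElt_eq] at h1
  have h2 : mat q k (prime q k (symElt q μ) * altElt q μ) s t ≠ 0 := by
    rw [h1, map_smul, Matrix.smul_apply, smul_eq_mul]
    exact mul_ne_zero (poincare_ne_zero hq.out _) h
  rw [map_mul, Matrix.mul_apply] at h2
  obtain ⟨u, -, hu⟩ := Finset.exists_ne_zero_of_sum_ne_zero h2
  have h3 := left_ne_zero_of_mul hu
  refine ⟨u, ?_, ?_⟩
  · by_contra hn
    exact h3 (mat_eq_zero q _ (Ne.symm hn))
  · rw [mat_prime] at h3
    exact isSemi_of_mat_symElt_ne_zero q (right_ne_zero_of_mul h3)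

theorem mat_symElt_eq {μ : Shape k} {s t u : Tab k} (hs : shape s = μ) (ht : shape t = μ)
    (h : ∀ i, (s.1 i).1 = block μ i) (h' : IsSemi (fil (block μ) t.1) (shape t).1) :
    mat q k (symElt q μ) t u = mat q k (symElt q μ) s u := by
  rw [symElt_eq]
  exact (isInv_mat_symOf q (block μ) u).apply_eq q (block_monotone μ) (hs.trans ht.symm)
    (fil_eq_of_isSemi hs ht h h')

theorem exists_mat_symElt_ne_zero {μ : Shape k} {s : Tab k}
    (h : ∀ i, (s.1 i).1 = block μ i) : ∃ t, mat q k (symElt q μ) s t ≠ 0 := by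
  by_contra! hn
  have h2 := congrFun (symOf_smul_of_forall q (psi q k) (block_monotone μ)
    (isInv_filInd q (block μ) (isSemi_of_fst_eq h))) s
  rw [psi_apply_eq_sum, Pi.smul_apply, smul_eq_mul, filInd, if_pos ⟨rfl, rfl⟩, mul_one] at h2
  refine poincare_ne_zero hq.out _ (h2.symm.trans (Finset.sum_eq_zero fun t _ ↦ ?_))
  rw [← symElt_eq, hn, zero_mul]

theorem exists_mat_altElt_ne_zero (μ : Shape k) :
    ∃ s t, shape s = μ ∧ mat q k (altElt q μ.conj) s t ≠ 0 := by
  obtain ⟨s, hs, h⟩ := exists_superstandard μ.conj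
  obtain ⟨t, ht⟩ := exists_mat_symElt_ne_zero q h
  have h1 := prime_symOf_mul_symOf q (c := -(q : ℂ)⁻¹) (q_mul_self q)
    ((add_comm _ _).trans (sub_inv_eq_qhat q)) (block_monotone μ.conj)
  rw [← altElt_eq, ← symElt_eq] at h1
  have h2 : mat q k (prime q k (altElt q μ.conj) * symElt q μ.conj) s t ≠ 0 := by
    rw [h1, map_smul, Matrix.smul_apply, smul_eq_mul]
    exact mul_ne_zero (poincare_ne_zero (transcendental_neg_inv q) _) ht
  rw [map_mul, Matrix.mul_apply] at h2
  obtain ⟨u, -, hu⟩ := Finset.exists_ne_zero_of_sum_ne_zero h2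
  have h3 := left_ne_zero_of_mul hu
  have h4 : shape u = μ.conj := by
    by_contra hn
    exact h3 (mat_eq_zero q _ fun h5 ↦ hn (h5.symm.trans hs))
  rw [mat_prime] at h3
  refine ⟨u.conj, s.conj, ?_, right_ne_zero_of_mul h3⟩
  rw [shape_conj_eq_iff, h4]

/-! ### Specht modules -/

/-- A nonzero product yields a column-strict filling of the shape of `v` with content `μ` and one of
the transposed shape with content `μ'`; the two dominance inequalities then force the shape to be
`μ`. -/
theorem mat_altElt_mul_mul_symElt {μ : Shape k} (h : Hecke q k) {v : Tab k} (hv : shape v ≠ μ)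
    (s t : Tab k) :
    mat q k (altElt q μ.conj * h) s v * mat q k (symElt q μ) v t = 0 := by
  by_contra hn
  have h1 := isSemi_of_mat_symElt_ne_zero q (right_ne_zero_of_mul hn)
  have h2 := left_ne_zero_of_mul hn
  have h3 : shape s = shape v := by
    by_contra h4
    exact h2 (mat_eq_zero q _ h4)
  rw [map_mul, Matrix.mul_apply] at h2
  obtain ⟨u, -, hu⟩ := Finset.exists_ne_zero_of_sum_ne_zero h2
  obtain ⟨w, hw, hws⟩ := exists_isSemi_of_mat_altElt_ne_zero q (left_ne_zero_of_mul hu)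
  exact hv (shape_eq_of_isSemi (hw.trans h3).symm h1 hws)

/-- Only rows of `x_μ` at semistandard tableaux of shape `μ` matter, and since `K_{μμ} = 1` they all
coincide. So each generator, and hence each element of the module, is a column vector times one
fixed row. -/
theorem exists_mat_eq_of_mem_specht {μ : Shape k} {s₀ : Tab k} (hs : shape s₀ = μ)
    (h₀ : ∀ i, (s₀.1 i).1 = block μ i) {z : Hecke q k} (hz : z ∈ specht q μ) :
    ∃ g : Tab k → ℂ, (∀ s, shape s ≠ μ → g s = 0) ∧
      ∀ s t, mat q k z s t = g s * mat q k (symElt q μ) s₀ t := by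
  rw [specht] at hz
  induction hz using Submodule.span_induction with
  | mem z hz =>
    obtain ⟨h, rfl⟩ := hz
    let S := Finset.univ.filter fun v : Tab k ↦ shape v = μ ∧ IsSemi (fil (block μ) v.1) (shape v).1
    refine ⟨fun s ↦ ∑ v ∈ S, mat q k (altElt q μ.conj * h) s v, fun s hs' ↦ ?_, fun s t ↦ ?_⟩
    · refine Finset.sum_eq_zero fun v hv ↦ mat_eq_zero q _ ?_
      rw [(Finset.mem_filter.1 hv).2.1]
      exact hs'
    · rw [map_mul, Matrix.mul_apply, Finset.sum_mul]
      refine (Finset.sum_subset (Finset.subset_univ S) fun v _ hv ↦ ?_).symm.trans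
        (Finset.sum_congr rfl fun v hv ↦ ?_)
      · by_cases hvs : shape v = μ
        · have h1 : ¬ IsSemi (fil (block μ) v.1) (shape v).1 := fun h2 ↦
            hv (Finset.mem_filter.2 ⟨Finset.mem_univ _, hvs, h2⟩)
          by_contra hn
          exact h1 (isSemi_of_mat_symElt_ne_zero q (right_ne_zero_of_mul hn))
        · exact mat_altElt_mul_mul_symElt q h hvs s t
      · have h1 := (Finset.mem_filter.1 hv).2
        rw [mat_symElt_eq q hs h1.1 h₀ h1.2]
  | zero => exact ⟨0, by simp, by simp⟩
  | add x y _ _ hx hy =>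
    obtain ⟨g, hg, hgx⟩ := hx
    obtain ⟨g', hg', hgy⟩ := hy
    exact ⟨g + g', fun s hs ↦ by simp [hg s hs, hg' s hs], fun s t ↦ by
      rw [map_add, Matrix.add_apply, hgx, hgy, Pi.add_apply, add_mul]⟩
  | smul h x _ hx =>
    obtain ⟨g, hg, hgx⟩ := hx
    refine ⟨fun s ↦ ∑ u, mat q k h s u * g u, fun s hs' ↦ Finset.sum_eq_zero fun u _ ↦ ?_,
      fun s t ↦ ?_⟩
    · by_cases hu : shape u = μ
      · rw [mat_eq_zero q h (hu ▸ hs'), zero_mul]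
      · rw [hg u hu, mul_zero]
    · rw [smul_eq_mul, map_mul, Matrix.mul_apply, Finset.sum_mul]
      exact Finset.sum_congr rfl fun u _ ↦ by rw [hgx, mul_assoc]

/-- The vectors of a Specht module that correspond to the seminormal basis. -/
def spechtVec {μ : Shape k} (s₀ : {t : Tab k // shape t = μ}) (s : {t : Tab k // shape t = μ}) :
    Hecke q k := eunit q ⟨(s.1, s₀.1), s.2.trans s₀.2.symm⟩ * symElt q μ

theorem mat_spechtVec {μ : Shape k} (s₀ s : {t : Tab k // shape t = μ}) (u t : Tab k) :
    mat q k (spechtVec q s₀ s) u t = if u = s.1 then mat q k (symElt q μ) s₀.1 t else 0 :=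
  mat_eunit_mul q _ _ u t

/-- A nonzero entry `(a, b)` of `y_{μ'}` is picked out by matrix units on both sides: the unit `(b,
s₀)` is taken as the middle factor of a generator, and the unit `(s, a)`, divided by the entry,
multiplies from the left. -/
theorem spechtVec_mem {μ : Shape k} (s₀ s : {t : Tab k // shape t = μ}) :
    spechtVec q s₀ s ∈ specht q μ := by
  obtain ⟨a, b, ha, hab⟩ := exists_mat_altElt_ne_zero q μ
  have hb : shape a = shape b := by
    by_contra hn
    exact hab (mat_eq_zero q _ hn)
  have h1 : spechtVec q s₀ s = (algebraMap ℂ (Hecke q k) (mat q k (altElt q μ.conj) a b)⁻¹ *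
      eunit q ⟨(s.1, a), s.2.trans ha.symm⟩) • (altElt q μ.conj *
        eunit q ⟨(b, s₀.1), (hb.symm.trans ha).trans s₀.2.symm⟩ * symElt q μ) := by
    apply mat_injective q
    ext u t
    rw [smul_eq_mul, ← Algebra.smul_def, smul_mul_assoc, map_smul, Matrix.smul_apply,
      mat_eunit_mul, mat_spechtVec]
    dsimp only
    split_ifs with hu
    · rw [map_mul, Matrix.mul_apply, Finset.sum_eq_single s₀.1]
      · rw [mat_mul_eunit, if_pos rfl, smul_eq_mul, inv_mul_cancel_left₀ hab]
      · intro v _ hv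
        rw [mat_mul_eunit, if_neg hv, zero_mul]
      · simp
    · rw [smul_zero]
  rw [h1]
  exact Submodule.smul_mem _ _ (Submodule.subset_span ⟨_, rfl⟩)

theorem smul_spechtVec {μ : Shape k} (s₀ s : {t : Tab k // shape t = μ}) (h : Hecke q k) :
    h * spechtVec q s₀ s =
      ∑ u : {t : Tab k // shape t = μ}, mat q k h u.1 s.1 • spechtVec q s₀ u := by
  apply mat_injective q
  ext u t
  rw [map_sum, Matrix.sum_apply, map_mul, Matrix.mul_apply, Finset.sum_eq_single s.1]
  · rw [mat_spechtVec, if_pos rfl]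
    by_cases hu : shape u = μ
    · rw [Finset.sum_eq_single ⟨u, hu⟩]
      · rw [map_smul, Matrix.smul_apply, mat_spechtVec, if_pos rfl, smul_eq_mul]
      · intro v _ hv
        rw [map_smul, Matrix.smul_apply, mat_spechtVec, if_neg, smul_zero]
        exact fun h' ↦ hv (Subtype.ext h'.symm)
      · simp
    · rw [mat_eq_zero q h (by rwa [s.2]), zero_mul]
      refine (Finset.sum_eq_zero fun v _ ↦ ?_).symm
      rw [map_smul, Matrix.smul_apply, mat_spechtVec, if_neg, smul_zero]
      rintro rfl
      exact hu v.2
  · intro v _ hv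
    rw [mat_spechtVec, if_neg hv, mul_zero]
  · simp

/-- The seminormal basis of a Specht module. -/
theorem exists_basis_specht (μ : Shape k) :
    ∃ (s₀ : {t : Tab k // shape t = μ})
      (B : Module.Basis {t : Tab k // shape t = μ} ℂ (specht q μ)),
      ∀ s, (B s : Hecke q k) = spechtVec q s₀ s := by
  obtain ⟨s₀, hs, h₀⟩ := exists_superstandard μ
  obtain ⟨t₁, ht₁⟩ := exists_mat_symElt_ne_zero q h₀
  let v : {t : Tab k // shape t = μ} → specht q μ := fun s ↦
    ⟨spechtVec q ⟨s₀, hs⟩ s, spechtVec_mem q _ s⟩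
  have hli : LinearIndependent ℂ v := by
    rw [Fintype.linearIndependent_iff]
    intro g hg s
    have h1 : ∑ u, g u • spechtVec q ⟨s₀, hs⟩ u = 0 := by
      have := congrArg (Subtype.val) hg
      simpa [v] using this
    have h2 := congrArg (fun z ↦ mat q k z s.1 t₁) h1
    simp only [map_sum, Matrix.sum_apply, map_smul, Matrix.smul_apply, mat_spechtVec, map_zero,
      Matrix.zero_apply] at h2
    rw [Finset.sum_eq_single s] at h2
    · rw [if_pos rfl, smul_eq_mul] at h2
      exact (mul_eq_zero.1 h2).resolve_right ht₁
    · intro u _ hu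
      rw [if_neg fun h ↦ hu (Subtype.ext h.symm), smul_zero]
    · simp
  have hsp : ⊤ ≤ Submodule.span ℂ (Set.range v) := by
    rintro ⟨z, hz⟩ -
    obtain ⟨g, hg, hgz⟩ := exists_mat_eq_of_mem_specht q hs h₀ hz
    have h1 : (⟨z, hz⟩ : specht q μ) = ∑ u : {t : Tab k // shape t = μ}, g u.1 • v u := by
      apply Subtype.ext
      apply mat_injective q
      ext s t
      have h2 : ((∑ u : {t : Tab k // shape t = μ}, g u.1 • v u : specht q μ) : Hecke q k) =
          ∑ u : {t : Tab k // shape t = μ}, g u.1 • spechtVec q ⟨s₀, hs⟩ u := by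
        simp [v]
      rw [h2]
      simp only [map_sum, Matrix.sum_apply, map_smul, Matrix.smul_apply, mat_spechtVec, hgz]
      by_cases hs' : shape s = μ
      · rw [Finset.sum_eq_single ⟨s, hs'⟩]
        · rw [if_pos rfl, smul_eq_mul]
        · intro u _ hu
          rw [if_neg fun h ↦ hu (Subtype.ext h.symm), smul_zero]
        · simp
      · rw [hg s hs', zero_mul]
        refine (Finset.sum_eq_zero fun u _ ↦ ?_).symm
        rw [if_neg, smul_zero]
        rintro rfl
        exact hs' u.2
    rw [h1]
    exact Submodule.sum_mem _ fun u _ ↦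
      Submodule.smul_mem _ _ (Submodule.subset_span ⟨u, rfl⟩)
  refine ⟨⟨s₀, hs⟩, Module.Basis.mk hli hsp, fun s ↦ ?_⟩
  rw [Module.Basis.mk_apply]

theorem character_eq_chi (μ : Shape k) (h : Hecke q k) : character q μ h = chi q μ h := by
  obtain ⟨s₀, B, hB⟩ := exists_basis_specht q μ
  have h1 : ∀ s, Algebra.lsmul ℂ ℂ (specht q μ) h (B s) =
      ∑ u : {t : Tab k // shape t = μ}, mat q k h u.1 s.1 • B u := fun s ↦ by
    apply Subtype.ext
    rw [Algebra.lsmul_coe, Submodule.coe_smul, hB, smul_eq_mul, smul_spechtVec]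
    simp [hB]
  rw [character, LinearMap.trace_eq_matrix_trace ℂ B, Matrix.trace, chi_apply, ← Finset.sum_filter,
    Finset.sum_subtype (p := fun t ↦ shape t = μ) _ (by simp)]
  refine Finset.sum_congr rfl fun s _ ↦ ?_
  rw [Matrix.diag_apply, LinearMap.toMatrix_apply, h1]
  simp [Finsupp.single_apply]

theorem tval_eq_tChi (μ : Shape k) : tval q μ = tChi q μ := by
  simp only [tval, tChi, character_eq_chi]

/-! ### The minimal central idempotents -/

theorem mat_center {e : Hecke q k} (he : e ∈ Subalgebra.center ℂ (Hecke q k)) {s t : Tab k}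
    (h : shape s = shape t) (u : Tab k) :
    mat q k e u s = if u = s then mat q k e t t else 0 := by
  have h1 := congrArg (fun z ↦ mat q k z u t)
    (Subalgebra.mem_center_iff.1 he (eunit q ⟨(s, t), h⟩))
  simp only [mat_eunit_mul, mat_mul_eunit, if_true] at h1
  exact h1.symm

theorem zElt_ne_zero (μ : Shape k) : zElt q μ ≠ 0 := by
  obtain ⟨t, ht⟩ := exists_tab μ
  intro h
  have h1 := congrArg (fun z ↦ mat q k z t t) h
  simp [mat_zElt, ht] at h1

theorem zElt_mul_of_mem_specht {μ : Shape k} {v : Hecke q k} (hv : v ∈ specht q μ) :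
    zElt q μ * v = v := by
  obtain ⟨s₀, hs, h₀⟩ := exists_superstandard μ
  obtain ⟨g, hg, hgv⟩ := exists_mat_eq_of_mem_specht q hs h₀ hv
  apply mat_injective q
  ext s t
  rw [mat_zElt_mul]
  split_ifs with h
  · rfl
  · rw [hgv, hg s h, zero_mul]

/-- A central element is a scalar on each matrix block, and an idempotent scalar is `0` or `1`. -/
theorem mul_zElt_eq {μ : Shape k} {e : Hecke q k} (he : e ∈ Subalgebra.center ℂ (Hecke q k))
    (hi : IsIdempotentElem e) : e * zElt q μ = 0 ∨ e * zElt q μ = zElt q μ := by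
  obtain ⟨t, ht⟩ := exists_tab μ
  have h1 : e * zElt q μ = mat q k e t t • zElt q μ := by
    apply mat_injective q
    ext u s
    rw [mat_mul_zElt, map_smul, Matrix.smul_apply, mat_zElt, Matrix.diagonal_apply]
    by_cases hs : shape s = μ
    · rw [if_pos hs, mat_center q he (hs.trans ht.symm)]
      split_ifs with h2 h3
      · simp
      · exact absurd (h2 ▸ hs) h3
      · simp
    · rw [if_neg hs]
      split_ifs with h2 h3
      · exact absurd (h2 ▸ h3) hs
      · simp
      · simp
  have h2 : mat q k e t t * mat q k e t t = mat q k e t t := by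
    have h3 := congrArg (fun z ↦ mat q k z t t) hi.eq
    simp only [map_mul, Matrix.mul_apply] at h3
    rw [Finset.sum_eq_single t] at h3
    · exact h3
    · intro u _ hu
      rw [mat_center q he (rfl : shape t = shape t) u, if_neg hu, mul_zero]
    · simp
  rw [h1]
  rcases IsIdempotentElem.iff_eq_zero_or_one.1 h2 with h | h
  · exact Or.inl (by rw [h, zero_smul])
  · exact Or.inr (by rw [h, one_smul])

theorem isCentralIdempotentOf_zElt (μ : Shape k) : IsCentralIdempotentOf q μ (zElt q μ) where
  central := Subalgebra.mem_center_iff.2 fun h ↦ (zElt_comm q μ h).symm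
  idem := by rw [IsIdempotentElem, zElt_mul_zElt, if_pos rfl]
  ne_zero := zElt_ne_zero q μ
  minimal e he hi hez := by
    have := mul_zElt_eq q (μ := μ) he hi
    rwa [hez] at this
  acts _ hv := zElt_mul_of_mem_specht q hv

/-- Both `z` and `zElt` act as the identity on a nonzero module, so their product is nonzero and
hence equals `zElt`; minimality of `z` then gives equality. -/
theorem IsCentralIdempotentOf.eq_zElt {μ : Shape k} {z : Hecke q k}
    (hz : IsCentralIdempotentOf q μ z) : z = zElt q μ := by
  obtain ⟨s₀, B, hB⟩ := exists_basis_specht q μ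
  have hc : zElt q μ ∈ Subalgebra.center ℂ (Hecke q k) :=
    (isCentralIdempotentOf_zElt q μ).central
  have h1 : z * zElt q μ ≠ 0 := by
    intro h0
    have h2 := hz.acts _ (B s₀).2
    have h3 : (B s₀ : Hecke q k) = 0 := by
      rw [← h2, ← zElt_mul_of_mem_specht q (B s₀).2, ← mul_assoc, h0, zero_mul]
    exact B.ne_zero s₀ (Subtype.ext h3)
  have h2 : z * zElt q μ = zElt q μ := (mul_zElt_eq q hz.central hz.idem).resolve_left h1
  have h3 : zElt q μ * z = zElt q μ := (zElt_comm q μ z).trans h2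
  exact ((hz.minimal _ hc (isCentralIdempotentOf_zElt q μ).idem h3).resolve_left
    (zElt_ne_zero q μ)).symm

theorem existsUnique_isCentralIdempotentOf (μ : Shape k) :
    ∃! z : Hecke q k, IsCentralIdempotentOf q μ z :=
  ⟨zElt q μ, isCentralIdempotentOf_zElt q μ, fun _ hz ↦ hz.eq_zElt q⟩

end Specht

/-! ### Weight spaces of tensor powers as induced modules -/

section WeightSpaces

variable (q : ℂˣ) {k : ℕ}

/-- The vectors `T_{w⁻¹}⁻¹ x` of the left ideal generated by a symmetrizer `x`, normalized so that
they only depend on the coset of `w`. -/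
def cosetVec (b : Fin k → ℕ) (w : Equiv.Perm (Fin k)) : Hecke q k :=
  (-(q : ℂ)) ^ len w • (primeFlip q k (Tperm q w) * symOf q q b)

theorem cosetVec_one (b : Fin k → ℕ) : cosetVec q b 1 = symOf q q b := by
  rw [cosetVec, len_one, pow_zero, one_smul, Tperm_one, map_one, one_mul]

/-- On the symmetrizer `-T_i⁻¹` acts by `-q⁻¹`, which the factor `(-q) ^ len w` is there to cancel.
-/
theorem cosetVec_mul_simple_of_lt {b : Fin k → ℕ} {i : Fin (k - 1)} (h : b (lo i) = b (hi i))
    {w : Equiv.Perm (Fin k)} (hw : w (lo i) < w (hi i)) :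
    cosetVec q b (w * simple k i) = cosetVec q b w := by
  have hq : (q : ℂ) ≠ 0 := q.ne_zero
  have h1 : primeFlip q k (T q k i) * symOf q q b = (-(q : ℂ)⁻¹) • symOf q q b := by
    rw [primeFlip_T, sub_mul, smul_mul_assoc, one_mul, T_mul_symOf q (q_mul_self q) h, ← sub_smul,
      ← sub_inv_eq_qhat, add_sub_cancel_left]
  rw [cosetVec, cosetVec, len_mul_simple_of_lt hw, Tperm_mul_simple q hw, map_mul, mul_assoc, h1,
    mul_smul_comm, smul_smul]
  congr 1
  rw [pow_succ]
  field_simp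

theorem cosetVec_mul_simple {b : Fin k → ℕ} {i : Fin (k - 1)} (h : b (lo i) = b (hi i))
    (w : Equiv.Perm (Fin k)) : cosetVec q b (w * simple k i) = cosetVec q b w := by
  rcases lo_lt_hi_or w i with hw | hw
  · exact cosetVec_mul_simple_of_lt q h hw
  · have h1 := cosetVec_mul_simple_of_lt q h (w := w * simple k i) (by
      rwa [Equiv.Perm.mul_apply, Equiv.Perm.mul_apply, simple_lo, simple_hi])
    rwa [mul_assoc, simple_mul_self, mul_one, eq_comm] at h1

theorem cosetVec_mul {b : Fin k → ℕ} (hb : Monotone b) {p : Equiv.Perm (Fin k)} (hp : b ∘ p = b)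
    (w : Equiv.Perm (Fin k)) : cosetVec q b (w * p) = cosetVec q b w := by
  refine block_induction hb (P := fun p ↦ cosetVec q b (w * p) = cosetVec q b w) ?_ ?_ p hp
  · rw [mul_one]
  · intro p i _ hi _ ih
    rw [← mul_assoc, cosetVec_mul_simple q hi, ih]

theorem cosetVec_simple_mul {b : Fin k → ℕ} {i : Fin (k - 1)} {w : Equiv.Perm (Fin k)}
    (hw : w⁻¹ (lo i) < w⁻¹ (hi i)) : cosetVec q b (simple k i * w) =
      (q : ℂ) • ((T q k i - qhat q • 1) * cosetVec q b w) := by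
  have h1 : Tperm q (simple k i * w) = T q k i * Tperm q w := by
    rw [T_mul_Tperm, if_neg hw.not_gt, add_zero]
  rw [cosetVec, cosetVec, len_simple_mul_of_lt hw, h1, map_mul, primeFlip_T, mul_smul_comm,
    smul_smul, mul_assoc, pow_succ', neg_mul, neg_smul, ← smul_neg, ← neg_mul, neg_sub]

theorem T_mul_cosetVec_mem (b : Fin k → ℕ) (i : Fin (k - 1)) (w : Equiv.Perm (Fin k)) :
    T q k i * cosetVec q b w ∈ Submodule.span ℂ (Set.range (cosetVec q b)) := by
  have hq : (q : ℂ) ≠ 0 := q.ne_zero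
  have hmem : ∀ w, cosetVec q b w ∈ Submodule.span ℂ (Set.range (cosetVec q b)) := fun w ↦
    Submodule.subset_span ⟨w, rfl⟩
  have key : ∀ w : Equiv.Perm (Fin k), w⁻¹ (lo i) < w⁻¹ (hi i) → T q k i * cosetVec q b w =
      (q : ℂ)⁻¹ • cosetVec q b (simple k i * w) + qhat q • cosetVec q b w := fun w hw ↦ by
    rw [cosetVec_simple_mul q hw, smul_smul, inv_mul_cancel₀ hq, one_smul, sub_mul,
      smul_mul_assoc, one_mul, sub_add_cancel]
  rcases lo_lt_hi_or w⁻¹ i with hw | hw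
  · rw [key w hw]
    exact Submodule.add_mem _ (Submodule.smul_mem _ _ (hmem _)) (Submodule.smul_mem _ _ (hmem _))
  · have hw' : (simple k i * w)⁻¹ (lo i) < (simple k i * w)⁻¹ (hi i) := by
      rw [mul_inv_rev, simple_inv, Equiv.Perm.mul_apply, Equiv.Perm.mul_apply, simple_lo,
        simple_hi]
      exact hw
    have h1 : cosetVec q b w =
        (q : ℂ) • ((T q k i - qhat q • 1) * cosetVec q b (simple k i * w)) := by
      rw [← cosetVec_simple_mul q hw', ← mul_assoc, simple_mul_self, one_mul]
    have h2 : T q k i * cosetVec q b w = (q : ℂ) • cosetVec q b (simple k i * w) := by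
      rw [h1, mul_smul_comm, ← mul_assoc, mul_sub, T_quad, mul_smul_comm, mul_one,
        add_sub_cancel_left, one_mul]
    rw [h2]
    exact Submodule.smul_mem _ _ (hmem _)

theorem mul_symOf_mem (b : Fin k → ℕ) (x : Hecke q k) :
    x * symOf q q b ∈ Submodule.span ℂ (Set.range (cosetVec q b)) := by
  have h := eq_top_of_mul_mem
    ((Submodule.span ℂ (Set.range (cosetVec q b))).comap (LinearMap.mulRight ℂ (symOf q q b)))
    (by
      rw [Submodule.mem_comap, LinearMap.mulRight_apply, one_mul, ← cosetVec_one]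
      exact Submodule.subset_span ⟨1, rfl⟩)
    (fun i x hx ↦ by
      rw [Submodule.mem_comap, LinearMap.mulRight_apply] at *
      rw [mul_assoc]
      generalize x * symOf q q b = y at hx ⊢
      induction hx using Submodule.span_induction with
      | mem y hy =>
        obtain ⟨w, rfl⟩ := hy
        exact T_mul_cosetVec_mem q b i w
      | zero => rw [mul_zero]; exact Submodule.zero_mem _
      | add y z _ _ hy hz => rw [mul_add]; exact Submodule.add_mem _ hy hz
      | smul a y _ hy => rw [mul_smul_comm]; exact Submodule.smul_mem _ _ hy)
  exact (h ▸ Submodule.mem_top : x ∈ Submodule.comap _ _)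

variable {N : ℕ}

/-- The orbit map of a basis vector of `V^{⊗ k}`. -/
def orbitMap (v : Fin k → Fin N) : Hecke q k →ₗ[ℂ] TensorPower k N :=
  LinearMap.applyₗ (Finsupp.single v 1) ∘ₗ (rho q k N).toLinearMap

theorem orbitMap_apply (v : Fin k → Fin N) (h : Hecke q k) :
    orbitMap q v h = rho q k N h (Finsupp.single v 1) := rfl

theorem orbitMap_mul (v : Fin k → Fin N) (a b : Hecke q k) :
    orbitMap q v (a * b) = rho q k N a (orbitMap q v b) := by
  rw [orbitMap_apply, map_mul]; rfl

theorem orbitMap_symOf {v : Fin k → Fin N} (hv : Monotone v) :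
    orbitMap q v (symOf q q (Fin.val ∘ v)) = poincare (q : ℂ) (Fin.val ∘ v) • Finsupp.single v 1 :=
  symOf_smul_of_forall q (rho q k N) (fun _ _ h ↦ hv h) fun i hi ↦ by
    rw [rho_T_single, if_pos (Fin.ext hi)]

variable [hq : Fact (Transcendental ℚ (q : ℂ))]

/-- Inverse generators are used because `T_i - (q - q⁻¹) = T_i⁻¹` sends a word with an ascent at `i`
to its plain exchange, so no correction terms arise when starting from the weakly increasing word
`v`. -/
theorem exists_orbitMap_cosetVec {v : Fin k → Fin N} (hv : Monotone v)
    (w : Equiv.Perm (Fin k)) : ∃ a : ℂ, a ≠ 0 ∧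
      orbitMap q v (cosetVec q (Fin.val ∘ v) w) = a • Finsupp.single (v ∘ ⇑w⁻¹) 1 := by
  have h0 : (q : ℂ) ≠ 0 := q.ne_zero
  induction hn : len w using Nat.strong_induction_on generalizing w with
  | _ n ih =>
    by_cases hw : w = 1
    · subst hw
      refine ⟨poincare (q : ℂ) (Fin.val ∘ v), poincare_ne_zero hq.out _, ?_⟩
      rw [cosetVec_one, orbitMap_symOf q hv, inv_one]
      rfl
    · obtain ⟨i, hd⟩ := exists_descent (inv_ne_one.2 hw)
      have hl := len_simple_mul_of_gt hd
      obtain ⟨a, ha, h1⟩ := ih (len (simple k i * w)) (by omega) (simple k i * w) rfl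
      have hw' : (simple k i * w)⁻¹ (lo i) < (simple k i * w)⁻¹ (hi i) := by
        rw [mul_inv_rev, simple_inv, Equiv.Perm.mul_apply, Equiv.Perm.mul_apply, simple_lo,
          simple_hi]
        exact hd
      have h2 : cosetVec q (Fin.val ∘ v) w = (q : ℂ) • ((T q k i - qhat q • 1) *
          cosetVec q (Fin.val ∘ v) (simple k i * w)) := by
        rw [← cosetVec_simple_mul q hw', ← mul_assoc, simple_mul_self, one_mul]
      have h3 : (v ∘ ⇑(simple k i * w)⁻¹) ∘ simple k i = v ∘ ⇑w⁻¹ := by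
        ext x
        simp [simple_inv]
      rw [h2, map_smul, orbitMap_mul, h1, map_smul, map_sub, LinearMap.sub_apply, rho_T_single,
        map_smul, map_one, LinearMap.smul_apply, Module.End.one_apply, h3]
      have hle : (v ∘ ⇑(simple k i * w)⁻¹) (lo i) ≤ (v ∘ ⇑(simple k i * w)⁻¹) (HeckeA.hi i) :=
        hv hw'.le
      rcases hle.eq_or_lt with h4 | h4
      · have h5 : v ∘ ⇑(simple k i * w)⁻¹ = v ∘ ⇑w⁻¹ := by
          rw [← h3]
          ext x
          rw [Function.comp_apply (g := simple k i)]
          by_cases hx : x = lo i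
          · rw [hx, simple_lo, h4]
          · by_cases hx' : x = HeckeA.hi i
            · rw [hx', simple_hi, h4]
            · rw [simple_of_ne i hx hx']
        refine ⟨a, ha, ?_⟩
        rw [if_pos h4, ← sub_smul, smul_smul, smul_smul, h5, ← sub_inv_eq_qhat]
        congr 1
        field_simp
        ring
      · refine ⟨q * a, mul_ne_zero h0 ha, ?_⟩
        rw [if_neg h4.ne, if_pos h4, add_sub_cancel_left, smul_smul]

theorem exists_perm_of_content_eq {u v : Fin k → Fin N} (h : content u = content v) :
    ∃ w : Equiv.Perm (Fin k), v ∘ ⇑w⁻¹ = u := by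
  have e : ∀ m, Nonempty ({i // u i = m} ≃ {i // v i = m}) := fun m ↦
    Fintype.card_eq.1 (by
      rw [Fintype.card_subtype, Fintype.card_subtype]
      exact congrFun h m)
  refine ⟨(Equiv.ofFiberEquiv fun m ↦ (e m).some)⁻¹, ?_⟩
  rw [inv_inv]
  exact funext fun i ↦ Equiv.ofFiberEquiv_map _ i

theorem content_comp (v : Fin k → Fin N) (w : Equiv.Perm (Fin k)) :
    content (v ∘ w) = content v := by
  ext j
  rw [content, content, ← Finset.card_map w.toEmbedding]
  congr 1
  ext i
  simp only [Finset.mem_map, Finset.mem_filter, Finset.mem_univ, true_and,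
    Equiv.coe_toEmbedding, Function.comp_apply]
  exact ⟨fun ⟨a, ha, h⟩ ↦ h ▸ ha, fun h ↦ ⟨w.symm i, by simpa using h, by simp⟩⟩

/-- The trace on a weight space is the trace of a two-sided multiplication on `H_k`. -/
theorem trace_contentProj_mul {v : Fin k → Fin N} (hv : Monotone v) (h : Hecke q k) :
    poincare (q : ℂ) (Fin.val ∘ v) *
        LinearMap.trace ℂ (TensorPower k N) (contentProj k N (content v) * rho q k N h) =
      LinearMap.trace ℂ (Hecke q k)
        (LinearMap.mulLeft ℂ h ∘ₗ LinearMap.mulRight ℂ (symOf q q (Fin.val ∘ v))) := by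
  set b : Fin k → ℕ := Fin.val ∘ v with hbdef
  have hb : Monotone b := fun _ _ h ↦ hv h
  have hP : poincare (q : ℂ) b ≠ 0 := poincare_ne_zero hq.out b
  choose a ha hav using fun w ↦ exists_orbitMap_cosetVec q hv w
  rw [← hbdef] at hav
  choose! p hp using fun u (hu : content u = content v) ↦ exists_perm_of_content_eq hu
  -- A section of the orbit map on the weight space of `v`, extended by zero to the other weight
  -- spaces.
  let σ : TensorPower k N →ₗ[ℂ] Hecke q k := Finsupp.linearCombination ℂ fun u ↦
    if content u = content v then (a (p u))⁻¹ • cosetVec q b (p u) else 0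
  have hσ : ∀ u, content u = content v → σ (Finsupp.single u 1) =
      (a (p u))⁻¹ • cosetVec q b (p u) := fun u hu ↦ by
    simp [σ, hu]
  have hLσ : orbitMap q v ∘ₗ σ = contentProj k N (content v) := by
    refine Finsupp.lhom_ext' fun u ↦ LinearMap.ext_ring ?_
    simp only [LinearMap.comp_apply, Finsupp.lsingle_apply]
    by_cases hu : content u = content v
    · rw [hσ u hu, map_smul, hav, smul_smul, inv_mul_cancel₀ (ha _), one_smul, hp u hu]
      simp [contentProj, hu]
    · simp [σ, contentProj, hu]
  -- The chosen permutation `p` need not be `w`, but it differs from `w` by an element of the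
  -- stabilizer, on which the coset vectors do not depend.
  have hZ : ∀ w, σ (orbitMap q v (cosetVec q b w)) = cosetVec q b w := fun w ↦ by
    have hu : content (v ∘ ⇑w⁻¹) = content v := content_comp v w⁻¹
    have h1 : cosetVec q b (p (v ∘ ⇑w⁻¹)) = cosetVec q b w := by
      have h2 := hp _ hu
      have h3 : b ∘ ⇑(w⁻¹ * p (v ∘ ⇑w⁻¹)) = b := by
        ext x
        have := congrFun h2 (p (v ∘ ⇑w⁻¹) x)
        have h4 : (p (v ∘ ⇑w⁻¹))⁻¹ (p (v ∘ ⇑w⁻¹) x) = x := Equiv.symm_apply_apply _ _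
        rw [Function.comp_apply, Function.comp_apply, h4] at this
        simp only [hbdef, Function.comp_apply, Equiv.Perm.mul_apply, this]
      have h4 := cosetVec_mul q hb h3 w
      rwa [mul_inv_cancel_left] at h4
    have h5 : a (p (v ∘ ⇑w⁻¹)) = a w := by
      have h6 := hav (p (v ∘ ⇑w⁻¹))
      rw [h1, hav, hp _ hu] at h6
      have h7 := DFunLike.congr_fun h6 (v ∘ ⇑w⁻¹)
      simpa using h7.symm
    rw [hav, map_smul, hσ _ hu, h1, h5, smul_smul, mul_inv_cancel₀ (ha w), one_smul]
  have hspan : ∀ z ∈ Submodule.span ℂ (Set.range (cosetVec q b)), σ (orbitMap q v z) = z := by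
    intro z hz
    induction hz using Submodule.span_induction with
    | mem y hy => obtain ⟨w, rfl⟩ := hy; exact hZ w
    | zero => rw [map_zero, map_zero]
    | add y z _ _ hy hz => rw [map_add, map_add, hy, hz]
    | smul c y _ hy => rw [map_smul, map_smul, hy]
  -- The orbit map sends `x * symOf` to the Poincaré polynomial times the image of `x`, and `σ`
  -- inverts the orbit map on the left ideal. The claim then follows from cyclicity of the trace.
  have hσL : LinearMap.mulRight ℂ (symOf q q b) = poincare (q : ℂ) b • (σ ∘ₗ orbitMap q v) := by
    ext x
    rw [LinearMap.mulRight_apply, ← hspan _ (mul_symOf_mem q b x), orbitMap_mul,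
      orbitMap_symOf q hv, map_smul, map_smul]
    rfl
  have hLh : orbitMap q v ∘ₗ LinearMap.mulLeft ℂ h = rho q k N h ∘ₗ orbitMap q v :=
    LinearMap.ext fun x ↦ orbitMap_mul q v h x
  rw [hσL, LinearMap.comp_smul, map_smul, smul_eq_mul, ← LinearMap.comp_assoc,
    LinearMap.trace_comp_comm', ← LinearMap.comp_assoc, hLh, LinearMap.comp_assoc, hLσ,
    ← Module.End.mul_eq_comp, LinearMap.trace_mul_comm]

theorem Ebasis_repr (x : Hecke q k) (p : TabPair k) :
    (Ebasis q k).repr x p = mat q k x p.1.1 p.1.2 := by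
  have h := congrArg (fun z ↦ mat q k z p.1.1 p.1.2) ((Ebasis q k).sum_repr x)
  simp only [map_sum, Matrix.sum_apply, map_smul, Matrix.smul_apply, Ebasis_apply, mat_eunit] at h
  rw [← h, Finset.sum_eq_single p]
  · simp
  · intro p' _ hp'
    rw [Matrix.single_apply, if_neg, smul_zero]
    exact fun h' ↦ hp' (Subtype.ext (Prod.ext h'.1 h'.2))
  · simp

/-- A block is `V_μ ⊗ V_μ*` as a bimodule, so the trace of a two-sided multiplication is a product
of two characters; it is computed in the basis of matrix units. -/
theorem trace_mulLeft_mulRight (h e : Hecke q k) :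
    LinearMap.trace ℂ (Hecke q k) (LinearMap.mulLeft ℂ h ∘ₗ LinearMap.mulRight ℂ e) =
      ∑ μ : Shape k, chi q μ h * chi q μ e := by
  have h1 : ∀ p : TabPair k, mat q k (h * (eunit q p * e)) p.1.1 p.1.2 =
      mat q k h p.1.1 p.1.1 * mat q k e p.1.2 p.1.2 := fun p ↦ by
    rw [map_mul, Matrix.mul_apply, Finset.sum_eq_single p.1.1]
    · rw [mat_eunit_mul, if_pos rfl]
    · intro u _ hu
      rw [mat_eunit_mul, if_neg hu, mul_zero]
    · simp
  rw [LinearMap.trace_eq_matrix_trace ℂ (Ebasis q k), Matrix.trace]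
  simp only [Matrix.diag_apply, LinearMap.toMatrix_apply, Ebasis_repr, LinearMap.comp_apply,
    LinearMap.mulLeft_apply, LinearMap.mulRight_apply, Ebasis_apply, h1, chi_apply,
    Finset.sum_mul_sum]
  rw [← Finset.sum_subtype (Finset.univ.filter fun p : Tab k × Tab k ↦ shape p.1 = shape p.2)
    (p := fun p ↦ shape p.1 = shape p.2) (by simp)
    fun p ↦ mat q k h p.1 p.1 * mat q k e p.2 p.2, Finset.sum_filter, Fintype.sum_prod_type]
  symm
  rw [Finset.sum_comm]
  refine Finset.sum_congr rfl fun s _ ↦ ?_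
  rw [Finset.sum_comm]
  refine Finset.sum_congr rfl fun t _ ↦ ?_
  rw [Finset.sum_eq_single (shape s)]
  · rw [if_pos rfl, mul_ite, mul_zero]
    exact if_congr eq_comm rfl rfl
  · intro μ _ hμ
    rw [if_neg hμ.symm, zero_mul]
  · simp

theorem trace_contentProj {v : Fin k → Fin N} (hv : Monotone v) (h : Hecke q k) :
    LinearMap.trace ℂ (TensorPower k N) (contentProj k N (content v) * rho q k N h) =
      ∑ μ : Shape k, chi q μ h * (fils (Fin.val ∘ v) μ).card := by
  have hb : Monotone (Fin.val ∘ v) := fun _ _ h ↦ hv h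
  have h1 := trace_contentProj_mul q hv h
  rw [trace_mulLeft_mulRight] at h1
  refine mul_left_cancel₀ (poincare_ne_zero hq.out (Fin.val ∘ v)) (h1.trans ?_)
  rw [Finset.mul_sum]
  refine Finset.sum_congr rfl fun μ _ ↦ ?_
  rw [chi_symOf q hb]
  ring

end WeightSpaces

/-! ### Ram's trace and Schur polynomials -/

section RamTrace

variable (q : ℂˣ) {k N : ℕ}

theorem prod_X_eq_monomial {ι : Type*} [Fintype ι] (g : ι → Fin N) :
    ∏ x, (MvPolynomial.X (g x) : MvPolynomial (Fin N) ℂ) =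
      MvPolynomial.monomial (Finsupp.equivFunOnFinite.symm fun j ↦
        (Finset.univ.filter fun x ↦ g x = j).card) 1 := by
  have h : Finsupp.equivFunOnFinite.symm (fun j ↦ (Finset.univ.filter fun x ↦ g x = j).card) =
      ∑ x, Finsupp.single (g x) 1 := by
    ext j
    rw [Finsupp.finsetSum_apply, Finsupp.equivFunOnFinite_symm_apply_apply, Finset.card_filter]
    exact Finset.sum_congr rfl fun x _ ↦ (Finsupp.single_apply ..).symm
  rw [h, MvPolynomial.monomial_sum_one]
  rfl

/-- The content of a semistandard tableau. -/
def ssytContent {μ : YoungDiagram} (S : BoundedSSYT μ N) (j : Fin N) : ℕ :=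
  (Finset.univ.filter fun c : μ.cells ↦
    (⟨S.1 c.1.1 c.1.2, S.2 c.1 c.2⟩ : Fin N) = j).card

theorem schur_eq_sum (μ : YoungDiagram) (N : ℕ) :
    schur μ N = ∑ S : BoundedSSYT μ N,
      MvPolynomial.monomial (Finsupp.equivFunOnFinite.symm (ssytContent S)) 1 :=
  Finset.sum_congr rfl fun _ _ ↦ prod_X_eq_monomial _

theorem ssytContent_eq_card {μ : YoungDiagram} (S : BoundedSSYT μ N) (j : Fin N) :
    ssytContent S j = (μ.cells.filter fun u ↦ S.1 u.1 u.2 = j.1).card := by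
  rw [ssytContent, ← Finset.card_map (Function.Embedding.subtype _)]
  congr 1
  ext u
  simp only [Finset.mem_map, Finset.mem_filter, Finset.mem_univ, true_and, Fin.ext_iff,
    Function.Embedding.subtype_apply, Subtype.exists, exists_and_right, exists_eq_right]
  exact ⟨fun ⟨h, h'⟩ ↦ ⟨h, h'⟩, fun ⟨h, h'⟩ ↦ ⟨h, h'⟩⟩

theorem sum_ssytContent {μ : YoungDiagram} (S : BoundedSSYT μ N) :
    ∑ j, ssytContent S j = μ.card := by
  simp only [ssytContent]
  rw [← Finset.card_eq_sum_card_fiberwise fun _ _ ↦ Finset.mem_coe.2 (Finset.mem_univ _)]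
  simp [YoungDiagram.card]

theorem exists_monotone_content {c : Fin N → ℕ} (hc : ∑ j, c j = k) :
    ∃ v : Fin k → Fin N, Monotone v ∧ content v = c := by
  have e : Nonempty (Fin k ≃ Σ j, Fin (c j)) := Fintype.card_eq.1 (by simp [hc])
  obtain ⟨e⟩ := e
  let u : Fin k → Fin N := fun i ↦ (e i).1
  refine ⟨u ∘ Tuple.sort u, Tuple.monotone_sort u, ?_⟩
  rw [content_comp]
  ext j
  rw [content, ← Fintype.card_subtype, ← Fintype.card_fin (c j)]
  refine Fintype.card_congr ((e.subtypeEquiv (q := fun x ↦ x.1 = j) fun _ ↦ Iff.rfl).trans ?_)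
  exact Equiv.sigmaSubtype j

/-- Every semistandard tableau of this content arises from a standard one through standardization.
Both kinds of filling vanish outside the diagram, so they can be compared as functions on all cells.
-/
theorem card_fils {v : Fin k → Fin N} (hv : Monotone v) (μ : Shape k) :
    (fils (Fin.val ∘ v) μ).card =
      (Finset.univ.filter fun S : BoundedSSYT μ.1 N ↦ ssytContent S = content v).card := by
  have hb : Monotone (Fin.val ∘ v) := fun _ _ h ↦ hv h
  symm
  refine Finset.card_bij (fun S _ u ↦ S.1 u.1 u.2) (fun S hS ↦ ?_) (fun S _ S' _ h ↦ ?_)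
    (fun F hF ↦ ?_)
  · have hS' : ssytContent S = content v := (Finset.mem_filter.1 hS).2
    obtain ⟨t, ht, hS₂, -⟩ := exists_tab_of_filling hb μ (F := fun u ↦ S.1 u.1 u.2)
      (fun u w huw hw ↦ (S.1.row_weak_of_le huw.2
        (μ.1.isLowerSet (show ((u.1, w.2) : ℕ × ℕ) ≤ w from ⟨huw.1, le_rfl⟩) hw)).trans
          (S.1.col_weak huw.1 hw)) (fun m ↦ by
        by_cases hm : m < N
        · have h1 := ssytContent_eq_card S ⟨m, hm⟩
          rw [hS', content] at h1
          rw [← h1]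
          simp only [Fin.ext_iff, Function.comp_apply]
        · refine (Finset.card_eq_zero.2 (Finset.filter_false_of_mem fun u hu h ↦ ?_)).trans
            (Finset.card_eq_zero.2 (Finset.filter_false_of_mem fun i _ h ↦ ?_)).symm
          · exact hm (h ▸ S.2 u hu)
          · exact hm (h ▸ (v i).2))
    have hfil : fil (Fin.val ∘ v) t.1 = fun u ↦ S.1 u.1 u.2 := by
      ext u
      by_cases hu : u ∈ (shape t).1
      · obtain ⟨i, rfl⟩ := mem_shape.1 hu
        rw [fil_apply _ t.2.1, hS₂]
      · rw [fil_eq_zero _ hu, S.1.zeros (by rwa [ht] at hu)]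
    refine Finset.mem_image.2 ⟨t, Finset.mem_filter.2 ⟨Finset.mem_univ _, ht, ?_⟩, hfil⟩
    rw [hfil]
    exact fun r c h ↦ S.1.col_strict (Nat.lt_succ_self r) h
  · exact Subtype.ext (SemistandardYoungTableau.ext fun i j ↦ congrFun h (i, j))
  · obtain ⟨t, ht, rfl⟩ := Finset.mem_image.1 hF
    obtain ⟨rfl, hs⟩ := (Finset.mem_filter.1 ht).2
    have hbd : ∀ u ∈ (shape t).1.cells, fil (Fin.val ∘ v) t.1 u < N := fun u hu ↦ by
      obtain ⟨i, rfl⟩ := mem_cells.1 hu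
      rw [fil_apply _ t.2.1]
      exact (v i).2
    refine ⟨⟨⟨fun i j ↦ fil (Fin.val ∘ v) t.1 (i, j), fun hj h ↦ fil_mono hb t ⟨le_rfl, hj.le⟩ h,
      fun hi h ↦ lt_of_isSemi hs hi h, fun h ↦ fil_eq_zero _ h⟩, fun u hu ↦ hbd u hu⟩, ?_, rfl⟩
    refine Finset.mem_filter.2 ⟨Finset.mem_univ _, funext fun j ↦ ?_⟩
    rw [ssytContent_eq_card]
    refine (card_fil_eq (Fin.val ∘ v) t j.1).trans ?_
    rw [content]
    simp only [Fin.ext_iff, Function.comp_apply]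

variable [hq : Fact (Transcendental ℚ (q : ℂ))]

/-- The Frobenius formula for the Hecke algebra. Every content is that of a weakly increasing word,
for which the weight space trace is known; the Kostka numbers then assemble the monomials into Schur
polynomials. -/
theorem ramTrace_eq (N : ℕ) (h : Hecke q k) :
    ramTrace q k N h = ∑ μ : Shape k, chi q μ h • schur μ.1 N := by
  have h1 : ∀ c ∈ Finset.piAntidiag (Finset.univ : Finset (Fin N)) k,
      LinearMap.trace ℂ (TensorPower k N) (contentProj k N c * rho q k N h) =
        ∑ μ : Shape k, chi q μ h *
          (Finset.univ.filter fun S : BoundedSSYT μ.1 N ↦ ssytContent S = c).card := by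
    intro c hc
    obtain ⟨v, hv, rfl⟩ := exists_monotone_content (Finset.mem_piAntidiag.1 hc).1
    simp only [trace_contentProj q hv, card_fils hv]
  have h2 : ∀ μ : Shape k, schur μ.1 N = ∑ c ∈ Finset.piAntidiag (Finset.univ : Finset (Fin N)) k,
      ((Finset.univ.filter fun S : BoundedSSYT μ.1 N ↦ ssytContent S = c).card : ℂ) •
        MvPolynomial.monomial (Finsupp.equivFunOnFinite.symm c) 1 := fun μ ↦ by
    rw [schur_eq_sum, ← Finset.sum_fiberwise_of_maps_to
      (t := Finset.piAntidiag (Finset.univ : Finset (Fin N)) k) (g := ssytContent)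
      fun S _ ↦ Finset.mem_piAntidiag.2 ⟨(sum_ssytContent S).trans μ.2, by simp⟩]
    refine Finset.sum_congr rfl fun c _ ↦ ?_
    rw [Finset.sum_congr rfl fun S hS ↦ by rw [(Finset.mem_filter.1 hS).2], Finset.sum_const,
      ← Nat.cast_smul_eq_nsmul ℂ]
  simp only [h2, Finset.smul_sum]
  rw [Finset.sum_comm, ramTrace, LinearMap.sum_apply]
  refine Finset.sum_congr rfl fun c hc ↦ ?_
  change MvPolynomial.monomial (Finsupp.equivFunOnFinite.symm c)
    (LinearMap.trace ℂ (TensorPower k N) (contentProj k N c * rho q k N h)) = _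
  rw [h1 c hc, map_sum]
  refine Finset.sum_congr rfl fun μ _ ↦ ?_
  rw [smul_smul, MvPolynomial.smul_monomial, smul_eq_mul, mul_one]

/-! ### The spectral decomposition -/

theorem centralIdempotent_eq (μ : Shape k) : centralIdempotent q μ = zElt q μ :=
  (Classical.epsilon_spec (p := IsCentralIdempotentOf q μ)
    ⟨_, isCentralIdempotentOf_zElt q μ⟩).eq_zElt q

theorem tval_ne_zero (μ : Shape k) : tval q μ ≠ 0 := by
  obtain ⟨t, rfl⟩ := exists_tab μ
  rw [tval_eq_tChi]
  exact tChi_shape_ne_zero q t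

theorem tval_smul_proj (μ : Shape k) :
    tval q μ • proj q μ = antisymmetrizer q k * (1 ⊗ₜ[ℂ] zElt q μ) := by
  rw [proj, smul_inv_smul₀ (tval_ne_zero q μ), centralIdempotent_eq, antisymmetrizer_mul_tmul,
    zElt_mul_zElt, if_pos rfl]

theorem proj_eq (μ : Shape k) :
    proj q μ = (tval q μ)⁻¹ • (antisymmetrizer q k * (1 ⊗ₜ[ℂ] zElt q μ)) := by
  rw [← tval_smul_proj, inv_smul_smul₀ (tval_ne_zero q μ)]

theorem antisymmetrizer_eq_sum_proj :
    antisymmetrizer q k = ∑ μ : Shape k, tval q μ • proj q μ := by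
  simp only [tval_smul_proj]
  rw [← Finset.mul_sum, ← TensorProduct.tmul_sum, sum_zElt, ← Algebra.TensorProduct.one_def,
    mul_one]

theorem proj_mul_proj (μ ν : Shape k) :
    proj q μ * proj q ν = if μ = ν then proj q μ else 0 := by
  rw [proj_eq, proj_eq, smul_mul_smul_comm, antisymmetrizer_zElt_mul]
  split_ifs with h
  · subst h
    rw [← tval_eq_tChi, smul_smul, inv_mul_cancel_right₀ (tval_ne_zero q μ)]
  · rw [smul_zero]

theorem ramTrace₂_proj (N : ℕ) (μ : Shape k) :
    ramTrace₂ q k N (proj q μ) = schur μ.conj.1 N * schur μ.1 N := by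
  have h1 : ∀ a b : Hecke q k, ramTrace₂ q k N (a ⊗ₜ[ℂ] b) = ramTrace q k N a * ramTrace q k N b :=
    fun a b ↦ rfl
  -- The idempotent in the second leg reduces the Frobenius formula to the single shape `μ`.
  have h2 : ∀ b : Hecke q k, ramTrace q k N (b * zElt q μ) = chi q μ b • schur μ.1 N := fun b ↦ by
    rw [ramTrace_eq, Finset.sum_eq_single μ]
    · rw [chi_mul_zElt, if_pos rfl]
    · intro ν _ hν
      rw [chi_mul_zElt, if_neg hν, zero_smul]
    · simp
  rw [proj_eq, map_smul, antisymmetrizer_eq, Finset.sum_mul, map_sum]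
  simp only [Algebra.TensorProduct.tmul_mul_tmul, mul_one, h1, h2, ramTrace_eq, chi_prime]
  have h3 : ∀ w : Equiv.Perm (Fin k),
      (∑ ν : Shape k, chi q ν.conj (Tperm q w⁻¹) • schur ν.1 N) *
        (chi q μ (Tperm q w) • schur μ.1 N) =
      ∑ ν : Shape k, (chi q ν.conj (Tperm q w⁻¹) * chi q μ (Tperm q w)) •
        (schur ν.1 N * schur μ.1 N) := fun w ↦ by
    rw [Finset.sum_mul]
    exact Finset.sum_congr rfl fun ν _ ↦ smul_mul_smul_comm _ _ _ _
  simp only [h3]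
  rw [Finset.sum_comm]
  simp only [← Finset.sum_smul, sum_chi_mul_chi_eq]
  -- The involution in the first leg has replaced `χ^ν` by `χ^{ν'}`, so orthogonality retains
  -- exactly `ν = μ'`, with the factor `t_μ` that cancels the normalization.
  rw [Finset.sum_eq_single μ.conj]
  · rw [Shape.conj_conj, if_pos rfl, ← tval_eq_tChi, smul_smul,
      inv_mul_cancel₀ (tval_ne_zero q μ), one_smul]
  · intro ν _ hν
    rw [if_neg, zero_smul]
    rintro rfl
    exact hν (Shape.conj_conj ν).symm
  · simp

end RamTrace

end HeckeA

end

open HeckeA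

theorem mainTheorem4 (q : ℂˣ) (hq : Transcendental ℚ (q : ℂ)) (k N : ℕ) (hk : 0 < k)
    (hN : 0 < N) :
    -- the minimal central idempotents `z_λ` are well defined, and `z_λ' = z_{λ'}`
    (∀ μ : Shape k, (∃! z : Hecke q k, IsCentralIdempotentOf q μ z) ∧
      IsCentralIdempotentOf q μ (centralIdempotent q μ)) ∧
    (∀ μ : Shape k, prime q k (centralIdempotent q μ) = centralIdempotent q μ.conj) ∧
    -- the spectral decomposition
    (∀ μ : Shape k, tval q μ ≠ 0) ∧
    antisymmetrizer q k = ∑ μ : Shape k, tval q μ • proj q μ ∧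
    (∀ μ : Shape k, IsIdempotentElem (proj q μ)) ∧
    (∀ μ ν : Shape k, μ ≠ ν → proj q μ * proj q ν = 0) ∧
    -- the trace formula
    (∀ μ : Shape k, ramTrace₂ q k N (proj q μ) = schur μ.conj.1 N * schur μ.1 N) := by
  have := Fact.mk hq
  refine ⟨fun μ ↦ ⟨existsUnique_isCentralIdempotentOf q μ, ?_⟩, fun μ ↦ ?_, tval_ne_zero q,
    antisymmetrizer_eq_sum_proj q, fun μ ↦ ?_, fun μ ν h ↦ ?_, ramTrace₂_proj q N⟩
  · rw [centralIdempotent_eq]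
    exact isCentralIdempotentOf_zElt q μ
  · rw [centralIdempotent_eq, centralIdempotent_eq, prime_zElt]
  · rw [IsIdempotentElem, proj_mul_proj, if_pos rfl]
  · rw [proj_mul_proj, if_neg h]
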